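/- **Theorem.** Let $N\ge 1$ and let $\Omega\subset\mathbb{R}^N$ be a nonempty bounded open set with Lipschitz boundary. Let $0=\sigma_1(\Omega)\le\sigma_2(\Omega)\le\dots$ be its Steklov eigenvalues, counted with multiplicity: $\sigma_k(\Omega)$ is the infimum of the Rayleigh quotient $\int_\Omega|\nabla u|^2\,dx\big/\int_{\partial\Omega}|u|^2\,d\mathcal{H}^{N-1}$ among the functions $u\in W^{1,2}(\Omega)$ with nonzero trace on $\partial\Omega$ that are orthogonal in $L^2(\partial\Omega)$ to the first $k-1$ eigenfunctions (which are obtained by successively minimizing this quotient; boundary values are meant in the trace sense). Let $\omega_N$ be the volume of the unit ball of $\mathbb{R}^N$, let $\Omega^*$ be the open ball centered at the origin with $|\Omega^*|=|\Omega|$, and let $x_{\partial\Omega}=\frac{1}{\mathcal{H}^{N-1}(\partial\Omega)}\int_{\partial\Omega}x\,d\mathcal{H}^{N-1}$ be the barycenter of $\partial\Omega$. Then for every open ball $B\subset\mathbb{R}^N$ $$\frac{1}{|\Omega|^{1/N}}\sum_{k=2}^{N+1}\frac{1}{\sigma_k(\Omega)}-\frac{1}{|B|^{1/N}}\sum_{k=2}^{N+1}\frac{1}{\sigma_k(B)}\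 \ge\ \mathfrak{c}_N\left(\frac{|\Omega\,\Delta\,(\Omega^*+x_{\partial\Omega})|}{|\Omega|}\right)^2,\qquad \mathfrak{c}_N=\frac{(N+1)\,N}{\omega_N^{1/N}}\,\frac{(2^{1/N}-1)^2}{8}>0,$$ where $1/0=+\infty$ (if $\Omega$ is disconnected, then $\sigma_2(\Omega)=0$ and the left-hand side is $+\infty$). -/

import Mathlib

open MeasureTheory Filter Topology
open scoped ENNReal ContDiff

namespace Steklov

noncomputable section

/-- `Ω` has Lipschitz boundary: near each boundary point `p`, with respect to some unit
direction `e`, the set `Ω` is the strict epigraph of a Lipschitz function `γ` of the component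
`x - ⟪e, x⟫ e` of `x` orthogonal to `e`. -/
def HasLipschitzBoundary {N : ℕ} (Ω : Set (EuclideanSpace ℝ (Fin N))) : Prop :=
  ∀ p ∈ frontier Ω, ∃ e : EuclideanSpace ℝ (Fin N), ‖e‖ = 1 ∧
    ∃ (K : NNReal) (γ : EuclideanSpace ℝ (Fin N) → ℝ), LipschitzWith K γ ∧
      ∃ U : Set (EuclideanSpace ℝ (Fin N)), IsOpen U ∧ p ∈ U ∧
        ∀ x ∈ U, (x ∈ Ω ↔ γ (x - inner ℝ e x • e) < inner ℝ e x)

/-- The surface measure on `∂Ω`, i.e. the restriction to `∂Ω` of the `(N-1)`-dimensional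
Hausdorff measure, in its Euclidean normalization. -/
def boundaryMeasure {N : ℕ} (Ω : Set (EuclideanSpace ℝ (Fin N))) :
    Measure (EuclideanSpace ℝ (Fin N)) :=
  (Measure.euclideanHausdorffMeasure (N - 1)).restrict (frontier Ω)

/-- `G` is the distributional gradient of `u` in `Ω`. -/
def IsWeakGradient {N : ℕ} (Ω : Set (EuclideanSpace ℝ (Fin N)))
    (u : EuclideanSpace ℝ (Fin N) → ℝ)
    (G : EuclideanSpace ℝ (Fin N) → EuclideanSpace ℝ (Fin N)) : Prop :=
  ∀ φ : EuclideanSpace ℝ (Fin N) → ℝ, ContDiff ℝ ∞ φ → HasCompactSupport φ → tsupport φ ⊆ Ω →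
    ∫ x in Ω, u x • gradient φ x = - ∫ x in Ω, φ x • G x

/-- `g` is the trace on `∂Ω` of the function `u` whose gradient in `Ω` is `G`: there are smooth
functions `φ n` on the whole space, converging to `u` in `W^{1,2}(Ω)`, whose restrictions to `∂Ω`
converge to `g` in `L²(∂Ω)`. -/
def IsTrace {N : ℕ} (Ω : Set (EuclideanSpace ℝ (Fin N)))
    (u : EuclideanSpace ℝ (Fin N) → ℝ)
    (G : EuclideanSpace ℝ (Fin N) → EuclideanSpace ℝ (Fin N))
    (g : EuclideanSpace ℝ (Fin N) → ℝ) : Prop :=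
  ∃ φ : ℕ → EuclideanSpace ℝ (Fin N) → ℝ, (∀ n, ContDiff ℝ ∞ (φ n)) ∧
    Tendsto (fun n => eLpNorm (fun x => φ n x - u x) 2 (volume.restrict Ω)) atTop (𝓝 0) ∧
    Tendsto (fun n => eLpNorm (fun x => gradient (φ n) x - G x) 2 (volume.restrict Ω))
      atTop (𝓝 0) ∧
    Tendsto (fun n => eLpNorm (fun x => φ n x - g x) 2 (boundaryMeasure Ω)) atTop (𝓝 0)

/-- A function of `W^{1,2}(Ω)`, together with its weak gradient and its trace on `∂Ω`. (If `Ω` is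
bounded with Lipschitz boundary, each element of `W^{1,2}(Ω)` has exactly one weak gradient and
exactly one trace, up to null sets.) -/
structure W12 {N : ℕ} (Ω : Set (EuclideanSpace ℝ (Fin N))) where
  /-- the function -/
  fn : EuclideanSpace ℝ (Fin N) → ℝ
  /-- its weak gradient -/
  grad : EuclideanSpace ℝ (Fin N) → EuclideanSpace ℝ (Fin N)
  /-- its trace on the boundary -/
  trace : EuclideanSpace ℝ (Fin N) → ℝ
  memLp_fn : MemLp fn 2 (volume.restrict Ω)
  memLp_grad : MemLp grad 2 (volume.restrict Ω)
  isWeakGradient : IsWeakGradient Ω fn grad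
  memLp_trace : MemLp trace 2 (boundaryMeasure Ω)
  isTrace : IsTrace Ω fn grad trace

/-- The Rayleigh quotient `∫_Ω |∇u|² / ∫_{∂Ω} |u|²`. -/
def W12.rayleigh {N : ℕ} {Ω : Set (EuclideanSpace ℝ (Fin N))} (u : W12 Ω) : ℝ≥0∞ :=
  (∫⁻ x in Ω, ‖u.grad x‖ₑ ^ 2) / (∫⁻ x, ‖u.trace x‖ₑ ^ 2 ∂(boundaryMeasure Ω))

/-- `u` is orthogonal to `v` in `L²(∂Ω)`. -/
def W12.BdryOrthogonal {N : ℕ} {Ω : Set (EuclideanSpace ℝ (Fin N))} (u v : W12 Ω) : Prop :=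
  ∫ x, u.trace x * v.trace x ∂(boundaryMeasure Ω) = 0

/-- The trace of `u` is not zero in `L²(∂Ω)`, so that the Rayleigh quotient makes sense. -/
def W12.TraceNeZero {N : ℕ} {Ω : Set (EuclideanSpace ℝ (Fin N))} (u : W12 Ω) : Prop :=
  ∫⁻ x, ‖u.trace x‖ₑ ^ 2 ∂(boundaryMeasure Ω) ≠ 0

/-- `S 0, …, S (m-1)` are the first `m` Steklov eigenfunctions of `Ω` (for some choice of them
within the eigenspaces): each minimizes the Rayleigh quotient among the functions which are
orthogonal in `L²(∂Ω)` to the previous ones. -/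
def IsFirstEigenfunctions {N : ℕ} (Ω : Set (EuclideanSpace ℝ (Fin N))) {m : ℕ}
    (S : Fin m → W12 Ω) : Prop :=
  ∀ j : Fin m, (S j).TraceNeZero ∧ (∀ i < j, (S j).BdryOrthogonal (S i)) ∧
    ∀ v : W12 Ω, v.TraceNeZero → (∀ i < j, v.BdryOrthogonal (S i)) →
      (S j).rayleigh ≤ v.rayleigh

/-- The `k`-th Steklov eigenvalue `σ_k(Ω)`, `k ≥ 1`, numbered with multiplicity and so that
`σ_1(Ω) = 0`: the infimum of the Rayleigh quotient among the functions which are orthogonal in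
`L²(∂Ω)` to the first `k - 1` eigenfunctions. (The infimum does not depend on the choice of the
first `k - 1` eigenfunctions; the outer supremum is over all the choices.) -/
def eigenvalue {N : ℕ} (Ω : Set (EuclideanSpace ℝ (Fin N))) (k : ℕ) : ℝ≥0∞ :=
  ⨆ (S : Fin (k - 1) → W12 Ω) (_ : IsFirstEigenfunctions Ω S),
    ⨅ (u : W12 Ω) (_ : u.TraceNeZero) (_ : ∀ i, u.BdryOrthogonal (S i)), u.rayleigh

/-- `|Ω|^{-1/N} ∑_{k=2}^{N+1} 1/σ_k(Ω)`, with `1/0 = ∞`. -/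
def scaledInverseSum {N : ℕ} (Ω : Set (EuclideanSpace ℝ (Fin N))) : ℝ≥0∞ :=
  (volume Ω ^ (1 / (N : ℝ)))⁻¹ * ∑ k ∈ Finset.Icc 2 (N + 1), (eigenvalue Ω k)⁻¹

/-- The volume `ω_N` of the unit ball of `ℝ^N`. -/
def unitBallVolume (N : ℕ) : ℝ :=
  volume.real (Metric.ball (0 : EuclideanSpace ℝ (Fin N)) 1)

/-- `Ω^*`: the open ball centered at the origin whose volume is that of `Ω`. -/
def symmBall {N : ℕ} (Ω : Set (EuclideanSpace ℝ (Fin N))) : Set (EuclideanSpace ℝ (Fin N)) :=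
  Metric.ball 0 ((volume.real Ω / unitBallVolume N) ^ (1 / (N : ℝ)))

/-- The barycenter of the boundary, the mean of `x` over `∂Ω`. -/
def boundaryBarycenter {N : ℕ} (Ω : Set (EuclideanSpace ℝ (Fin N))) :
    EuclideanSpace ℝ (Fin N) :=
  ⨍ x, x ∂(boundaryMeasure Ω)

/-- `(N+1) N / ω_N^{1/N} * (2^{1/N} - 1)² / 8`. -/
def stabilityConst (N : ℕ) : ℝ :=
  ((N : ℝ) + 1) * N / unitBallVolume N ^ (1 / (N : ℝ)) * ((2 : ℝ) ^ (1 / (N : ℝ)) - 1) ^ 2 / 8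

end

end Steklov

/-!
The two sides are compared with `N / ω_N ^ (1 / N)`: the scaled sum for a ball does not exceed this
number, and the scaled sum for `Ω` exceeds it by the stability term.

*The domain.* Put `c = x_{∂Ω}`. The affine functions which vanish at `c` have mean zero on `∂Ω`.
Diagonalizing the second moments of `∂Ω` about `c` and testing with affine functions gives
`∑ 1 / σ_k(Ω) ≥ |Ω|⁻¹ ∫_{∂Ω} |x - c|²` (`integral_sq_div_le_sum_inv_eigenvalue`); a dimension count
supplies a test function orthogonal to whatever first eigenfunctions have been chosen.

*The moment of inertia of the boundary.* The divergence inequality `∫_Ω div V ≤ ∫_{∂Ω} |V|`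
(`integral_divergence_le`), with `V = |x - c| (x - c)`, gives
`∫_{∂Ω} |x - c|² ≥ (N + 1) ∫_Ω |x - c|`. The last integral is compared with the one over the ball
`B` of the same volume around `c`: the mass of `Ω \ B` lies outside `B` and that of `B \ Ω` inside,
and a constant portion of it at a distance from `∂B` which is proportional to the asymmetry
(`mul_symmDiff_sq_le_integral_norm_sub`). On `B` the divergence theorem gives equality.

The divergence inequality needs only that `∂Ω` has finite surface measure. For a fixed direction `e`
the difference quotients of `φ`, integrated over `Ω`, are integrals of `φ` over the points swept by
`∂Ω` moving along `e`, and the volume swept is controlled by the projection along `e`, which is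
`1`-Lipschitz. For a vector field, `V` is frozen on the pieces of a fine partition of unity of `∂Ω`.

*The ball.* It has to be shown that `σ_k(B) ≥ 1 / r` for `2 ≤ k ≤ N + 1`, if `r` is the radius; that
is, `∫_{∂B} f² ≤ r ∫_B |∇f|²` for `f` of mean zero on `∂B` (`integral_sq_le_of_integral_eq_zero`).
The bound `r |∂B| ≤ N |B|`, which comes from cones over small pieces of the sphere, makes the radial
field an equality case of the divergence inequality, and the first-order condition for equality is
the divergence theorem on the ball (`integral_divergence_ball`). If `f` is odd in a hyperplane, the
inequality follows from the divergence theorem with the linear function vanishing on the hyperplane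
as a ground state. In general, let `f` be replaced by its even part in a hyperplane: the deficit
`r ∫_B |∇f|² - ∫_{∂B} f²` splits into those of the even and the odd part, so it does not increase.
Finally, iterated symmetrizations of `f` come arbitrarily close to zero on `∂B`, by compactness, so
that the deficit is nonnegative. The first eigenfunctions of the ball are the constant and the
coordinates.
-/

namespace Steklov

open scoped Pointwise BoundedContinuousFunction

variable {N : ℕ}

local notation "𝔼" => EuclideanSpace ℝ (Fin N)

/-! ### Hausdorff measure, projections and cones -/

lemma euclideanHausdorffMeasure_image_le {X Y : Type*} [EMetricSpace X] [MeasurableSpace X]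
    [BorelSpace X] [EMetricSpace Y] [MeasurableSpace Y] [BorelSpace Y] {f : X → Y} {s : Set X}
    {K : NNReal} (hf : LipschitzOnWith K f s) (d : ℕ) :
    μHE[d] (f '' s) ≤ (K : ℝ≥0∞) ^ d * μHE[d] s := by
  have h := hf.hausdorffMeasure_image_le (d := (d : ℝ)) (by positivity)
  rw [ENNReal.rpow_natCast] at h
  simp only [Measure.euclideanHausdorffMeasure_def, Measure.smul_apply, ENNReal.smul_def,
    smul_eq_mul]
  calc _ ≤ _ * ((K : ℝ≥0∞) ^ d * μH[(d : ℝ)] s) := by gcongr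
    _ = _ := by ring

/-- The volume of a set lying in a slab of direction `e`, above a set `A`, is at most the width of
the slab times the surface measure of `A`: the projection along `e` is `1`-Lipschitz. -/
lemma volume_le_width_mul_hausdorff {e : 𝔼} (he : ‖e‖ = 1) {A T : Set 𝔼} {a b : ℝ}
    (hab : ∀ x ∈ T, inner ℝ e x ∈ Set.Icc a b) (hT : ∀ x ∈ T, ∃ y ∈ A, ∃ t : ℝ, x = y + t • e) :
    volume T ≤ ENNReal.ofReal (b - a) * μHE[N - 1] A := by
  have he0 : e ≠ 0 := by rintro rfl; simp at he
  set s : Submodule ℝ 𝔼 := ℝ ∙ e with hs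
  have hmp := s.measurePreserving_measurableEquivProd (0 : 𝔼)
  rw [InnerProductSpace.euclideanHausdorffMeasure_eq_volume] at hmp
  let f : ℝ → s := fun t => t • (⟨e, Submodule.mem_span_singleton_self e⟩ : s)
  have hf : Isometry f := by
    refine Isometry.of_dist_eq fun x y => ?_
    simp only [f, dist_eq_norm, ← sub_smul, norm_smul]
    simp [he]
  have hrank : Module.finrank ℝ s = 1 := finrank_span_singleton he0
  have hrank' : Module.finrank ℝ sᗮ = N - 1 := by
    have := s.finrank_add_finrank_orthogonal
    rw [hrank] at this
    simp at this
    omega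
  have hsub : T ⊆ s.measurableEquivProd (0 : 𝔼) ⁻¹'
      ((f '' Set.Icc a b) ×ˢ (sᗮ.orthogonalProjectionOnto '' A)) := by
    intro x hx
    simp only [Set.mem_preimage, Submodule.measurableEquivProd_apply, Set.mem_prod, vsub_eq_sub,
      sub_zero]
    refine ⟨⟨inner ℝ e x, hab x hx, ?_⟩, ?_⟩
    · apply Subtype.ext
      simp only [f]
      rw [← Submodule.starProjection_apply, Submodule.starProjection_unit_singleton ℝ he]
      rfl
    · obtain ⟨y, hy, t, rfl⟩ := hT x hx
      refine ⟨y, hy, ?_⟩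
      have h0 : sᗮ.orthogonalProjectionOnto e = 0 := by
        rw [Submodule.orthogonalProjectionOnto_eq_zero_iff, Submodule.orthogonal_orthogonal]
        exact Submodule.mem_span_singleton_self e
      rw [map_add, map_smul, h0, smul_zero, add_zero]
  refine (measure_mono hsub).trans ?_
  rw [hmp.measure_preimage_equiv, Measure.volume_eq_prod, Measure.prod_prod]
  gcongr
  · rw [← InnerProductSpace.euclideanHausdorffMeasure_eq_volume, hrank,
      hf.euclideanHausdorffMeasure_image]
    have : (μHE[1] : Measure ℝ) = volume := by
      rw [← InnerProductSpace.euclideanHausdorffMeasure_eq_volume]; simp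
    rw [this, Real.volume_Icc]
  · rw [← InnerProductSpace.euclideanHausdorffMeasure_eq_volume, hrank']
    have := euclideanHausdorffMeasure_image_le (f := sᗮ.orthogonalProjectionOnto) (s := A) (K := 1)
      (LipschitzWith.lipschitzOnWith (by
        refine LipschitzWith.of_dist_le_mul fun x y => ?_
        rw [dist_eq_norm, dist_eq_norm, ← map_sub, NNReal.coe_one, one_mul]
        exact sᗮ.norm_orthogonalProjectionOnto_apply_le _)) (N - 1)
    simpa using this

lemma lipschitzOnWith_normalize {A : Set 𝔼} (hA : ∀ x ∈ A, 1 ≤ ‖x‖) :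
    LipschitzOnWith 1 (fun x : 𝔼 => ‖x‖⁻¹ • x) A := by
  refine LipschitzOnWith.of_dist_le_mul fun x hx y hy => ?_
  have h1 := hA x hx
  have h2 := hA y hy
  rw [NNReal.coe_one, one_mul, dist_eq_norm, dist_eq_norm]
  refine le_of_sq_le_sq ?_ (norm_nonneg _)
  rw [norm_sub_sq_real, norm_sub_sq_real, norm_smul, norm_smul, real_inner_smul_left,
    real_inner_smul_right]
  have hx0 : ‖x‖ ≠ 0 := by positivity
  have hy0 : ‖y‖ ≠ 0 := by positivity
  simp only [norm_inv, norm_norm]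
  rw [inv_mul_cancel₀ hx0, inv_mul_cancel₀ hy0]
  set c := ‖x‖⁻¹ * (‖y‖⁻¹ * inner ℝ x y) with hc
  have hc1 : c ≤ 1 := by
    rw [hc]
    calc _ ≤ ‖x‖⁻¹ * (‖y‖⁻¹ * (‖x‖ * ‖y‖)) := by gcongr; exact real_inner_le_norm x y
      _ = 1 := by field_simp
  have hc' : inner ℝ x y = c * (‖x‖ * ‖y‖) := by rw [hc]; field_simp
  rw [hc']
  have h3 : 1 ≤ ‖x‖ * ‖y‖ := one_le_mul_of_one_le_of_one_le h1 h2
  nlinarith [sq_nonneg (‖x‖ - ‖y‖), mul_nonneg (sub_nonneg.2 h3) (sub_nonneg.2 hc1)]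

/-- The surface measure of a piece `A` of the unit sphere, seen under a small angle around `p`, is
compared with the volume of the solid cone over `A`. The comparison goes through the gnomonic
projection of `A` to the plane `⟪p, x⟫ = 1`, whose inverse is `1`-Lipschitz. -/
lemma hausdorff_le_volume_cone (hN : 1 ≤ N) {p : 𝔼} (hp : ‖p‖ = 1) {κ : ℝ} (hκ : 0 < κ)
    {A : Set 𝔼} (hA : MeasurableSet A) (hAs : A ⊆ Metric.sphere 0 1)
    (hAp : ∀ x ∈ A, κ ≤ inner ℝ p x) :
    ENNReal.ofReal (κ ^ N) * μHE[N - 1] A ≤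
      N * volume {x : 𝔼 | x ∈ Metric.ball 0 1 ∧ ‖x‖⁻¹ • x ∈ A} := by
  have hp0 : p ≠ 0 := by rintro rfl; simp at hp
  set C : Set 𝔼 := {x | inner ℝ p x ∈ Set.Ioo (0 : ℝ) 1 ∧ ‖x‖⁻¹ • x ∈ A} with hC
  have hmeas : Measurable fun x : 𝔼 => ‖x‖⁻¹ • x := by fun_prop
  have hCm : MeasurableSet C := by
    have h1 : Measurable fun x : 𝔼 => inner ℝ p x := by fun_prop
    exact (h1 measurableSet_Ioo).inter (hmeas hA)
  set A' : Set 𝔼 := {y | inner ℝ p y = 1 ∧ ‖y‖⁻¹ • y ∈ A} with hA'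
  have hAA' : μHE[N - 1] A ≤ μHE[N - 1] A' := by
    have h1 : A ⊆ (fun x : 𝔼 => ‖x‖⁻¹ • x) '' A' := by
      intro x hx
      have hx1 : ‖x‖ = 1 := by simpa using hAs hx
      have hpos : 0 < inner ℝ p x := hκ.trans_le (hAp x hx)
      have h2 : ‖(inner ℝ p x)⁻¹ • x‖⁻¹ • (inner ℝ p x)⁻¹ • x = x := by
        rw [norm_smul, hx1, norm_inv, Real.norm_of_nonneg hpos.le, smul_smul]
        simp [hpos.ne']
      refine ⟨(inner ℝ p x)⁻¹ • x, ⟨?_, ?_⟩, h2⟩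
      · rw [real_inner_smul_right, inv_mul_cancel₀ hpos.ne']
      · rw [h2]; exact hx
    have h2 := euclideanHausdorffMeasure_image_le (f := fun x : 𝔼 => ‖x‖⁻¹ • x) (s := A') (K := 1)
      (lipschitzOnWith_normalize fun y hy => by
        have := real_inner_le_norm p y
        rw [hy.1, hp, one_mul] at this
        exact this) (N - 1)
    refine (measure_mono h1).trans (h2.trans (by simp))
  have hvol := EuclideanGeometry.euclideanHausdorffMeasure_eq_lintegral (0 : 𝔼) hp0 hCm
  rw [InnerProductSpace.euclideanHausdorffMeasure_eq_volume] at hvol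
  have hr : Module.finrank ℝ 𝔼 = N := by simp
  rw [hr] at hvol
  have hslice : ∀ x ∈ Set.Ioo (0 : ℝ) 1, ENNReal.ofReal (x ^ (N - 1)) * μHE[N - 1] A' ≤
      μHE[N - 1] (C ∩ AffineSubspace.mk' (x • p +ᵥ (0 : 𝔼)) (ℝ ∙ p)ᗮ) := by
    intro x hx
    have h1 := Measure.euclideanHausdorffMeasure_smul₀ (N - 1) hx.1.ne' A'
    have h2 : ENNReal.ofReal (x ^ (N - 1)) * μHE[N - 1] A' = μHE[N - 1] (x • A') := by
      rw [h1, ENNReal.smul_def, smul_eq_mul, ENNReal.ofReal_pow hx.1.le, ENNReal.coe_pow]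
      congr 2
      rw [← Real.enorm_eq_ofReal hx.1.le]; rfl
    rw [h2]
    refine measure_mono ?_
    rintro _ ⟨y, hy, rfl⟩
    refine ⟨⟨?_, ?_⟩, ?_⟩
    · simp only [real_inner_smul_right, hy.1, mul_one]; exact hx
    · simp only [norm_smul, Real.norm_of_nonneg hx.1.le, smul_smul]
      rw [show (x * ‖y‖)⁻¹ * x = ‖y‖⁻¹ by
        have := hx.1.ne'
        rw [mul_inv]; field_simp]
      exact hy.2
    · rw [SetLike.mem_coe, AffineSubspace.mem_mk',
        Submodule.mem_orthogonal_singleton_iff_inner_right]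
      simp only [vadd_eq_add, add_zero, vsub_eq_sub, inner_sub_right, real_inner_smul_right, hy.1,
        real_inner_self_eq_norm_sq, hp]
      norm_num
  have hCvol : μHE[N - 1] A ≤ N * volume C := by
    have h3 : (∫⁻ x in Set.Ioo (0 : ℝ) 1, ENNReal.ofReal (x ^ (N - 1)) * μHE[N - 1] A') ≤
        volume C := by
      rw [hvol]
      have : ‖p‖ₑ = 1 := by rw [← ofReal_norm, hp]; simp
      rw [this, one_mul]
      exact (setLIntegral_mono' measurableSet_Ioo hslice).trans (setLIntegral_le_lintegral _ _)
    have h4 : (∫⁻ x in Set.Ioo (0 : ℝ) 1, ENNReal.ofReal (x ^ (N - 1))) = (N : ℝ≥0∞)⁻¹ := by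
      rw [← ofReal_integral_eq_lintegral_ofReal]
      · rw [← integral_Ioc_eq_integral_Ioo, ← intervalIntegral.integral_of_le zero_le_one,
          integral_pow]
        have : ((N - 1 : ℕ) : ℝ) + 1 = N := by
          rw [Nat.cast_sub hN]; simp
        rw [this]
        rw [Nat.sub_add_cancel hN, one_pow, zero_pow (by omega), sub_zero, one_div,
          ENNReal.ofReal_inv_of_pos (by positivity), ENNReal.ofReal_natCast]
      · exact ((continuous_pow (N - 1)).integrableOn_Icc (a := (0 : ℝ)) (b := 1)).mono_set
          Set.Ioo_subset_Icc_self
      · exact (ae_restrict_mem measurableSet_Ioo).mono fun x hx => pow_nonneg hx.1.le _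
    rw [lintegral_mul_const'' _ (by fun_prop), h4] at h3
    calc μHE[N - 1] A ≤ μHE[N - 1] A' := hAA'
      _ = N * ((N : ℝ≥0∞)⁻¹ * μHE[N - 1] A') := by
        rw [← mul_assoc, ENNReal.mul_inv_cancel (by simp; omega) (by simp), one_mul]
      _ ≤ _ := by gcongr
  have hscale : ENNReal.ofReal (κ ^ N) * volume C ≤
      volume {x : 𝔼 | x ∈ Metric.ball 0 1 ∧ ‖x‖⁻¹ • x ∈ A} := by
    have h1 := Measure.addHaar_smul (volume : Measure 𝔼) κ C
    rw [hr, abs_of_pos (by positivity)] at h1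
    rw [← h1]
    refine measure_mono ?_
    rintro _ ⟨y, hy, rfl⟩
    have hy0 : y ≠ 0 := by
      rintro rfl
      have := hy.1.1
      simp at this
    have hny : 0 < ‖y‖ := norm_pos_iff.2 hy0
    refine ⟨?_, ?_⟩
    · have h2 := hAp _ hy.2
      rw [real_inner_smul_right] at h2
      have h3 := hy.1.2
      simp only [Metric.mem_ball, dist_zero_right, norm_smul, Real.norm_of_nonneg hκ.le]
      calc κ * ‖y‖ ≤ ‖y‖⁻¹ * inner ℝ p y * ‖y‖ := by gcongr
        _ = inner ℝ p y := by field_simp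
        _ < 1 := h3
    · simp only [norm_smul, Real.norm_of_nonneg hκ.le, smul_smul]
      rw [show (κ * ‖y‖)⁻¹ * κ = ‖y‖⁻¹ by rw [mul_inv]; field_simp]
      exact hy.2
  calc ENNReal.ofReal (κ ^ N) * μHE[N - 1] A ≤ ENNReal.ofReal (κ ^ N) * (N * volume C) := by gcongr
    _ = N * (ENNReal.ofReal (κ ^ N) * volume C) := by ring
    _ ≤ _ := by gcongr

lemma exists_measurable_partition_dist_le {δ : ℝ} (hδ : 0 < δ) :
    ∃ D : ℕ → Set 𝔼, (∀ n, MeasurableSet (D n)) ∧ Pairwise (Function.onFun Disjoint D) ∧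
      ⋃ n, D n = Set.univ ∧ ∀ n, ∀ x ∈ D n, ∀ y ∈ D n, dist x y ≤ δ := by
  let B : ℕ → Set 𝔼 := fun n => Metric.closedBall (TopologicalSpace.denseSeq 𝔼 n) (δ / 2)
  refine ⟨disjointed B, fun n => ?_, disjoint_disjointed B, ?_, fun n x hx y hy => ?_⟩
  · exact MeasurableSet.disjointed (fun i => Metric.isClosed_closedBall.measurableSet) n
  · rw [iUnion_disjointed, Set.eq_univ_iff_forall]
    intro x
    obtain ⟨n, hn⟩ :=
      (TopologicalSpace.denseRange_denseSeq 𝔼).exists_dist_lt x (half_pos hδ)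
    exact Set.mem_iUnion.2 ⟨n, hn.le⟩
  · have h1 := disjointed_subset B n hx
    have h2 := disjointed_subset B n hy
    simp only [B, Metric.mem_closedBall] at h1 h2
    linarith [dist_triangle_right x y (TopologicalSpace.denseSeq 𝔼 n)]

/-- The cone estimate, summed over a partition of the sphere into small pieces. -/
lemma pow_mul_hausdorff_sphere_le (hN : 1 ≤ N) {κ : ℝ} (hκ : 0 < κ) (hκ1 : κ < 1) :
    ENNReal.ofReal (κ ^ N) * μHE[N - 1] (Metric.sphere (0 : 𝔼) 1) ≤
      N * volume (Metric.ball (0 : 𝔼) 1) := by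
  -- two unit vectors at distance at most `√(2 (1 - κ))` have inner product at least `κ`
  obtain ⟨D, hDm, hDd, hDu, hD⟩ := exists_measurable_partition_dist_le (N := N)
    (Real.sqrt_pos.2 (by linarith : 0 < 2 * (1 - κ)))
  set S := Metric.sphere (0 : 𝔼) 1 with hS
  have hSm : MeasurableSet S := Metric.isClosed_sphere.measurableSet
  have hmeas : Measurable fun x : 𝔼 => ‖x‖⁻¹ • x := by fun_prop
  have hpiece : ∀ n, ENNReal.ofReal (κ ^ N) * μHE[N - 1] (D n ∩ S) ≤
      N * volume {x : 𝔼 | x ∈ Metric.ball 0 1 ∧ ‖x‖⁻¹ • x ∈ D n ∩ S} := by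
    intro n
    rcases (D n ∩ S).eq_empty_or_nonempty with h | ⟨p, hp⟩
    · rw [h]; simp
    have hp1 : ‖p‖ = 1 := by simpa [hS] using hp.2
    refine hausdorff_le_volume_cone hN hp1 hκ ((hDm n).inter hSm) Set.inter_subset_right ?_
    intro x hx
    have hx1 : ‖x‖ = 1 := by simpa [hS] using hx.2
    have h1 := hD n p hp.1 x hx.1
    rw [dist_eq_norm] at h1
    have h2 := norm_sub_sq_real p x
    have h3 := Real.sq_sqrt (by linarith : 0 ≤ 2 * (1 - κ))
    rw [hp1, hx1] at h2
    nlinarith [norm_nonneg (p - x), Real.sqrt_nonneg (2 * (1 - κ))]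
  have hsum1 : μHE[N - 1] S = ∑' n, μHE[N - 1] (D n ∩ S) := by
    rw [← measure_iUnion (fun i j hij => (hDd hij).mono Set.inter_subset_left Set.inter_subset_left)
      (fun n => (hDm n).inter hSm), ← Set.iUnion_inter, hDu, Set.univ_inter]
  rw [hsum1, ← ENNReal.tsum_mul_left]
  refine (ENNReal.tsum_le_tsum hpiece).trans ?_
  rw [ENNReal.tsum_mul_left]
  gcongr
  rw [← measure_iUnion]
  · exact measure_mono (Set.iUnion_subset fun n x hx => hx.1)
  · intro i j hij
    refine Set.disjoint_left.2 fun x hx hy => ?_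
    exact Set.disjoint_left.1 (hDd hij) hx.2.1 hy.2.1
  · intro n
    exact Metric.isOpen_ball.measurableSet.inter (hmeas ((hDm n).inter hSm))

lemma hausdorff_unitSphere_le (hN : 1 ≤ N) :
    μHE[N - 1] (Metric.sphere (0 : 𝔼) 1) ≤ N * volume (Metric.ball (0 : 𝔼) 1) := by
  have h : Tendsto (fun κ : ℝ => ENNReal.ofReal (κ ^ N) * μHE[N - 1] (Metric.sphere (0 : 𝔼) 1))
      (𝓝[<] 1) (𝓝 (ENNReal.ofReal (1 ^ N) * μHE[N - 1] (Metric.sphere (0 : 𝔼) 1))) := by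
    refine ENNReal.Tendsto.mul_const ?_ (Or.inl (by simp))
    exact ENNReal.tendsto_ofReal (((continuous_pow N).tendsto 1).mono_left nhdsWithin_le_nhds)
  rw [one_pow, ENNReal.ofReal_one, one_mul] at h
  refine le_of_tendsto h ?_
  filter_upwards [Ioo_mem_nhdsLT (zero_lt_one' ℝ)] with κ hκ
  exact pow_mul_hausdorff_sphere_le hN hκ.1 hκ.2

/-- The sharp upper bound for the surface measure of a sphere. Equality holds, but this is the half
which the divergence inequality does not give. -/
lemma hausdorff_sphere_le (hN : 1 ≤ N) (y : 𝔼) {r : ℝ} (hr : 0 < r) :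
    ENNReal.ofReal r * μHE[N - 1] (Metric.sphere y r) ≤ N * volume (Metric.ball y r) := by
  have h1 : μHE[N - 1] (Metric.sphere y r) =
      ENNReal.ofReal (r ^ (N - 1)) * μHE[N - 1] (Metric.sphere (0 : 𝔼) 1) := by
    have h2 : Metric.sphere y r = (fun x => y + x) '' (r • Metric.sphere (0 : 𝔼) 1) := by
      rw [smul_sphere' hr.ne', smul_zero, mul_one, Real.norm_of_nonneg hr.le]
      ext x
      simp [sub_eq_neg_add]
    have hiso : Isometry fun x : 𝔼 => y + x := Isometry.of_dist_eq fun a b => dist_add_left y a b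
    rw [h2, hiso.euclideanHausdorffMeasure_image, Measure.euclideanHausdorffMeasure_smul₀ _ hr.ne',
      ENNReal.smul_def, smul_eq_mul, ENNReal.ofReal_pow hr.le, ENNReal.coe_pow,
      ← Real.enorm_eq_ofReal hr.le]
    rfl
  have h3 := Measure.addHaar_ball_of_pos (volume : Measure 𝔼) y hr
  rw [h1, h3, ← mul_assoc, ← ENNReal.ofReal_mul hr.le, ← pow_succ', Nat.sub_add_cancel hN]
  calc _ ≤ _ := mul_le_mul_right (hausdorff_unitSphere_le hN) _
    _ = _ := by simp; ring

/-! ### The directional estimate -/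

/-- The integral of `|φ|` over the points swept by `K` moving by `h` along `e` is, to first order in
`h`, at most `h ∫_K |φ|`. Here `ε` bounds the oscillation of `φ`, and `δ` is the diameter of the
pieces into which `K` is cut. -/
lemma lintegral_sweep_le {e : 𝔼} (he : ‖e‖ = 1) {K : Set 𝔼} (hK : MeasurableSet K)
    {φ : 𝔼 → ℝ} {h δ : ℝ} (hδ : 0 < δ) {ε : ℝ}
    (hφ : ∀ x y, dist x y ≤ h + δ → |φ x - φ y| ≤ ε) :
    ∫⁻ x in {x | ∃ y ∈ K, ∃ s ∈ Set.Icc 0 h, x = y + s • e}, ‖φ x‖ₑ ≤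
      ENNReal.ofReal (h + 2 * δ) *
        ∫⁻ x in K, (‖φ x‖ₑ + ENNReal.ofReal ε) ∂(μHE[N - 1] : Measure 𝔼) := by
  obtain ⟨D, hDm, hDd, hDu, hD⟩ := exists_measurable_partition_dist_le (N := N) hδ
  let T : ℕ → Set 𝔼 := fun n => {x | ∃ y ∈ D n ∩ K, ∃ s ∈ Set.Icc 0 h, x = y + s • e}
  have hT : {x | ∃ y ∈ K, ∃ s ∈ Set.Icc 0 h, x = y + s • e} ⊆ ⋃ n, T n := by
    rintro x ⟨y, hy, hs⟩
    have : y ∈ ⋃ n, D n := by rw [hDu]; trivial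
    obtain ⟨n, hn⟩ := Set.mem_iUnion.1 this
    exact Set.mem_iUnion.2 ⟨n, y, ⟨hn, hy⟩, hs⟩
  have hpiece : ∀ n, ∫⁻ x in T n, ‖φ x‖ₑ ≤ ENNReal.ofReal (h + 2 * δ) *
      ∫⁻ x in D n ∩ K, (‖φ x‖ₑ + ENNReal.ofReal ε) ∂(μHE[N - 1] : Measure 𝔼) := by
    intro n
    rcases (D n ∩ K).eq_empty_or_nonempty with h0 | ⟨p, hp⟩
    · have : T n = ∅ := by simp only [T, h0]; simp
      rw [this]; simp
    have hvol : volume (T n) ≤ ENNReal.ofReal (h + 2 * δ) * μHE[N - 1] (D n ∩ K) := by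
      have := volume_le_width_mul_hausdorff he (A := D n ∩ K) (T := T n)
        (a := inner ℝ e p - δ) (b := inner ℝ e p + δ + h) ?_ ?_
      · refine this.trans (le_of_eq ?_)
        congr 2; ring
      · rintro _ ⟨y, hy, s, hs, rfl⟩
        have h1 : |inner ℝ e (y - p)| ≤ δ := by
          have := abs_real_inner_le_norm e (y - p)
          rw [he, one_mul, ← dist_eq_norm] at this
          exact this.trans (hD n y hy.1 p hp.1)
        rw [inner_sub_right, abs_le] at h1
        rw [inner_add_right, real_inner_smul_right, real_inner_self_eq_norm_sq, he]
        constructor <;> nlinarith [hs.1, hs.2]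
      · rintro _ ⟨y, hy, s, hs, rfl⟩
        exact ⟨y, hy, s, rfl⟩
    set c : ℝ≥0∞ := ⨅ z ∈ D n ∩ K, (‖φ z‖ₑ + ENNReal.ofReal ε) with hc
    have h1 : ∀ x ∈ T n, ‖φ x‖ₑ ≤ c := by
      rintro _ ⟨y, hy, s, hs, rfl⟩
      refine le_iInf₂ fun z hz => ?_
      have hd : dist (y + s • e) z ≤ h + δ := by
        calc dist (y + s • e) z ≤ dist (y + s • e) y + dist y z := dist_triangle _ _ _
          _ ≤ h + δ := by
            gcongr
            · rw [dist_eq_norm, add_sub_cancel_left, norm_smul, he, mul_one,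
                Real.norm_of_nonneg hs.1]
              exact hs.2
            · exact hD n y hy.1 z hz.1
      have h2 := hφ _ _ hd
      have hε : 0 ≤ ε := (abs_nonneg _).trans h2
      rw [← ofReal_norm, ← ofReal_norm, ← ENNReal.ofReal_add (norm_nonneg _) hε]
      refine ENNReal.ofReal_le_ofReal ?_
      rw [Real.norm_eq_abs, Real.norm_eq_abs]
      linarith [abs_sub_abs_le_abs_sub (φ (y + s • e)) (φ z)]
    calc ∫⁻ x in T n, ‖φ x‖ₑ ≤ ∫⁻ x in T n, c := setLIntegral_mono measurable_const h1
      _ = c * volume (T n) := by simp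
      _ ≤ c * (ENNReal.ofReal (h + 2 * δ) * μHE[N - 1] (D n ∩ K)) := by gcongr
      _ = ENNReal.ofReal (h + 2 * δ) * (c * μHE[N - 1] (D n ∩ K)) := by ring
      _ ≤ _ := by
        gcongr
        rw [← setLIntegral_const]
        exact setLIntegral_mono' ((hDm n).inter hK) fun x hx => iInf₂_le x hx
  calc _ ≤ ∫⁻ x in ⋃ n, T n, ‖φ x‖ₑ := lintegral_mono_set hT
    _ ≤ ∑' n, ∫⁻ x in T n, ‖φ x‖ₑ := lintegral_iUnion_le _ _
    _ ≤ ∑' n, ENNReal.ofReal (h + 2 * δ) *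
      ∫⁻ x in D n ∩ K, (‖φ x‖ₑ + ENNReal.ofReal ε) ∂(μHE[N - 1] : Measure 𝔼) :=
        ENNReal.tsum_le_tsum hpiece
    _ = _ := by
      rw [ENNReal.tsum_mul_left, ← lintegral_iUnion (fun n => (hDm n).inter hK)
        (fun i j hij => (hDd hij).mono Set.inter_subset_left Set.inter_subset_left),
        ← Set.iUnion_inter, hDu, Set.univ_inter]

/-- A segment with one end in `Ω` and the other one not meets the boundary. -/
lemma exists_mem_frontier_of_segment {Ω : Set 𝔼} {e x : 𝔼} {h : ℝ} (hh : 0 < h)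
    (hx : ¬ (x - h • e ∈ Ω ↔ x ∈ Ω)) :
    ∃ y ∈ frontier Ω, ∃ s ∈ Set.Icc 0 h, x = y + s • e := by
  let f : ℝ → 𝔼 := fun s => x - s • e
  have hf : Continuous f := by fun_prop
  have hpre : IsPreconnected (f '' Set.Icc 0 h) := isPreconnected_Icc.image _ hf.continuousOn
  have h0 : x ∈ f '' Set.Icc 0 h := ⟨0, ⟨le_rfl, hh.le⟩, by simp [f]⟩
  have h1 : x - h • e ∈ f '' Set.Icc 0 h := ⟨h, ⟨hh.le, le_rfl⟩, rfl⟩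
  have h2 : (f '' Set.Icc 0 h ∩ frontier Ω).Nonempty := by
    by_contra hne
    have hcov : f '' Set.Icc 0 h ⊆ interior Ω ∪ (closure Ω)ᶜ := by
      intro z hz
      by_contra hz'
      simp only [Set.mem_union, Set.mem_compl_iff, not_or, not_not] at hz'
      exact hne ⟨z, hz, hz'.2, hz'.1⟩
    rcases hpre.subset_or_subset isOpen_interior isClosed_closure.isOpen_compl
      (Set.disjoint_compl_right_iff_subset.2 interior_subset_closure) hcov with h3 | h3
    · exact hx (iff_of_true (interior_subset (h3 h1)) (interior_subset (h3 h0)))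
    · exact hx (iff_of_false (fun h => h3 h1 (subset_closure h)) fun h => h3 h0 (subset_closure h))
  obtain ⟨_, ⟨s, hs, rfl⟩, hy⟩ := h2
  exact ⟨_, hy, s, hs, by simp [f]⟩

/-- The difference quotient of `φ` in the direction `e`, integrated over `Ω`, only sees the points
swept by the boundary. -/
lemma norm_integral_shift_sub_le {Ω : Set 𝔼} (hΩ : IsOpen Ω) {e : 𝔼} {φ : 𝔼 → ℝ}
    (hφ : Continuous φ) (hφc : HasCompactSupport φ) {h : ℝ} (hh : 0 < h) :
    ‖∫ x in Ω, (φ (x + h • e) - φ x)‖ₑ ≤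
      ∫⁻ x in {x | ∃ y ∈ frontier Ω, ∃ s ∈ Set.Icc 0 h, x = y + s • e}, ‖φ x‖ₑ := by
  have hint : Integrable φ := hφ.integrable_of_hasCompactSupport hφc
  have hint' : Integrable fun x => φ (x + h • e) := hint.comp_add_right (h • e)
  have h1 : ∫ x in Ω, (φ (x + h • e) - φ x) =
      ∫ x, (Ω.indicator (fun _ => (1 : ℝ)) (x - h • e) - Ω.indicator (fun _ => 1) x) * φ x := by
    rw [integral_sub hint'.integrableOn hint.integrableOn]
    have h2 : ∀ g : 𝔼 → ℝ, Ω.indicator g = fun x => Ω.indicator (fun _ => (1 : ℝ)) x * g x := by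
      intro g; ext x
      by_cases hx : x ∈ Ω <;> simp [hx]
    have hi1 : Integrable fun x => Ω.indicator (fun _ => (1 : ℝ)) x * φ x := by
      rw [← h2]; exact hint.indicator hΩ.measurableSet
    have hi2 : Integrable fun x => Ω.indicator (fun _ => (1 : ℝ)) x * φ (x + h • e) := by
      rw [← h2 fun x => φ (x + h • e)]; exact hint'.indicator hΩ.measurableSet
    have hi3 : Integrable fun x => Ω.indicator (fun _ => (1 : ℝ)) (x - h • e) * φ x := by
      have := hi2.comp_sub_right (h • e)
      simpa using this
    simp_rw [sub_mul]
    rw [integral_sub hi3 hi1, ← integral_indicator hΩ.measurableSet,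
      ← integral_indicator hΩ.measurableSet, h2 φ, h2 fun x => φ (x + h • e)]
    congr 1
    have := integral_sub_right_eq_self (μ := volume)
      (fun x => Ω.indicator (fun _ => (1 : ℝ)) x * φ (x + h • e)) (h • e)
    rw [← this]
    simp
  rw [h1]
  refine (enorm_integral_le_lintegral_enorm _).trans ?_
  rw [← setLIntegral_eq_of_support_subset
    (s := {x | ∃ y ∈ frontier Ω, ∃ s ∈ Set.Icc 0 h, x = y + s • e})]
  · refine lintegral_mono fun x => ?_
    rw [enorm_mul]
    refine mul_le_of_le_one_left' ?_
    rw [← ofReal_norm, ENNReal.ofReal_le_one, Real.norm_eq_abs]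
    by_cases h3 : x ∈ Ω <;> by_cases h4 : x - h • e ∈ Ω <;> simp [h3, h4]
  · intro x hx
    refine exists_mem_frontier_of_segment hh fun h3 => hx ?_
    by_cases h4 : x ∈ Ω
    · simp [h4, h3.2 h4]
    · simp [h4, mt h3.1 h4]

/-- The directional derivative is the limit of the difference quotients with step `h`. In the
sweeping estimate the boundary is cut into pieces of diameter `ε h`, small compared with the
step. -/
lemma abs_integral_fderiv_le_of_hasCompactSupport {Ω : Set 𝔼} (hΩ : IsOpen Ω)
    (hΩb : Bornology.IsBounded Ω) (hH : μHE[N - 1] (frontier Ω) ≠ ⊤) {e : 𝔼} (he : ‖e‖ = 1)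
    {φ : 𝔼 → ℝ} (hφ : ContDiff ℝ 1 φ) (hφc : HasCompactSupport φ) :
    |∫ x in Ω, fderiv ℝ φ x e| ≤ ∫ x, |φ x| ∂(boundaryMeasure Ω) := by
  have hfin : IsFiniteMeasure (boundaryMeasure Ω) := ⟨by simpa [boundaryMeasure] using hH.lt_top⟩
  have hint : Integrable φ (boundaryMeasure Ω) := hφ.continuous.integrable_of_hasCompactSupport hφc
  obtain ⟨C, hC⟩ := hφ.lipschitzWith_of_hasCompactSupport hφc one_ne_zero
  have huc := hφc.uniformContinuous_of_continuous hφ.continuous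
  set I := ∫ x, |φ x| ∂(boundaryMeasure Ω) with hI
  have hI0 : 0 ≤ I := integral_nonneg fun x => abs_nonneg _
  set M := (μHE[N - 1] (frontier Ω)).toReal with hM
  have hlim : Tendsto (fun h : ℝ => ∫ x in Ω, h⁻¹ * (φ (x + h • e) - φ x)) (𝓝[>] 0)
      (𝓝 (∫ x in Ω, fderiv ℝ φ x e)) := by
    refine tendsto_integral_filter_of_dominated_convergence (fun _ => (C : ℝ)) ?_ ?_ ?_ ?_
    · refine Eventually.of_forall fun h => Continuous.aestronglyMeasurable ?_
      have := hφ.continuous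
      fun_prop
    · filter_upwards [self_mem_nhdsWithin] with h hh
      refine Eventually.of_forall fun x => ?_
      have h1 := hC.dist_le_mul (x + h • e) x
      have hh' : 0 < h := hh
      rw [dist_eq_norm, dist_eq_norm, add_sub_cancel_left, norm_smul, he, mul_one,
        Real.norm_of_nonneg hh'.le] at h1
      rw [norm_mul, norm_inv, Real.norm_of_nonneg hh'.le]
      rw [inv_mul_le_iff₀ hh', mul_comm]
      exact h1
    · have : IsFiniteMeasure (volume.restrict Ω) := ⟨by simpa using hΩb.measure_lt_top⟩
      exact integrable_const _
    · refine Eventually.of_forall fun x => ?_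
      have h1 := (hφ.differentiable one_ne_zero x).hasFDerivAt.hasLineDerivAt e
      simpa using h1.tendsto_slope_zero_right
  have hbound : ∀ ε : ℝ, 0 < ε → |∫ x in Ω, fderiv ℝ φ x e| ≤ (1 + 2 * ε) * (I + ε * M) := by
    intro ε hε
    obtain ⟨η, hη, hηφ⟩ := Metric.uniformContinuous_iff.1 huc ε hε
    refine le_of_tendsto hlim.abs ?_
    filter_upwards [Ioo_mem_nhdsGT (show 0 < η / (1 + ε) by positivity)] with h hh
    have hh0 : 0 < h := hh.1
    rw [integral_const_mul, abs_mul, abs_inv, abs_of_pos hh0, inv_mul_le_iff₀ hh0]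
    have h1 := norm_integral_shift_sub_le hΩ (e := e) hφ.continuous hφc hh0
    have h2 := lintegral_sweep_le he (K := frontier Ω) isClosed_frontier.measurableSet (φ := φ)
      (h := h) (δ := ε * h) (by positivity) (ε := ε) (fun x y hxy => by
        have := hηφ (a := x) (b := y) (by
          have := hh.2
          rw [lt_div_iff₀ (by positivity)] at this
          linarith)
        exact this.le)
    have h3 : ∫⁻ x in frontier Ω, (‖φ x‖ₑ + ENNReal.ofReal ε) ∂(μHE[N - 1] : Measure 𝔼) =
        ENNReal.ofReal (I + ε * M) := by
      have h4 : ∫⁻ x in frontier Ω, ‖φ x‖ₑ ∂(μHE[N - 1] : Measure 𝔼) = ENNReal.ofReal I :=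
        (ofReal_integral_norm_eq_lintegral_enorm hint).symm
      rw [lintegral_add_right _ measurable_const, setLIntegral_const, h4,
        ENNReal.ofReal_add hI0 (by positivity), ENNReal.ofReal_mul hε.le, hM,
        ENNReal.ofReal_toReal hH]
    rw [h3, ← ENNReal.ofReal_mul (by positivity)] at h2
    have h4 := h1.trans h2
    rw [← ofReal_norm, ENNReal.ofReal_le_ofReal_iff (by positivity)] at h4
    calc _ ≤ _ := h4
      _ = _ := by ring
  have hlim2 : Tendsto (fun ε : ℝ => (1 + 2 * ε) * (I + ε * M)) (𝓝[>] 0) (𝓝 I) := by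
    have : Continuous fun ε : ℝ => (1 + 2 * ε) * (I + ε * M) := by fun_prop
    have h := (this.tendsto 0).mono_left (nhdsWithin_le_nhds (s := Set.Ioi 0))
    simpa using h
  exact ge_of_tendsto hlim2 (by filter_upwards [self_mem_nhdsWithin] with ε hε using hbound ε hε)

lemma abs_integral_fderiv_le {Ω : Set 𝔼} (hΩ : IsOpen Ω)
    (hΩb : Bornology.IsBounded Ω) (hH : μHE[N - 1] (frontier Ω) ≠ ⊤) (e : 𝔼)
    {φ : 𝔼 → ℝ} (hφ : ContDiff ℝ 1 φ) :
    |∫ x in Ω, fderiv ℝ φ x e| ≤ ‖e‖ * ∫ x, |φ x| ∂(boundaryMeasure Ω) := by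
  rcases eq_or_ne e 0 with rfl | he0
  · simp
  have hne : 0 < ‖e‖ := norm_pos_iff.2 he0
  obtain ⟨R, hR0, hR⟩ := hΩb.subset_closedBall_lt 0 (0 : 𝔼)
  let χ : ContDiffBump (0 : 𝔼) := ⟨R + 1, R + 2, by linarith, by linarith⟩
  have hχ : ∀ x ∈ Metric.closedBall (0 : 𝔼) R, (fun y => χ y * φ y) =ᶠ[𝓝 x] φ := by
    intro x hx
    have : Metric.ball (0 : 𝔼) (R + 1) ∈ 𝓝 x := Metric.isOpen_ball.mem_nhds (by
      simp at hx ⊢; linarith)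
    filter_upwards [this] with y hy
    rw [χ.one_of_mem_closedBall (Metric.ball_subset_closedBall hy), one_mul]
  have hcl : closure Ω ⊆ Metric.closedBall 0 R := closure_minimal hR Metric.isClosed_closedBall
  have h := abs_integral_fderiv_le_of_hasCompactSupport hΩ hΩb hH (e := ‖e‖⁻¹ • e)
    (by rw [norm_smul, norm_inv, norm_norm, inv_mul_cancel₀ hne.ne'])
    (φ := fun y => χ y * φ y) (χ.contDiff.mul hφ) χ.hasCompactSupport.mul_right
  have h1 : ∫ x in Ω, fderiv ℝ (fun y => χ y * φ y) x (‖e‖⁻¹ • e) =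
      ‖e‖⁻¹ * ∫ x in Ω, fderiv ℝ φ x e := by
    rw [← integral_const_mul]
    refine setIntegral_congr_fun hΩ.measurableSet fun x hx => ?_
    rw [(hχ x (hR hx)).fderiv_eq, map_smul, smul_eq_mul]
  have h2 : ∫ x, |χ x * φ x| ∂(boundaryMeasure Ω) = ∫ x, |φ x| ∂(boundaryMeasure Ω) := by
    refine setIntegral_congr_fun isClosed_frontier.measurableSet fun x hx => ?_
    have := (hχ x (hcl (frontier_subset_closure hx))).eq_of_nhds
    rw [this]
  rw [h1, h2, abs_mul, abs_of_pos (inv_pos.2 hne), inv_mul_le_iff₀ hne] at h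
  exact h

/-! ### The divergence inequality -/

/-- The divergence of a vector field, the sum of the `∂_i V_i`. -/
noncomputable def divergence (V : 𝔼 → 𝔼) (x : 𝔼) : ℝ :=
  ∑ i, fderiv ℝ V x (EuclideanSpace.single i 1) i

lemma divergence_eq_sum {V : 𝔼 → 𝔼} {x : 𝔼} (hV : DifferentiableAt ℝ V x) :
    divergence V x = ∑ i, fderiv ℝ (fun y => V y i) x (EuclideanSpace.single i 1) := by
  refine Finset.sum_congr rfl fun i _ => ?_
  have h := ((EuclideanSpace.proj (𝕜 := ℝ) i).hasFDerivAt.comp x hV.hasFDerivAt).fderiv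
  have h2 : (fun y => V y i) = (EuclideanSpace.proj (𝕜 := ℝ) i) ∘ V := rfl
  rw [h2, h]
  rfl

lemma continuous_divergence {V : 𝔼 → 𝔼} (hV : ContDiff ℝ 1 V) : Continuous (divergence V) := by
  have h := hV.continuous_fderiv one_ne_zero
  unfold divergence
  fun_prop

lemma divergence_add {V W : 𝔼 → 𝔼} {x : 𝔼} (hV : DifferentiableAt ℝ V x)
    (hW : DifferentiableAt ℝ W x) :
    divergence (fun y => V y + W y) x = divergence V x + divergence W x := by
  simp only [divergence, fderiv_fun_add hV hW, ← Finset.sum_add_distrib]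
  rfl

lemma divergence_smul {φ : 𝔼 → ℝ} {V : 𝔼 → 𝔼} {x : 𝔼} (hφ : DifferentiableAt ℝ φ x)
    (hV : DifferentiableAt ℝ V x) :
    divergence (fun y => φ y • V y) x = fderiv ℝ φ x (V x) + φ x * divergence V x := by
  simp only [divergence, fderiv_fun_smul hφ hV]
  have h : V x = ∑ i, V x i • EuclideanSpace.single i (1 : ℝ) := by
    have := (EuclideanSpace.basisFun (Fin N) ℝ).sum_repr (V x)
    simpa using this.symm
  conv_rhs => rw [h]
  rw [map_sum, Finset.mul_sum, ← Finset.sum_add_distrib]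
  refine Finset.sum_congr rfl fun i _ => ?_
  simp
  ring

lemma divergence_smul_const {φ : 𝔼 → ℝ} {x : 𝔼} (hφ : DifferentiableAt ℝ φ x) (v : 𝔼) :
    divergence (fun y => φ y • v) x = fderiv ℝ φ x v := by
  rw [divergence_smul hφ (differentiableAt_const v)]
  simp [divergence]

lemma divergence_sub_const (y x : 𝔼) : divergence (fun x : 𝔼 => x - y) x = N := by
  have : fderiv ℝ (fun x : 𝔼 => x - y) x = ContinuousLinearMap.id ℝ _ := by
    rw [fderiv_sub_const, fderiv_fun_id]
  simp [divergence, this]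

lemma integrableOn_of_continuous_of_isBounded {F : Type*} [NormedAddCommGroup F] {f : 𝔼 → F}
    (hf : Continuous f) {Ω : Set 𝔼} (hΩb : Bornology.IsBounded Ω) : IntegrableOn f Ω :=
  (hf.continuousOn.integrableOn_compact hΩb.isCompact_closure).mono_set subset_closure

lemma integrable_boundaryMeasure {F : Type*} [NormedAddCommGroup F] {f : 𝔼 → F}
    (hf : Continuous f) {Ω : Set 𝔼} (hΩb : Bornology.IsBounded Ω)
    (hH : μHE[N - 1] (frontier Ω) ≠ ⊤) : Integrable f (boundaryMeasure Ω) := by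
  have hK : IsCompact (frontier Ω) :=
    Metric.isCompact_of_isClosed_isBounded isClosed_frontier
      (hΩb.closure.subset frontier_subset_closure)
  obtain ⟨C, hC⟩ := hK.exists_bound_of_continuousOn hf.continuousOn
  refine IntegrableOn.of_bound hH.lt_top hf.aestronglyMeasurable C ?_
  exact (ae_restrict_mem isClosed_frontier.measurableSet).mono hC

lemma exists_finite_partitionOfUnity {K : Set 𝔼} (hK : IsCompact K) {δ : ℝ} (hδ : 0 < δ) :
    ∃ (n : ℕ) (p : Fin n → 𝔼) (ψ : Fin n → 𝔼 → ℝ), (∀ j, ContDiff ℝ 1 (ψ j)) ∧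
      (∀ j x, 0 ≤ ψ j x) ∧ (∀ j x, ψ j x ≠ 0 → dist x (p j) < δ) ∧ ∀ x ∈ K, ∑ j, ψ j x = 1 := by
  obtain ⟨t, -, ht⟩ := hK.elim_nhds_subcover (fun x => Metric.ball x (δ / 2))
    fun x _ => Metric.ball_mem_nhds x (half_pos hδ)
  let p : Fin t.card → 𝔼 := fun j => t.equivFin.symm j
  let b : ∀ j, ContDiffBump (p j) := fun j => ⟨δ / 2, δ, half_pos hδ, half_lt_self hδ⟩
  -- in a fixed order, each bump function takes what the previous ones have left
  refine ⟨t.card, p, fun j x => b j x * ∏ i with i < j, (1 - b i x), fun j => ?_, fun j x => ?_,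
    fun j x hx => ?_, fun x hx => ?_⟩
  · refine (b j).contDiff.mul (contDiff_prod fun i _ => contDiff_const.sub (b i).contDiff)
  · exact mul_nonneg (b j).nonneg (Finset.prod_nonneg fun i _ => sub_nonneg.2 (b i).le_one)
  · have h1 : x ∈ Function.support (b j) := left_ne_zero_of_mul hx
    rw [(b j).support_eq] at h1
    exact h1
  · have h := Finset.prod_one_sub_ordered Finset.univ fun j => b j x
    obtain ⟨y, hy, hxy⟩ := Set.mem_iUnion₂.1 (ht hx)
    have h1 : b (t.equivFin ⟨y, hy⟩) x = 1 := by
      refine (b _).one_of_mem_closedBall ?_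
      have : p (t.equivFin ⟨y, hy⟩) = y := by simp [p]
      rw [← this] at hxy
      exact Metric.ball_subset_closedBall hxy
    have h2 : ∏ j, (1 - b j x) = 0 :=
      Finset.prod_eq_zero (Finset.mem_univ (t.equivFin ⟨y, hy⟩)) (by rw [h1, sub_self])
    rw [h2] at h
    linarith

lemma contDiff_apply {V : 𝔼 → 𝔼} (hV : ContDiff ℝ 1 V) (i : Fin N) :
    ContDiff ℝ 1 fun y => V y i :=
  (EuclideanSpace.proj (𝕜 := ℝ) i).contDiff.comp hV

/-- A crude bound, with the dimension as constant, obtained coordinate by coordinate. -/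
lemma integral_divergence_le_mul {Ω : Set 𝔼} (hΩ : IsOpen Ω)
    (hΩb : Bornology.IsBounded Ω) (hH : μHE[N - 1] (frontier Ω) ≠ ⊤)
    {V : 𝔼 → 𝔼} (hV : ContDiff ℝ 1 V) :
    ∫ x in Ω, divergence V x ≤ N * ∫ x, ‖V x‖ ∂(boundaryMeasure Ω) := by
  have h1 : ∫ x in Ω, divergence V x =
      ∑ i, ∫ x in Ω, fderiv ℝ (fun y => V y i) x (EuclideanSpace.single i 1) := by
    rw [← integral_finsetSum]
    · exact integral_congr_ae (Eventually.of_forall fun x =>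
        divergence_eq_sum (hV.differentiable one_ne_zero x))
    · intro i _
      refine integrableOn_of_continuous_of_isBounded ?_ hΩb
      exact ((contDiff_apply hV i).continuous_fderiv one_ne_zero).clm_apply continuous_const
  rw [h1]
  calc _ ≤ ∑ i : Fin N, ∫ x, ‖V x‖ ∂(boundaryMeasure Ω) := by
        refine Finset.sum_le_sum fun i _ => ?_
        refine (le_abs_self _).trans ((abs_integral_fderiv_le hΩ hΩb hH _
          (contDiff_apply hV i)).trans ?_)
        rw [PiLp.norm_single, norm_one, one_mul]
        refine integral_mono
          (integrable_boundaryMeasure (contDiff_apply hV i).continuous.abs hΩb hH)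
          (integrable_boundaryMeasure hV.continuous.norm hΩb hH) fun x => ?_
        exact PiLp.norm_apply_le (V x) i
    _ = _ := by simp

/-- The divergence inequality with the sharp constant, for an arbitrary bounded open set whose
boundary has finite surface measure. The field is frozen on the pieces of a fine partition of unity
of the boundary, and the directional estimate is used on each piece in the direction of the frozen
value. -/
theorem integral_divergence_le {Ω : Set 𝔼} (hΩ : IsOpen Ω)
    (hΩb : Bornology.IsBounded Ω) (hH : μHE[N - 1] (frontier Ω) ≠ ⊤)
    {V : 𝔼 → 𝔼} (hV : ContDiff ℝ 1 V) :
    ∫ x in Ω, divergence V x ≤ ∫ x, ‖V x‖ ∂(boundaryMeasure Ω) := by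
  have hfin : IsFiniteMeasure (boundaryMeasure Ω) := ⟨by simpa [boundaryMeasure] using hH.lt_top⟩
  have hK : IsCompact (frontier Ω) :=
    Metric.isCompact_of_isClosed_isBounded isClosed_frontier
      (hΩb.closure.subset frontier_subset_closure)
  set M := (boundaryMeasure Ω).real Set.univ with hM
  have hVi : Integrable (fun x => ‖V x‖) (boundaryMeasure Ω) :=
    integrable_boundaryMeasure hV.continuous.norm hΩb hH
  have hbound : ∀ ε : ℝ, 0 < ε → ∫ x in Ω, divergence V x ≤
      ∫ x, ‖V x‖ ∂(boundaryMeasure Ω) + ε * M + N * (ε * M) := by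
    intro ε hε
    obtain ⟨δ, hδ, hδV⟩ : ∃ δ > 0, ∀ x ∈ frontier Ω, ∀ y, dist x y < δ → dist (V x) (V y) < ε := by
      have := hK.uniformContinuousAt_of_continuousAt V (fun x _ => hV.continuous.continuousAt)
        (Metric.dist_mem_uniformity hε)
      obtain ⟨δ, hδ, h⟩ := Metric.mem_uniformity_dist.1 this
      exact ⟨δ, hδ, fun x hx y hxy => h hxy hx⟩
    obtain ⟨n, p, ψ, hψ, hψ0, hψd, hψ1⟩ := exists_finite_partitionOfUnity hK hδ
    -- the frozen field; the crude bound suffices for the small remainder `V - F`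
    let F : 𝔼 → 𝔼 := fun x => ∑ j, ψ j x • V (p j)
    have hFj : ∀ j, ContDiff ℝ 1 fun x => ψ j x • V (p j) := fun j => (hψ j).smul contDiff_const
    have hF : ContDiff ℝ 1 F := ContDiff.sum fun j _ => hFj j
    have hW : ContDiff ℝ 1 fun x => V x - F x := hV.sub hF
    have hclose : ∀ x ∈ frontier Ω, ∀ j, ψ j x * ‖V x - V (p j)‖ ≤ ψ j x * ε := by
      intro x hx j
      rcases eq_or_ne (ψ j x) 0 with h0 | h0
      · simp [h0]
      · have := hδV x hx _ (hψd j x h0)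
        rw [dist_eq_norm] at this
        exact mul_le_mul_of_nonneg_left this.le (hψ0 j x)
    have hdiv : ∀ x, divergence V x = divergence (fun x => V x - F x) x +
        ∑ j, fderiv ℝ (ψ j) x (V (p j)) := by
      intro x
      have h1 : divergence V x = divergence (fun x => (V x - F x) + F x) x := by simp
      rw [h1, divergence_add (hW.differentiable one_ne_zero x) (hF.differentiable one_ne_zero x)]
      congr 1
      simp only [divergence, F]
      rw [fderiv_fun_sum fun j _ => (hFj j).differentiable one_ne_zero x]
      simp only [_root_.sum_apply, WithLp.ofLp_sum, Finset.sum_apply]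
      rw [Finset.sum_comm]
      refine Finset.sum_congr rfl fun j _ => ?_
      exact divergence_smul_const ((hψ j).differentiable one_ne_zero x) _
    have hfd : ∀ j, IntegrableOn (fun x => fderiv ℝ (ψ j) x (V (p j))) Ω := fun j =>
      integrableOn_of_continuous_of_isBounded
        (((hψ j).continuous_fderiv one_ne_zero).clm_apply continuous_const) hΩb
    have h2 : ∫ x in Ω, divergence V x = (∫ x in Ω, divergence (fun x => V x - F x) x) +
        ∑ j, ∫ x in Ω, fderiv ℝ (ψ j) x (V (p j)) := by
      simp_rw [hdiv]
      rw [integral_add (integrableOn_of_continuous_of_isBounded (continuous_divergence hW) hΩb)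
        (integrable_finsetSum _ fun j _ => hfd j), integral_finsetSum _ fun j _ => hfd j]
    have h3 : ∑ j, ∫ x in Ω, fderiv ℝ (ψ j) x (V (p j)) ≤
        ∫ x, ‖V x‖ ∂(boundaryMeasure Ω) + ε * M := by
      calc _ ≤ ∑ j, ‖V (p j)‖ * ∫ x, |ψ j x| ∂(boundaryMeasure Ω) :=
            Finset.sum_le_sum fun j _ =>
              (le_abs_self _).trans (abs_integral_fderiv_le hΩ hΩb hH _ (hψ j))
        _ = ∫ x, ∑ j, ‖V (p j)‖ * |ψ j x| ∂(boundaryMeasure Ω) := by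
            simp_rw [← integral_const_mul]
            rw [integral_finsetSum]
            exact fun j _ => (integrable_boundaryMeasure (hψ j).continuous.abs hΩb hH).const_mul _
        _ ≤ ∫ x, (‖V x‖ + ε) ∂(boundaryMeasure Ω) := by
            refine setIntegral_mono_on ?_ ?_ isClosed_frontier.measurableSet fun x hx => ?_
            · exact integrable_finsetSum _ fun j _ =>
                (integrable_boundaryMeasure (hψ j).continuous.abs hΩb hH).const_mul _
            · exact hVi.add (integrable_const _)
            · calc _ ≤ ∑ j, ψ j x * (‖V x‖ + ε) := by
                    refine Finset.sum_le_sum fun j _ => ?_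
                    have h4 := hclose x hx j
                    have h5 : ‖V (p j)‖ ≤ ‖V x‖ + ‖V x - V (p j)‖ := by
                      have := norm_sub_le (V x) (V x - V (p j))
                      simpa using this
                    rw [abs_of_nonneg (hψ0 j x)]
                    nlinarith [mul_le_mul_of_nonneg_left h5 (hψ0 j x)]
                _ = _ := by rw [← Finset.sum_mul, hψ1 x hx, one_mul]
        _ = _ := by
            rw [integral_add hVi (integrable_const _), integral_const, smul_eq_mul]
            ring
    have h6 : ∫ x, ‖V x - F x‖ ∂(boundaryMeasure Ω) ≤ ε * M := by
      calc _ ≤ ∫ x, ε ∂(boundaryMeasure Ω) := by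
            refine setIntegral_mono_on ?_ ?_ isClosed_frontier.measurableSet fun x hx => ?_
            · exact integrable_boundaryMeasure hW.continuous.norm hΩb hH
            · exact integrable_const (μ := boundaryMeasure Ω) ε
            · have h7 : V x - F x = ∑ j, ψ j x • (V x - V (p j)) := by
                simp_rw [smul_sub, Finset.sum_sub_distrib, ← Finset.sum_smul]
                rw [hψ1 x hx, one_smul]
              calc ‖V x - F x‖ ≤ ∑ j, ‖ψ j x • (V x - V (p j))‖ := by
                    rw [h7]; exact norm_sum_le _ _
                _ ≤ ∑ j, ψ j x * ε := by
                    refine Finset.sum_le_sum fun j _ => ?_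
                    rw [norm_smul, Real.norm_of_nonneg (hψ0 j x)]
                    exact hclose x hx j
                _ = ε := by rw [← Finset.sum_mul, hψ1 x hx, one_mul]
        _ = _ := by rw [integral_const, smul_eq_mul]; ring
    have h8 := integral_divergence_le_mul hΩ hΩb hH hW
    have h9 := mul_le_mul_of_nonneg_left h6 (Nat.cast_nonneg (α := ℝ) N)
    linarith
  have hlim : Tendsto (fun ε : ℝ => ∫ x, ‖V x‖ ∂(boundaryMeasure Ω) + ε * M + N * (ε * M)) (𝓝[>] 0)
      (𝓝 (∫ x, ‖V x‖ ∂(boundaryMeasure Ω))) := by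
    have : Continuous fun ε : ℝ =>
      ∫ x, ‖V x‖ ∂(boundaryMeasure Ω) + ε * M + N * (ε * M) := by fun_prop
    have h := (this.tendsto 0).mono_left (nhdsWithin_le_nhds (s := Set.Ioi 0))
    simpa using h
  exact ge_of_tendsto hlim (by filter_upwards [self_mem_nhdsWithin] with ε hε using hbound ε hε)

/-! ### The divergence theorem on a ball -/

lemma hausdorff_frontier_ball_ne_top (hN : 1 ≤ N) (y : 𝔼) {r : ℝ} (hr : 0 < r) :
    μHE[N - 1] (frontier (Metric.ball y r)) ≠ ⊤ := by
  rw [frontier_ball y hr.ne']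
  intro h
  have h1 := hausdorff_sphere_le hN y hr
  rw [h, ENNReal.mul_top (by simpa using hr)] at h1
  exact (ENNReal.mul_lt_top (by simp) measure_ball_lt_top).not_ge h1

lemma isFiniteMeasure_boundaryMeasure_ball (hN : 1 ≤ N) (y : 𝔼) {r : ℝ} (hr : 0 < r) :
    IsFiniteMeasure (boundaryMeasure (Metric.ball y r)) :=
  ⟨by simpa [boundaryMeasure] using (hausdorff_frontier_ball_ne_top hN y hr).lt_top⟩

lemma mul_boundaryMeasure_ball_le (hN : 1 ≤ N) (y : 𝔼) {r : ℝ} (hr : 0 < r) :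
    r * (boundaryMeasure (Metric.ball y r)).real Set.univ ≤ N * volume.real (Metric.ball y r) := by
  have h1 := hausdorff_sphere_le hN y hr
  have h2 : (boundaryMeasure (Metric.ball y r)).real Set.univ =
      (μHE[N - 1] (Metric.sphere y r)).toReal := by
    simp [Measure.real, boundaryMeasure, frontier_ball y hr.ne']
  have h3 := ENNReal.toReal_mono (ENNReal.mul_lt_top (by simp) measure_ball_lt_top).ne h1
  rw [ENNReal.toReal_mul, ENNReal.toReal_mul, ENNReal.toReal_ofReal hr.le, ENNReal.toReal_natCast]
    at h3
  rw [h2]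
  exact h3

/-- The divergence theorem on a ball. The radial field `x - y` is an equality case of the divergence
inequality, since the sphere has no more surface measure than it should, and the theorem is the
first-order condition along the fields `(x - y) + t V`. -/
theorem integral_divergence_ball (hN : 1 ≤ N) (y : 𝔼) {r : ℝ} (hr : 0 < r) {V : 𝔼 → 𝔼}
    (hV : ContDiff ℝ 1 V) :
    r * ∫ x in Metric.ball y r, divergence V x =
      ∫ x, inner ℝ (x - y) (V x) ∂(boundaryMeasure (Metric.ball y r)) := by
  have hH := hausdorff_frontier_ball_ne_top hN y hr
  have hb : Bornology.IsBounded (Metric.ball y r) := Metric.isBounded_ball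
  have hfin := isFiniteMeasure_boundaryMeasure_ball hN y hr
  set μ := boundaryMeasure (Metric.ball y r) with hμ
  set D := ∫ x in Metric.ball y r, divergence V x with hD
  set J := ∫ x, inner ℝ (x - y) (V x) ∂μ with hJ
  set C := ∫ x, ‖V x‖ ^ 2 ∂μ with hC
  have hi1 : Integrable (fun x => (inner ℝ (x - y) (V x) : ℝ)) μ :=
    integrable_boundaryMeasure (by have := hV.continuous; fun_prop) hb hH
  have hi2 : Integrable (fun x => ‖V x‖ ^ 2) μ :=
    integrable_boundaryMeasure (by have := hV.continuous; fun_prop) hb hH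
  have hX : ContDiff ℝ 1 fun x : 𝔼 => x - y := contDiff_id.sub contDiff_const
  have key : ∀ t : ℝ, t * (r * D - J) ≤ C / 2 * t ^ 2 := by
    intro t
    have htV : ContDiff ℝ 1 fun x => t • V x := hV.const_smul t
    have hW : ContDiff ℝ 1 fun x => (x - y) + t • V x := hX.add htV
    have h1 := integral_divergence_le Metric.isOpen_ball hb hH hW
    have h2 : ∫ x in Metric.ball y r, divergence (fun x => (x - y) + t • V x) x =
        N * volume.real (Metric.ball y r) + t * D := by
      have h3 : ∀ x, divergence (fun x => (x - y) + t • V x) x = N + t * divergence V x := by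
        intro x
        rw [divergence_add (hX.differentiable one_ne_zero x)
          (htV.differentiable one_ne_zero x), divergence_sub_const,
          divergence_smul (differentiableAt_const t) (hV.differentiable one_ne_zero x)]
        simp
      simp_rw [h3]
      rw [integral_add (integrableOn_of_continuous_of_isBounded continuous_const hb)
        ((integrableOn_of_continuous_of_isBounded (continuous_divergence hV) hb).const_mul t),
        integral_const_mul, setIntegral_const, smul_eq_mul, mul_comm (volume.real _)]
    -- on the sphere `a ≤ (r ^ 2 + a ^ 2) / (2 r)`, with equality at `t = 0`, bounds the norm by a
    -- quadratic polynomial in `t`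
    have h4 : ∫ x, ‖(x - y) + t • V x‖ ∂μ ≤
        ∫ x, (r + r⁻¹ * (t * inner ℝ (x - y) (V x)) + r⁻¹ * (t ^ 2 / 2 * ‖V x‖ ^ 2)) ∂μ := by
      refine setIntegral_mono_on (integrable_boundaryMeasure hW.continuous.norm hb hH) ?_
        isClosed_frontier.measurableSet fun x hx => ?_
      · exact (((integrable_const r).add ((hi1.const_mul t).const_mul r⁻¹)).add
          ((hi2.const_mul _).const_mul _))
      · rw [frontier_ball y hr.ne', mem_sphere_iff_norm] at hx
        have h5 := norm_add_sq_real (x - y) (t • V x)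
        rw [hx, real_inner_smul_right, norm_smul, mul_pow, Real.norm_eq_abs, sq_abs] at h5
        have h6 : r + r⁻¹ * (t * inner ℝ (x - y) (V x)) + r⁻¹ * (t ^ 2 / 2 * ‖V x‖ ^ 2) =
            (r ^ 2 + ‖x - y + t • V x‖ ^ 2) / (2 * r) := by
          rw [h5]; field_simp; ring
        rw [h6, le_div_iff₀ (by positivity)]
        nlinarith [sq_nonneg (r - ‖x - y + t • V x‖)]
    have h7 : ∫ x, (r + r⁻¹ * (t * inner ℝ (x - y) (V x)) + r⁻¹ * (t ^ 2 / 2 * ‖V x‖ ^ 2)) ∂μ =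
        r * μ.real Set.univ + r⁻¹ * (t * J) + r⁻¹ * (t ^ 2 / 2 * C) := by
      have ha : Integrable (fun x => r + r⁻¹ * (t * inner ℝ (x - y) (V x))) μ :=
        (integrable_const r).add ((hi1.const_mul t).const_mul r⁻¹)
      rw [integral_add ha ((hi2.const_mul _).const_mul _),
        integral_add (integrable_const r) ((hi1.const_mul t).const_mul r⁻¹), integral_const,
        integral_const_mul, integral_const_mul, integral_const_mul, integral_const_mul,
        smul_eq_mul, mul_comm (μ.real _)]
    have h8 := mul_boundaryMeasure_ball_le hN y hr
    rw [h2] at h1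
    rw [h7] at h4
    have h9 : t * D ≤ r⁻¹ * (t * J) + r⁻¹ * (t ^ 2 / 2 * C) := by linarith
    have h10 := mul_le_mul_of_nonneg_left h9 hr.le
    have h11 : r * (r⁻¹ * (t * J) + r⁻¹ * (t ^ 2 / 2 * C)) = t * J + t ^ 2 / 2 * C := by
      field_simp
    rw [h11] at h10
    linarith
  have hC0 : 0 ≤ C := integral_nonneg fun x => by positivity
  have h1 : r * D - J = 0 := by
    -- for this value of `t` the linear term exceeds the quadratic one
    have h2 := key ((r * D - J) / (C + 1))
    set a := r * D - J
    have h3 : C / 2 * (a / (C + 1)) ^ 2 ≤ a ^ 2 / (C + 1) / 2 := by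
      rw [div_pow, div_div, div_mul_div_comm, div_le_div_iff₀ (by positivity) (by positivity)]
      nlinarith [mul_nonneg (sq_nonneg a) hC0, mul_nonneg (mul_nonneg (sq_nonneg a) hC0) hC0]
    have h4 : a / (C + 1) * a = a ^ 2 / (C + 1) := by ring
    have h5 : a ^ 2 / (C + 1) ≤ 0 := by linarith
    have h6 : a ^ 2 ≤ 0 := by
      rw [div_le_iff₀ (by positivity), zero_mul] at h5
      exact h5
    nlinarith
  linarith

lemma mul_integral_fderiv_ball (hN : 1 ≤ N) (y : 𝔼) {r : ℝ} (hr : 0 < r) {φ : 𝔼 → ℝ}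
    (hφ : ContDiff ℝ 1 φ) (v : 𝔼) :
    r * ∫ x in Metric.ball y r, fderiv ℝ φ x v =
      ∫ x, φ x * inner ℝ (x - y) v ∂(boundaryMeasure (Metric.ball y r)) := by
  have h := integral_divergence_ball hN y hr (V := fun x => φ x • v) (hφ.smul contDiff_const)
  simp_rw [real_inner_smul_right] at h
  rw [← h]
  congr 1
  exact integral_congr_ae (Eventually.of_forall fun x =>
    (divergence_smul_const (hφ.differentiable one_ne_zero x) v).symm)

/-! ### Functions which are odd with respect to a hyperplane -/

/-- The Steklov inequality with the sharp constant for functions which vanish on a hyperplane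
through the centre of the ball: the linear function `⟪e, x⟫` is a ground state, and the divergence
theorem is applied to the field `f² / ⟪e, x⟫` in the direction `e`. -/
lemma integral_sq_le_of_abs_le_inner (hN : 1 ≤ N) {r : ℝ} (hr : 0 < r) {e : 𝔼} (he : ‖e‖ = 1)
    {f : 𝔼 → ℝ} (hf : ContDiff ℝ 1 f) {C : ℝ}
    (hC : ∀ x ∈ Metric.closedBall (0 : 𝔼) r, |f x| ≤ C * |inner ℝ e x|) :
    ∫ x, f x ^ 2 ∂(boundaryMeasure (Metric.ball (0 : 𝔼) r)) ≤
      r * ∫ x in Metric.ball (0 : 𝔼) r, fderiv ℝ f x e ^ 2 := by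
  have hH := hausdorff_frontier_ball_ne_top hN (0 : 𝔼) hr
  have hb : Bornology.IsBounded (Metric.ball (0 : 𝔼) r) := Metric.isBounded_ball
  have hfin := isFiniteMeasure_boundaryMeasure_ball hN (0 : 𝔼) hr
  set μ := boundaryMeasure (Metric.ball (0 : 𝔼) r) with hμ
  have hfc := hf.continuous
  have hf'c : Continuous fun x => fderiv ℝ f x e :=
    (hf.continuous_fderiv one_ne_zero).clm_apply continuous_const
  let l : 𝔼 →L[ℝ] ℝ := innerSL ℝ e
  have hl : ∀ x, l x = inner ℝ e x := fun x => rfl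
  have hle : l e = 1 := by rw [hl, real_inner_self_eq_norm_sq, he]; norm_num
  have hstep : ∀ ε : ℝ, 0 < ε → ∫ x, f x ^ 2 * (l x ^ 2 / (l x ^ 2 + ε)) ∂μ ≤
      r * (∫ x in Metric.ball (0 : 𝔼) r, fderiv ℝ f x e ^ 2) +
      r * ∫ x in Metric.ball (0 : 𝔼) r, ε * f x ^ 2 / (l x ^ 2 + ε) ^ 2 := by
    intro ε hε
    have hpos : ∀ x, 0 < l x ^ 2 + ε := fun x => by positivity
    -- a regularization of `f² / l`
    let g : 𝔼 → ℝ := fun x => f x ^ 2 * (l x / (l x ^ 2 + ε))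
    have hg : ContDiff ℝ 1 g :=
      (hf.pow 2).mul (l.contDiff.div ((l.contDiff.pow 2).add contDiff_const) fun x => (hpos x).ne')
    have hgd : ∀ x, fderiv ℝ g x e = 2 * f x * fderiv ℝ f x e * (l x / (l x ^ 2 + ε)) +
        f x ^ 2 * ((ε - l x ^ 2) / (l x ^ 2 + ε) ^ 2) := by
      intro x
      -- the derivative along the line `x + t e`
      have h1 : HasDerivAt (fun t : ℝ => f (x + t • e)) (fderiv ℝ f x e) 0 :=
        ((hf.differentiable one_ne_zero x).hasFDerivAt.hasLineDerivAt e)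
      have h2 : HasDerivAt (fun t : ℝ => l (x + t • e)) 1 0 := by
        have := (l.hasFDerivAt (x := x)).hasLineDerivAt e
        rw [hle] at this
        exact this
      have h3 := (h1.fun_pow 2).fun_mul
        (h2.fun_div ((h2.fun_pow 2).add_const ε) (by simpa using (hpos x).ne'))
      have h4 : HasDerivAt (fun t : ℝ => g (x + t • e)) (fderiv ℝ g x e) 0 :=
        ((hg.differentiable one_ne_zero x).hasFDerivAt.hasLineDerivAt e)
      rw [h4.unique h3]
      simp only [zero_smul, add_zero, Nat.cast_ofNat, Nat.add_one_sub_one, pow_one]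
      ring
    have h := mul_integral_fderiv_ball hN (0 : 𝔼) hr hg e
    have h1 : ∫ x, g x * inner ℝ (x - 0) e ∂μ = ∫ x, f x ^ 2 * (l x ^ 2 / (l x ^ 2 + ε)) ∂μ := by
      refine integral_congr_ae (Eventually.of_forall fun x => ?_)
      simp only [g, sub_zero, real_inner_comm, hl]
      ring
    rw [← h1, ← h, ← mul_add]
    refine mul_le_mul_of_nonneg_left ?_ hr.le
    have hi1 : IntegrableOn (fun x => fderiv ℝ f x e ^ 2) (Metric.ball (0 : 𝔼) r) :=
      integrableOn_of_continuous_of_isBounded (hf'c.pow 2) hb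
    have hi2 : IntegrableOn (fun x => ε * f x ^ 2 / (l x ^ 2 + ε) ^ 2) (Metric.ball (0 : 𝔼) r) :=
      integrableOn_of_continuous_of_isBounded
        ((continuous_const.mul (hfc.pow 2)).div (((l.continuous.pow 2).add continuous_const).pow 2)
          fun x => (pow_pos (hpos x) 2).ne') hb
    rw [← integral_add hi1 hi2]
    refine integral_mono (integrableOn_of_continuous_of_isBounded
      ((hg.continuous_fderiv one_ne_zero).clm_apply continuous_const) hb) (hi1.add hi2) fun x => ?_
    simp only
    rw [hgd]
    have h5 : fderiv ℝ f x e ^ 2 + ε * f x ^ 2 / (l x ^ 2 + ε) ^ 2 -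
        (2 * f x * fderiv ℝ f x e * (l x / (l x ^ 2 + ε)) +
        f x ^ 2 * ((ε - l x ^ 2) / (l x ^ 2 + ε) ^ 2)) =
        (fderiv ℝ f x e - f x * (l x / (l x ^ 2 + ε))) ^ 2 := by
      have := (hpos x).ne'
      field_simp
      ring
    nlinarith [sq_nonneg (fderiv ℝ f x e - f x * (l x / (l x ^ 2 + ε)))]
  have hlzero : ∀ x ∈ Metric.closedBall (0 : 𝔼) r, l x = 0 → f x = 0 := by
    intro x hx h0
    have := hC x hx
    rw [← hl, h0, abs_zero, mul_zero] at this
    exact abs_nonpos_iff.1 this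
  have hlim1 : Tendsto (fun ε : ℝ => ∫ x, f x ^ 2 * (l x ^ 2 / (l x ^ 2 + ε)) ∂μ) (𝓝[>] 0)
      (𝓝 (∫ x, f x ^ 2 ∂μ)) := by
    refine tendsto_integral_filter_of_dominated_convergence (fun x => f x ^ 2) ?_ ?_
      (integrable_boundaryMeasure (hfc.pow 2) hb hH) ?_
    · filter_upwards [self_mem_nhdsWithin] with ε hε
      have hε' : 0 < ε := hε
      refine ((hfc.pow 2).mul ((l.continuous.pow 2).div
        ((l.continuous.pow 2).add continuous_const) fun x => ?_)).aestronglyMeasurable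
      exact (by positivity : l x ^ 2 + ε ≠ 0)
    · filter_upwards [self_mem_nhdsWithin] with ε hε
      have hε' : 0 < ε := hε
      refine Eventually.of_forall fun x => ?_
      rw [Real.norm_of_nonneg (by positivity)]
      refine mul_le_of_le_one_right (sq_nonneg _) ?_
      rw [div_le_one (by positivity)]
      linarith
    · refine (ae_restrict_mem isClosed_frontier.measurableSet).mono fun x hx => ?_
      have hxb : x ∈ Metric.closedBall (0 : 𝔼) r := by
        rw [frontier_ball _ hr.ne'] at hx
        exact Metric.sphere_subset_closedBall hx
      by_cases h0 : l x = 0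
      · simp [hlzero x hxb h0]
      · have h1 : ContinuousAt (fun ε : ℝ => f x ^ 2 * (l x ^ 2 / (l x ^ 2 + ε))) 0 := by
          have : l x ^ 2 + 0 ≠ 0 := by simpa using h0
          fun_prop (disch := assumption)
        have h2 := h1.tendsto.mono_left (nhdsWithin_le_nhds (s := Set.Ioi 0))
        rwa [add_zero, div_self (pow_ne_zero 2 h0), mul_one] at h2
  have hlim2 : Tendsto (fun ε : ℝ =>
      ∫ x in Metric.ball (0 : 𝔼) r, ε * f x ^ 2 / (l x ^ 2 + ε) ^ 2) (𝓝[>] 0)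
      (𝓝 (∫ x in Metric.ball (0 : 𝔼) r, 0)) := by
    have hbf : IsFiniteMeasure (volume.restrict (Metric.ball (0 : 𝔼) r)) :=
      ⟨by simpa using measure_ball_lt_top⟩
    refine tendsto_integral_filter_of_dominated_convergence (fun x => C ^ 2) ?_ ?_
      (integrable_const _) ?_
    · filter_upwards [self_mem_nhdsWithin] with ε hε
      have hε' : 0 < ε := hε
      refine ((continuous_const.mul (hfc.pow 2)).div (((l.continuous.pow 2).add
        continuous_const).pow 2) fun x => ?_).aestronglyMeasurable
      exact (by positivity : (l x ^ 2 + ε) ^ 2 ≠ 0)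
    · filter_upwards [self_mem_nhdsWithin] with ε hε
      have hε' : 0 < ε := hε
      refine (ae_restrict_mem Metric.isOpen_ball.measurableSet).mono fun x hx => ?_
      have h1 := hC x (Metric.ball_subset_closedBall hx)
      rw [← hl] at h1
      have h2 : f x ^ 2 ≤ C ^ 2 * l x ^ 2 := by
        rw [← sq_abs (f x), ← sq_abs (l x), ← mul_pow]
        exact pow_le_pow_left₀ (abs_nonneg _) h1 2
      rw [Real.norm_of_nonneg (by positivity), div_le_iff₀ (by positivity)]
      have h3 : ε * f x ^ 2 ≤ ε * (C ^ 2 * l x ^ 2) := mul_le_mul_of_nonneg_left h2 hε'.le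
      have h4 : ε * l x ^ 2 ≤ (l x ^ 2 + ε) ^ 2 := by
        nlinarith [mul_nonneg hε'.le (sq_nonneg (l x)), sq_nonneg (l x ^ 2), sq_nonneg ε]
      calc _ ≤ _ := h3
        _ = C ^ 2 * (ε * l x ^ 2) := by ring
        _ ≤ _ := by gcongr
    · refine (ae_restrict_mem Metric.isOpen_ball.measurableSet).mono fun x hx => ?_
      by_cases h0 : l x = 0
      · simp [hlzero x (Metric.ball_subset_closedBall hx) h0]
      · have h1 : ContinuousAt (fun ε : ℝ => ε * f x ^ 2 / (l x ^ 2 + ε) ^ 2) 0 := by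
          have : (l x ^ 2 + 0) ^ 2 ≠ 0 := by simpa using h0
          fun_prop (disch := assumption)
        have h2 := h1.tendsto.mono_left (nhdsWithin_le_nhds (s := Set.Ioi 0))
        rwa [zero_mul, zero_div] at h2
  have hlim3 := (hlim2.const_mul r).const_add
    (r * ∫ x in Metric.ball (0 : 𝔼) r, fderiv ℝ f x e ^ 2)
  rw [integral_zero, mul_zero, add_zero] at hlim3
  exact le_of_tendsto_of_tendsto hlim1 hlim3
    (by filter_upwards [self_mem_nhdsWithin] with ε hε using hstep ε hε)

/-! ### Symmetrization with respect to hyperplanes -/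

/-- The reflection in the hyperplane through the origin orthogonal to `e`. -/
noncomputable def hyperplaneReflection (e : 𝔼) : 𝔼 ≃ₗᵢ[ℝ] 𝔼 := (ℝ ∙ e)ᗮ.reflection

lemma hyperplaneReflection_apply {e : 𝔼} (he : ‖e‖ = 1) (x : 𝔼) :
    hyperplaneReflection e x = x - (2 * inner ℝ e x) • e := by
  rw [hyperplaneReflection, Submodule.reflection_orthogonal_apply, Submodule.reflection_apply,
    Submodule.starProjection_unit_singleton ℝ he, two_smul, two_mul, add_smul]
  abel

@[simp] lemma hyperplaneReflection_hyperplaneReflection (e x : 𝔼) :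
    hyperplaneReflection e (hyperplaneReflection e x) = x :=
  Submodule.reflection_reflection _ x

/-- The part of `f` which is even with respect to the hyperplane orthogonal to `e`. -/
noncomputable def evenPart (e : 𝔼) (f : 𝔼 → ℝ) (x : 𝔼) : ℝ :=
  (f x + f (hyperplaneReflection e x)) / 2

/-- The part of `f` which is odd with respect to the hyperplane orthogonal to `e`. -/
noncomputable def oddPart (e : 𝔼) (f : 𝔼 → ℝ) (x : 𝔼) : ℝ :=
  (f x - f (hyperplaneReflection e x)) / 2

lemma contDiff_evenPart (e : 𝔼) {f : 𝔼 → ℝ} (hf : ContDiff ℝ 1 f) :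
    ContDiff ℝ 1 (evenPart e f) :=
  (hf.add (hf.comp (hyperplaneReflection e).contDiff)).div_const 2

lemma contDiff_oddPart (e : 𝔼) {f : 𝔼 → ℝ} (hf : ContDiff ℝ 1 f) :
    ContDiff ℝ 1 (oddPart e f) :=
  (hf.sub (hf.comp (hyperplaneReflection e).contDiff)).div_const 2

lemma hasGradientAt_comp_reflection (e : 𝔼) {f : 𝔼 → ℝ} (hf : ContDiff ℝ 1 f) (x : 𝔼) :
    HasGradientAt (fun y => f (hyperplaneReflection e y))
      ((hyperplaneReflection e).symm (gradient f (hyperplaneReflection e x))) x := by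
  rw [hasGradientAt_iff_hasFDerivAt]
  have h1 := (hf.differentiable one_ne_zero (hyperplaneReflection e x)).hasFDerivAt.comp x
    (hyperplaneReflection e).toContinuousLinearEquiv.hasFDerivAt
  refine h1.congr_fderiv ?_
  ext w
  rw [InnerProductSpace.toDual_apply_apply, LinearIsometryEquiv.inner_map_eq_flip,
    LinearIsometryEquiv.symm_symm, inner_gradient_left]
  rfl

lemma gradient_evenPart (e : 𝔼) {f : 𝔼 → ℝ} (hf : ContDiff ℝ 1 f) (x : 𝔼) :
    gradient (evenPart e f) x = (2 : ℝ)⁻¹ • (gradient f x +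
      (hyperplaneReflection e).symm (gradient f (hyperplaneReflection e x))) := by
  refine HasGradientAt.gradient ?_
  have h1 := (hf.differentiable one_ne_zero x).hasGradientAt
  have h2 := hasGradientAt_comp_reflection e hf x
  rw [hasGradientAt_iff_hasFDerivAt] at *
  rw [map_smul, map_add]
  have h3 := (h1.add h2).const_smul (2 : ℝ)⁻¹
  refine h3.congr_of_eventuallyEq (Eventually.of_forall fun y => ?_)
  simp only [evenPart, Pi.smul_apply, Pi.add_apply, smul_eq_mul]
  ring

lemma gradient_oddPart (e : 𝔼) {f : 𝔼 → ℝ} (hf : ContDiff ℝ 1 f) (x : 𝔼) :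
    gradient (oddPart e f) x = (2 : ℝ)⁻¹ • (gradient f x -
      (hyperplaneReflection e).symm (gradient f (hyperplaneReflection e x))) := by
  refine HasGradientAt.gradient ?_
  have h1 := (hf.differentiable one_ne_zero x).hasGradientAt
  have h2 := hasGradientAt_comp_reflection e hf x
  rw [hasGradientAt_iff_hasFDerivAt] at *
  rw [map_smul, map_sub]
  have h3 := (h1.sub h2).const_smul (2 : ℝ)⁻¹
  refine h3.congr_of_eventuallyEq (Eventually.of_forall fun y => ?_)
  simp only [oddPart, Pi.smul_apply, Pi.sub_apply, smul_eq_mul]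
  ring

lemma continuous_gradient {f : 𝔼 → ℝ} (hf : ContDiff ℝ 1 f) : Continuous (gradient f) :=
  (InnerProductSpace.toDual ℝ 𝔼).symm.continuous.comp (hf.continuous_fderiv one_ne_zero)

lemma exists_lipschitzOnWith_closedBall {f : 𝔼 → ℝ} (hf : ContDiff ℝ 1 f) (r : ℝ) :
    ∃ C : NNReal, LipschitzOnWith C f (Metric.closedBall 0 r) := by
  obtain ⟨C, hC⟩ := (isCompact_closedBall (0 : 𝔼) r).exists_bound_of_continuousOn
    (hf.continuous_fderiv one_ne_zero).continuousOn
  refine ⟨C.toNNReal, (convex_closedBall (0 : 𝔼) r).lipschitzOnWith_of_nnnorm_fderiv_le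
    (fun x _ => hf.differentiable one_ne_zero x) fun x hx => ?_⟩
  rw [← NNReal.coe_le_coe, coe_nnnorm]
  exact (hC x hx).trans (Real.le_coe_toNNReal C)

section Ball

variable {r : ℝ}

lemma measurePreserving_reflection_ball (e : 𝔼) :
    MeasurePreserving (hyperplaneReflection e) (volume.restrict (Metric.ball 0 r))
      (volume.restrict (Metric.ball 0 r)) := by
  have h := (hyperplaneReflection e).measurePreserving.restrict_preimage
    (Metric.isOpen_ball (x := (0 : 𝔼)) (ε := r)).measurableSet
  have h2 : hyperplaneReflection e ⁻¹' Metric.ball 0 r = Metric.ball 0 r := by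
    rw [LinearIsometryEquiv.preimage_ball, map_zero]
  rwa [h2] at h

lemma measurePreserving_reflection_sphere (hr : 0 < r) (e : 𝔼) :
    MeasurePreserving (hyperplaneReflection e) (boundaryMeasure (Metric.ball 0 r))
      (boundaryMeasure (Metric.ball 0 r)) := by
  have h := ((hyperplaneReflection e).toIsometryEquiv.measurePreserving_euclideanHausdorffMeasure
    (N - 1)).restrict_preimage
    (isClosed_frontier (s := Metric.ball (0 : 𝔼) r)).measurableSet
  have h2 : (hyperplaneReflection e).toIsometryEquiv ⁻¹' frontier (Metric.ball 0 r) =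
      frontier (Metric.ball 0 r) := by
    rw [frontier_ball _ hr.ne']
    exact (LinearIsometryEquiv.preimage_sphere (hyperplaneReflection e) 0 r).trans
      (by rw [map_zero])
  rw [h2] at h
  exact h

lemma integral_comp_reflection_ball (e : 𝔼) (g : 𝔼 → ℝ) :
    ∫ x in Metric.ball 0 r, g (hyperplaneReflection e x) = ∫ x in Metric.ball 0 r, g x :=
  (measurePreserving_reflection_ball e).integral_comp
    (hyperplaneReflection e).toHomeomorph.measurableEmbedding g

lemma integral_comp_reflection_sphere (hr : 0 < r) (e : 𝔼) (g : 𝔼 → ℝ) :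
    ∫ x, g (hyperplaneReflection e x) ∂(boundaryMeasure (Metric.ball 0 r)) =
      ∫ x, g x ∂(boundaryMeasure (Metric.ball 0 r)) :=
  (measurePreserving_reflection_sphere hr e).integral_comp
    (hyperplaneReflection e).toHomeomorph.measurableEmbedding g

lemma integral_sq_oddPart_le (hN : 1 ≤ N) (hr : 0 < r) {e : 𝔼} (he : ‖e‖ = 1) {f : 𝔼 → ℝ}
    (hf : ContDiff ℝ 1 f) :
    ∫ x, oddPart e f x ^ 2 ∂(boundaryMeasure (Metric.ball (0 : 𝔼) r)) ≤
      r * ∫ x in Metric.ball (0 : 𝔼) r, ‖gradient (oddPart e f) x‖ ^ 2 := by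
  obtain ⟨C, hC⟩ := exists_lipschitzOnWith_closedBall hf r
  have ho := contDiff_oddPart e hf
  refine (integral_sq_le_of_abs_le_inner hN hr he ho (C := C) fun x hx => ?_).trans ?_
  · have hx' : hyperplaneReflection e x ∈ Metric.closedBall (0 : 𝔼) r := by
      simpa using hx
    have h1 := hC.dist_le_mul x hx _ hx'
    rw [hyperplaneReflection_apply he, dist_eq_norm x, sub_sub_cancel, norm_smul, he, mul_one,
      norm_mul, Real.norm_eq_abs (inner ℝ e x), Real.norm_ofNat, Real.dist_eq] at h1
    rw [oddPart, abs_div, abs_two, hyperplaneReflection_apply he, div_le_iff₀ two_pos]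
    linarith
  · refine mul_le_mul_of_nonneg_left ?_ hr.le
    refine integral_mono (integrableOn_of_continuous_of_isBounded
      (((ho.continuous_fderiv one_ne_zero).clm_apply continuous_const).pow 2) Metric.isBounded_ball)
      (integrableOn_of_continuous_of_isBounded ((continuous_gradient ho).norm.pow 2)
        Metric.isBounded_ball) fun x => ?_
    simp only
    rw [← inner_gradient_left]
    refine sq_le_sq.2 ?_
    rw [abs_norm]
    have := abs_real_inner_le_norm (gradient (oddPart e f) x) e
    rwa [he, mul_one] at this

/-- The Steklov deficit does not increase under symmetrization: it splits into those of the even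
and the odd part, and the latter is nonnegative. -/
lemma deficit_evenPart_le (hN : 1 ≤ N) (hr : 0 < r) {e : 𝔼} (he : ‖e‖ = 1) {f : 𝔼 → ℝ}
    (hf : ContDiff ℝ 1 f) :
    r * (∫ x in Metric.ball (0 : 𝔼) r, ‖gradient (evenPart e f) x‖ ^ 2) -
        ∫ x, evenPart e f x ^ 2 ∂(boundaryMeasure (Metric.ball (0 : 𝔼) r)) ≤
      r * (∫ x in Metric.ball (0 : 𝔼) r, ‖gradient f x‖ ^ 2) -
        ∫ x, f x ^ 2 ∂(boundaryMeasure (Metric.ball (0 : 𝔼) r)) := by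
  have hH := hausdorff_frontier_ball_ne_top hN (0 : 𝔼) hr
  have hb : Bornology.IsBounded (Metric.ball (0 : 𝔼) r) := Metric.isBounded_ball
  have ho := contDiff_oddPart e hf
  have hev := contDiff_evenPart e hf
  have hodd := integral_sq_oddPart_le hN hr he hf
  have hρ : Continuous (hyperplaneReflection e) := (hyperplaneReflection e).continuous
  have hbd : ∫ x, evenPart e f x ^ 2 ∂(boundaryMeasure (Metric.ball (0 : 𝔼) r)) +
      ∫ x, oddPart e f x ^ 2 ∂(boundaryMeasure (Metric.ball (0 : 𝔼) r)) =
      ∫ x, f x ^ 2 ∂(boundaryMeasure (Metric.ball (0 : 𝔼) r)) := by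
    have hi : Integrable (fun x => f x ^ 2) (boundaryMeasure (Metric.ball (0 : 𝔼) r)) :=
      integrable_boundaryMeasure (hf.continuous.pow 2) hb hH
    have hi' : Integrable (fun x => f (hyperplaneReflection e x) ^ 2)
        (boundaryMeasure (Metric.ball (0 : 𝔼) r)) :=
      integrable_boundaryMeasure ((hf.continuous.comp hρ).pow 2) hb hH
    have h2 : ∀ {g : 𝔼 → ℝ}, ContDiff ℝ 1 g →
        Integrable (fun x => g x ^ 2) (boundaryMeasure (Metric.ball (0 : 𝔼) r)) :=
      fun hg => integrable_boundaryMeasure (hg.continuous.pow 2) hb hH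
    rw [← integral_add (h2 hev) (h2 ho)]
    have h1 : ∀ x, evenPart e f x ^ 2 + oddPart e f x ^ 2 =
        2⁻¹ * (f x ^ 2 + f (hyperplaneReflection e x) ^ 2) := by
      intro x; simp only [evenPart, oddPart]; ring
    simp_rw [h1]
    rw [integral_const_mul, integral_add hi hi',
      integral_comp_reflection_sphere hr e fun x => f x ^ 2]
    ring
  have hint : (∫ x in Metric.ball (0 : 𝔼) r, ‖gradient (evenPart e f) x‖ ^ 2) +
      (∫ x in Metric.ball (0 : 𝔼) r, ‖gradient (oddPart e f) x‖ ^ 2) =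
      ∫ x in Metric.ball (0 : 𝔼) r, ‖gradient f x‖ ^ 2 := by
    have hi : IntegrableOn (fun x => ‖gradient f x‖ ^ 2) (Metric.ball (0 : 𝔼) r) :=
      integrableOn_of_continuous_of_isBounded ((continuous_gradient hf).norm.pow 2) hb
    have hi' : IntegrableOn (fun x => ‖gradient f (hyperplaneReflection e x)‖ ^ 2)
        (Metric.ball (0 : 𝔼) r) :=
      integrableOn_of_continuous_of_isBounded (((continuous_gradient hf).comp hρ).norm.pow 2) hb
    have h2 : ∀ {g : 𝔼 → ℝ}, ContDiff ℝ 1 g →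
        IntegrableOn (fun x => ‖gradient g x‖ ^ 2) (Metric.ball (0 : 𝔼) r) :=
      fun hg => integrableOn_of_continuous_of_isBounded ((continuous_gradient hg).norm.pow 2) hb
    rw [← integral_add (h2 hev) (h2 ho)]
    have h1 : ∀ x, ‖gradient (evenPart e f) x‖ ^ 2 + ‖gradient (oddPart e f) x‖ ^ 2 =
        2⁻¹ * (‖gradient f x‖ ^ 2 + ‖gradient f (hyperplaneReflection e x)‖ ^ 2) := by
      intro x
      rw [gradient_evenPart e hf, gradient_oddPart e hf, norm_smul, norm_smul]
      have := parallelogram_law_with_norm ℝ (gradient f x)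
        ((hyperplaneReflection e).symm (gradient f (hyperplaneReflection e x)))
      rw [LinearIsometryEquiv.norm_map] at this
      rw [norm_inv, Real.norm_ofNat]
      linarith
    simp_rw [h1]
    rw [integral_const_mul, integral_add hi hi',
      integral_comp_reflection_ball e fun x => ‖gradient f x‖ ^ 2]
    ring
  rw [← hbd, ← hint, mul_add]
  linarith

end Ball

/-- The functions obtained from `f` by finitely many symmetrizations with respect to hyperplanes
through the origin. -/
inductive IsIteratedSymmetrization (f : 𝔼 → ℝ) : (𝔼 → ℝ) → Prop
  | refl : IsIteratedSymmetrization f f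
  | step (e : 𝔼) (he : ‖e‖ = 1) (g : 𝔼 → ℝ) (hg : IsIteratedSymmetrization f g) :
      IsIteratedSymmetrization f (evenPart e g)

section Ball

variable {r : ℝ}

lemma IsIteratedSymmetrization.contDiff {f g : 𝔼 → ℝ} (h : IsIteratedSymmetrization f g)
    (hf : ContDiff ℝ 1 f) : ContDiff ℝ 1 g := by
  induction h with
  | refl => exact hf
  | step e he g hg ih => exact contDiff_evenPart e ih

lemma IsIteratedSymmetrization.deficit_le (hN : 1 ≤ N) (hr : 0 < r) {f g : 𝔼 → ℝ}
    (h : IsIteratedSymmetrization f g) (hf : ContDiff ℝ 1 f) :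
    r * (∫ x in Metric.ball (0 : 𝔼) r, ‖gradient g x‖ ^ 2) -
        ∫ x, g x ^ 2 ∂(boundaryMeasure (Metric.ball (0 : 𝔼) r)) ≤
      r * (∫ x in Metric.ball (0 : 𝔼) r, ‖gradient f x‖ ^ 2) -
        ∫ x, f x ^ 2 ∂(boundaryMeasure (Metric.ball (0 : 𝔼) r)) := by
  induction h with
  | refl => exact le_rfl
  | step e he g hg ih => exact (deficit_evenPart_le hN hr he (hg.contDiff hf)).trans ih

lemma IsIteratedSymmetrization.integral_eq (hN : 1 ≤ N) (hr : 0 < r) {f g : 𝔼 → ℝ}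
    (h : IsIteratedSymmetrization f g) (hf : ContDiff ℝ 1 f) :
    ∫ x, g x ∂(boundaryMeasure (Metric.ball (0 : 𝔼) r)) =
      ∫ x, f x ∂(boundaryMeasure (Metric.ball (0 : 𝔼) r)) := by
  induction h with
  | refl => rfl
  | step e he g hg ih =>
    have hH := hausdorff_frontier_ball_ne_top hN (0 : 𝔼) hr
    have hgc := (hg.contDiff hf).continuous
    have h1 := integrable_boundaryMeasure hgc Metric.isBounded_ball hH
    have h2 : Integrable (fun x => g (hyperplaneReflection e x))
        (boundaryMeasure (Metric.ball (0 : 𝔼) r)) := integrable_boundaryMeasure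
      (hgc.comp (hyperplaneReflection e).continuous) Metric.isBounded_ball hH
    have h3 := integral_comp_reflection_sphere hr e g
    simp only [evenPart]
    rw [integral_div, integral_add h1 h2]
    rw [h3, ih]
    ring

lemma IsIteratedSymmetrization.abs_le {f g : 𝔼 → ℝ} (h : IsIteratedSymmetrization f g) {C : ℝ}
    (hf : ∀ x ∈ Metric.sphere (0 : 𝔼) r, |f x| ≤ C) : ∀ x ∈ Metric.sphere (0 : 𝔼) r, |g x| ≤ C := by
  induction h with
  | refl => exact hf
  | step e he g hg ih =>
    intro x hx
    have h1 := ih x hx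
    have h2 := ih (hyperplaneReflection e x) (by simpa using hx)
    rw [evenPart, abs_div, abs_two, div_le_iff₀ two_pos]
    linarith [abs_add_le (g x) (g (hyperplaneReflection e x))]

lemma IsIteratedSymmetrization.dist_le {f g : 𝔼 → ℝ} (h : IsIteratedSymmetrization f g) {C : ℝ}
    (hf : ∀ x ∈ Metric.sphere (0 : 𝔼) r, ∀ y ∈ Metric.sphere (0 : 𝔼) r,
      |f x - f y| ≤ C * dist x y) :
    ∀ x ∈ Metric.sphere (0 : 𝔼) r, ∀ y ∈ Metric.sphere (0 : 𝔼) r, |g x - g y| ≤ C * dist x y := by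
  induction h with
  | refl => exact hf
  | step e he g hg ih =>
    intro x hx y hy
    have h1 := ih x hx y hy
    have h2 := ih (hyperplaneReflection e x) (by simpa using hx) (hyperplaneReflection e y)
      (by simpa using hy)
    rw [LinearIsometryEquiv.dist_map] at h2
    have h3 : evenPart e g x - evenPart e g y = ((g x - g y) +
      (g (hyperplaneReflection e x) - g (hyperplaneReflection e y))) / 2 := by
      simp only [evenPart]; ring
    rw [h3, abs_div, abs_two, div_le_iff₀ two_pos]
    linarith [abs_add_le (g x - g y) (g (hyperplaneReflection e x) - g (hyperplaneReflection e y))]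

/-- The action of a hyperplane reflection on the sphere. -/
noncomputable def sphereReflection (r : ℝ) (e : 𝔼) :
    Metric.sphere (0 : 𝔼) r ≃ᵢ Metric.sphere (0 : 𝔼) r where
  toFun z := ⟨hyperplaneReflection e z, by simp⟩
  invFun z := ⟨hyperplaneReflection e z, by simp⟩
  left_inv z := by simp
  right_inv z := by simp
  isometry_toFun := Isometry.of_dist_eq fun x y => by
    simp only [Subtype.dist_eq, LinearIsometryEquiv.dist_map]

lemma exists_sphereReflection_eq {x z : Metric.sphere (0 : 𝔼) r} (hxz : x ≠ z) :
    ∃ e : 𝔼, ‖e‖ = 1 ∧ sphereReflection r e x = z := by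
  have hne : (x : 𝔼) - z ≠ 0 := fun h => hxz (Subtype.ext (sub_eq_zero.1 h))
  have hn : ‖(x : 𝔼) - z‖ ≠ 0 := norm_ne_zero_iff.2 hne
  refine ⟨‖(x : 𝔼) - z‖⁻¹ • ((x : 𝔼) - z), ?_, Subtype.ext ?_⟩
  · rw [norm_smul, norm_inv, norm_norm, inv_mul_cancel₀ hn]
  · have h1 : ‖(x : 𝔼)‖ = ‖(z : 𝔼)‖ := by
      rw [norm_eq_of_mem_sphere, norm_eq_of_mem_sphere]
    have h2 := Submodule.reflection_sub h1
    change hyperplaneReflection _ (x : 𝔼) = z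
    have h3 : (ℝ ∙ (‖(x : 𝔼) - z‖⁻¹ • ((x : 𝔼) - z))) = ℝ ∙ ((x : 𝔼) - z) :=
      Submodule.span_singleton_smul_eq (IsUnit.mk0 _ (inv_ne_zero hn)) _
    rw [hyperplaneReflection]
    simp only [h3]
    exact h2

lemma integral_sphere_eq (hr : 0 < r) (g : 𝔼 → ℝ) :
    ∫ z : Metric.sphere (0 : 𝔼) r, g z ∂(μHE[N - 1]) =
      ∫ x, g x ∂(boundaryMeasure (Metric.ball (0 : 𝔼) r)) := by
  have h1 := (isometry_subtype_coe (s := Metric.sphere (0 : 𝔼) r)).map_euclideanHausdorffMeasure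
    (d := N - 1)
  rw [boundaryMeasure, frontier_ball _ hr.ne']
  rw [Subtype.range_coe] at h1
  rw [← h1, MeasurableEmbedding.integral_map
    (MeasurableEmbedding.subtype_coe Metric.isClosed_sphere.measurableSet)]

lemma isFiniteMeasure_hausdorff_sphere (hN : 1 ≤ N) (hr : 0 < r) :
    IsFiniteMeasure (μHE[N - 1] : Measure (Metric.sphere (0 : 𝔼) r)) := by
  refine ⟨?_⟩
  have h1 := isometry_subtype_coe (s := Metric.sphere (0 : 𝔼) r) |>.euclideanHausdorffMeasure_image
    (d := N - 1) Set.univ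
  rw [Set.image_univ, Subtype.range_coe] at h1
  rw [← h1, ← frontier_ball (0 : 𝔼) hr.ne']
  exact (hausdorff_frontier_ball_ne_top hN (0 : 𝔼) hr).lt_top

lemma mul_boundaryMeasure_ball_eq (hN : 1 ≤ N) (hr : 0 < r) (y : 𝔼) :
    r * (boundaryMeasure (Metric.ball y r)).real Set.univ = N * volume.real (Metric.ball y r) := by
  have hX : ContDiff ℝ 1 fun x : 𝔼 => x - y := contDiff_id.sub contDiff_const
  have h1 := integral_divergence_ball hN y hr hX
  simp_rw [divergence_sub_const] at h1
  have h2 : ∫ x, inner ℝ (x - y) (x - y) ∂(boundaryMeasure (Metric.ball y r)) =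
      ∫ x, r ^ 2 ∂(boundaryMeasure (Metric.ball y r)) := by
    refine setIntegral_congr_fun isClosed_frontier.measurableSet fun x hx => ?_
    rw [frontier_ball y hr.ne', mem_sphere_iff_norm] at hx
    rw [real_inner_self_eq_norm_sq, hx]
  rw [h2, setIntegral_const, integral_const, smul_eq_mul, smul_eq_mul] at h1
  have : r * (volume.real (Metric.ball y r) * N) =
    r * (r * (boundaryMeasure (Metric.ball y r)).real Set.univ) := by rw [h1]; ring
  rw [← mul_left_cancel₀ hr.ne' this]
  ring

/-- The reflections act transitively on the sphere, so that a nonempty open null set would make the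
whole sphere null. -/
lemma isOpenPosMeasure_hausdorff_sphere (hN : 1 ≤ N) (hr : 0 < r) :
    (μHE[N - 1] : Measure (Metric.sphere (0 : 𝔼) r)).IsOpenPosMeasure := by
  refine ⟨fun U hU ⟨u, hu⟩ h0 => ?_⟩
  have hnull : (μHE[N - 1] : Measure (Metric.sphere (0 : 𝔼) r)) Set.univ = 0 := by
    refine measure_null_of_locally_null _ fun x _ => ?_
    rcases eq_or_ne x u with rfl | hxu
    · exact ⟨U, by simpa using hU.mem_nhds hu, h0⟩
    · obtain ⟨e, -, he⟩ := exists_sphereReflection_eq hxu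
      refine ⟨sphereReflection r e ⁻¹' U, ?_, ?_⟩
      · rw [nhdsWithin_univ]
        exact (sphereReflection r e).continuous.continuousAt.preimage_mem_nhds
          (hU.mem_nhds (by rw [he]; exact hu))
      · rw [((sphereReflection r e).measurePreserving_euclideanHausdorffMeasure
          (N - 1)).measure_preimage hU.measurableSet.nullMeasurableSet, h0]
  have h1 := integral_sphere_eq hr fun _ : 𝔼 => (1 : ℝ)
  have h2 := mul_boundaryMeasure_ball_eq hN hr (0 : 𝔼)
  have hpos : 0 < volume.real (Metric.ball (0 : 𝔼) r) :=
    ENNReal.toReal_pos (Metric.measure_ball_pos _ _ hr).ne' measure_ball_lt_top.ne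
  rw [integral_const, integral_const, Measure.real, hnull] at h1
  simp only [ENNReal.toReal_zero, smul_eq_mul, mul_one] at h1
  rw [← h1] at h2
  have : (0 : ℝ) < N * volume.real (Metric.ball (0 : 𝔼) r) := by
    have : (0 : ℝ) < N := by exact_mod_cast hN
    positivity
  linarith

/-- Iterated symmetrizations of a function of mean zero tend to zero on the sphere. Their closure in
the space of continuous functions is compact, and a minimizer of the `L²` norm in it is invariant
under all reflections, hence constant. -/
lemma exists_iteratedSymmetrization_integral_sq_lt (hN : 1 ≤ N) (hr : 0 < r) {f : 𝔼 → ℝ}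
    (hf : ContDiff ℝ 1 f)
    (hmean : ∫ x, f x ∂(boundaryMeasure (Metric.ball (0 : 𝔼) r)) = 0) {δ : ℝ} (hδ : 0 < δ) :
    ∃ g, IsIteratedSymmetrization f g ∧
      ∫ x, g x ^ 2 ∂(boundaryMeasure (Metric.ball (0 : 𝔼) r)) < δ := by
  let S := Metric.sphere (0 : 𝔼) r
  let ν : Measure S := μHE[N - 1]
  have hνfin : IsFiniteMeasure ν := isFiniteMeasure_hausdorff_sphere hN hr
  have hνpos : ν.IsOpenPosMeasure := isOpenPosMeasure_hausdorff_sphere hN hr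
  have hcpt : CompactSpace S := isCompact_iff_compactSpace.1 (isCompact_sphere _ _)
  have hνmp : ∀ e : 𝔼, MeasurePreserving (sphereReflection r e) ν ν := fun e =>
    (sphereReflection r e).measurePreserving_euclideanHausdorffMeasure (N - 1)
  have hνint : ∀ (e : 𝔼) (g : S → ℝ), ∫ z, g (sphereReflection r e z) ∂ν = ∫ z, g z ∂ν :=
    fun e g => (hνmp e).integral_comp (sphereReflection r e).toHomeomorph.measurableEmbedding g
  have hint : ∀ u : S →ᵇ ℝ, Integrable u ν := fun u => u.integrable ν
  -- the iterated symmetrizations, as continuous functions on the sphere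
  let A : Set (S →ᵇ ℝ) := {u | ∃ g, IsIteratedSymmetrization f g ∧ ∀ z, u z = g z}
  obtain ⟨C, hC⟩ := (isCompact_sphere (0 : 𝔼) r).exists_bound_of_continuousOn
    hf.continuous.continuousOn
  obtain ⟨L, hL⟩ := exists_lipschitzOnWith_closedBall hf r
  have hL' : ∀ x ∈ Metric.sphere (0 : 𝔼) r, ∀ y ∈ Metric.sphere (0 : 𝔼) r,
      |f x - f y| ≤ L * dist x y := fun x hx y hy =>
    hL.dist_le_mul x (Metric.sphere_subset_closedBall hx) y (Metric.sphere_subset_closedBall hy)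
  have hAcpt : IsCompact (closure A) := by
    refine BoundedContinuousFunction.arzela_ascoli (Set.Icc (-C) C) isCompact_Icc A ?_ ?_
    · rintro u z ⟨g, hg, hug⟩
      rw [hug]
      exact abs_le.1 (hg.abs_le hC z z.2)
    · refine Metric.equicontinuous_of_continuity_modulus (fun t => L * t) ?_ _ ?_
      · have : Continuous fun t : ℝ => (L : ℝ) * t := by fun_prop
        simpa using this.tendsto 0
      · rintro x y ⟨u, g, hg, hug⟩
        simp only [Real.dist_eq]
        rw [hug, hug]
        exact hg.dist_le hL' x x.2 y y.2
  have hfA : BoundedContinuousFunction.mkOfCompact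
      ⟨fun z : S => f z, hf.continuous.comp continuous_subtype_val⟩ ∈ A :=
    ⟨f, .refl, fun z => rfl⟩
  -- the functional to be minimized
  let I : (S →ᵇ ℝ) → ℝ := fun u => ∫ z, u z ∂ν
  have hIcont : Continuous I := by
    refine LipschitzWith.continuous (K := (ν.real Set.univ).toNNReal)
      (LipschitzWith.of_dist_le_mul fun u v => ?_)
    rw [Real.dist_eq]
    simp only [I]
    rw [← integral_sub (hint u) (hint v), ← Real.norm_eq_abs,
      Real.coe_toNNReal _ measureReal_nonneg, mul_comm]
    refine norm_integral_le_of_norm_le_const (Eventually.of_forall fun z => ?_)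
    rw [← dist_eq_norm]
    exact BoundedContinuousFunction.dist_coe_le_dist z
  have hI2cont : Continuous fun u : S →ᵇ ℝ => I (u * u) :=
    hIcont.comp (continuous_id.mul continuous_id)
  -- a minimizer of the `L²` norm; symmetrization `P e` cannot decrease its norm
  obtain ⟨u, huA, humin⟩ := hAcpt.exists_isMinOn ⟨_, subset_closure hfA⟩ hI2cont.continuousOn
  let ρ : 𝔼 → C(S, S) := fun e => ⟨sphereReflection r e, (sphereReflection r e).continuous⟩
  let P : 𝔼 → (S →ᵇ ℝ) → (S →ᵇ ℝ) := fun e v => (2⁻¹ : ℝ) • (v + v.compContinuous (ρ e))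
  have hPcont : ∀ e, Continuous (P e) := by
    intro e
    have h1 := BoundedContinuousFunction.continuous_compContinuous (β := ℝ) (ρ e)
    have h2 : Continuous fun v : S →ᵇ ℝ => v + v.compContinuous (ρ e) := continuous_id.add h1
    exact h2.const_smul (2⁻¹ : ℝ)
  have hPA : ∀ e : 𝔼, ‖e‖ = 1 → P e u ∈ closure A := by
    intro e he
    refine map_mem_closure (hPcont e) huA ?_
    rintro v ⟨g, hg, hvg⟩
    refine ⟨evenPart e g, hg.step e he, fun z => ?_⟩
    have h1 : P e v z = 2⁻¹ * (v z + v (sphereReflection r e z)) := rfl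
    rw [h1, hvg, hvg, evenPart, div_eq_inv_mul]
    rfl
  have hinv : ∀ e : 𝔼, ‖e‖ = 1 → ∀ z, u (sphereReflection r e z) = u z := by
    intro e he
    have hmin : I (u * u) ≤ I (P e u * P e u) := humin (hPA e he)
    let v : S →ᵇ ℝ := u.compContinuous (ρ e)
    have hvv : I (v * v) = I (u * u) := hνint e fun z => u z * u z
    -- the parallelogram law
    have hpar : I (P e u * P e u) + 4⁻¹ * I ((u - v) * (u - v)) =
        2⁻¹ * (I (u * u) + I (v * v)) := by
      simp only [I]
      rw [← integral_add (hint _) (hint _), ← integral_const_mul, ← integral_const_mul,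
        ← integral_add (hint _) ((hint _).const_mul _)]
      refine integral_congr_ae (Eventually.of_forall fun z => ?_)
      simp only [P, v, BoundedContinuousFunction.coe_mul, BoundedContinuousFunction.coe_smul,
        BoundedContinuousFunction.coe_add, BoundedContinuousFunction.coe_sub, Pi.mul_apply,
        Pi.add_apply, Pi.sub_apply, smul_eq_mul]
      ring
    have hzero : I ((u - v) * (u - v)) = 0 := by
      have h0 : 0 ≤ I ((u - v) * (u - v)) := integral_nonneg fun z => mul_self_nonneg ((u - v) z)
      rw [hvv] at hpar
      linarith
    have hae := (integral_eq_zero_iff_of_nonneg (fun z => mul_self_nonneg ((u - v) z))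
      (hint ((u - v) * (u - v)))).1 hzero
    have heq := (Continuous.ae_eq_iff_eq ν ((u - v) * (u - v)).continuous continuous_zero).1 hae
    intro z
    have h1 : (u z - u (sphereReflection r e z)) * (u z - u (sphereReflection r e z)) = 0 :=
      congrFun heq z
    have := mul_self_eq_zero.1 h1
    linarith
  have hconst : ∀ x z, u x = u z := by
    intro x z
    rcases eq_or_ne x z with rfl | hxz
    · rfl
    · obtain ⟨e, he, rfl⟩ := exists_sphereReflection_eq hxz
      exact (hinv e he x).symm
  have hu0 : I u = 0 := by
    have hcl : IsClosed {v : S →ᵇ ℝ | I v = 0} := isClosed_eq hIcont continuous_const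
    refine (closure_minimal ?_ hcl) huA
    rintro v ⟨g, hg, hvg⟩
    have h1 : I v = ∫ z : S, g z ∂ν := integral_congr_ae (Eventually.of_forall hvg)
    rw [Set.mem_ofPred_eq, h1, integral_sphere_eq hr, hg.integral_eq hN hr hf, hmean]
  have hI0 : I (u * u) = 0 := by
    rcases isEmpty_or_nonempty S with hS | ⟨⟨x⟩⟩
    · simp only [I]
      rw [Measure.eq_zero_of_isEmpty ν, integral_zero_measure]
    · have h1 : I (u * u) = u x * I u := by
        simp only [I]
        rw [← integral_const_mul]
        refine integral_congr_ae (Eventually.of_forall fun z => ?_)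
        simp only [BoundedContinuousFunction.coe_mul, Pi.mul_apply]
        rw [hconst z x]
      rw [h1, hu0, mul_zero]
  have hopen : IsOpen {v : S →ᵇ ℝ | I (v * v) < δ} := isOpen_lt hI2cont continuous_const
  obtain ⟨v, hv, g, hg, hvg⟩ := mem_closure_iff.1 huA _ hopen (by
    rw [Set.mem_ofPred_eq, hI0]; exact hδ)
  refine ⟨g, hg, ?_⟩
  rw [← integral_sphere_eq hr fun x => g x ^ 2]
  refine lt_of_eq_of_lt (integral_congr_ae (Eventually.of_forall fun z => ?_)) hv
  simp only [BoundedContinuousFunction.coe_mul, Pi.mul_apply]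
  rw [hvg, sq]

/-- The sharp Steklov inequality on a ball: the deficit of `f` is at least that of its iterated
symmetrizations, whose boundary term is arbitrarily small. -/
lemma integral_sq_le_of_integral_eq_zero (hN : 1 ≤ N) (hr : 0 < r) {f : 𝔼 → ℝ}
    (hf : ContDiff ℝ 1 f)
    (hmean : ∫ x, f x ∂(boundaryMeasure (Metric.ball (0 : 𝔼) r)) = 0) :
    ∫ x, f x ^ 2 ∂(boundaryMeasure (Metric.ball (0 : 𝔼) r)) ≤
      r * ∫ x in Metric.ball (0 : 𝔼) r, ‖gradient f x‖ ^ 2 := by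
  refine le_of_forall_pos_le_add fun δ hδ => ?_
  obtain ⟨g, hg, hgδ⟩ := exists_iteratedSymmetrization_integral_sq_lt hN hr hf hmean hδ
  have h1 := hg.deficit_le hN hr hf
  have h2 : 0 ≤ r * ∫ x in Metric.ball (0 : 𝔼) r, ‖gradient g x‖ ^ 2 :=
    mul_nonneg hr.le (integral_nonneg fun x => by positivity)
  linarith

end Ball

/-! ### The sharp trace inequality on a ball -/

lemma measurePreserving_add_boundaryMeasure (y : 𝔼) {r : ℝ} (hr : 0 < r) :
    MeasurePreserving (fun x => x + y) (boundaryMeasure (Metric.ball (0 : 𝔼) r))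
      (boundaryMeasure (Metric.ball y r)) := by
  have h := ((IsometryEquiv.addRight y).measurePreserving_euclideanHausdorffMeasure
    (N - 1)).restrict_preimage
    (isClosed_frontier (s := Metric.ball y r)).measurableSet
  have h2 : IsometryEquiv.addRight y ⁻¹' frontier (Metric.ball y r) =
      frontier (Metric.ball 0 r) := by
    rw [frontier_ball _ hr.ne', frontier_ball _ hr.ne']
    ext x
    simp
  rw [h2] at h
  exact h

lemma integral_sub_mean_sq_le (hN : 1 ≤ N) (y : 𝔼) {r : ℝ} (hr : 0 < r) {f : 𝔼 → ℝ}
    (hf : ContDiff ℝ 1 f) {m : ℝ}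
    (hm : ∫ x, f x ∂(boundaryMeasure (Metric.ball y r)) =
      m * (boundaryMeasure (Metric.ball y r)).real Set.univ) :
    ∫ x, (f x - m) ^ 2 ∂(boundaryMeasure (Metric.ball y r)) ≤
      r * ∫ x in Metric.ball y r, ‖gradient f x‖ ^ 2 := by
  have hmp := measurePreserving_add_boundaryMeasure y hr
  have hemb : MeasurableEmbedding fun x : 𝔼 => x + y := measurableEmbedding_addRight y
  have hfin := isFiniteMeasure_boundaryMeasure_ball hN y hr
  have hg : ContDiff ℝ 1 fun x => f (x + y) - m :=
    (hf.comp (contDiff_id.add contDiff_const)).sub contDiff_const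
  have hmean : ∫ x, (f (x + y) - m) ∂(boundaryMeasure (Metric.ball (0 : 𝔼) r)) = 0 := by
    rw [hmp.integral_comp hemb fun x => f x - m, integral_sub
      (integrable_boundaryMeasure hf.continuous Metric.isBounded_ball
        (hausdorff_frontier_ball_ne_top hN y hr)) (integrable_const m), hm, integral_const,
      smul_eq_mul]
    ring
  have h := integral_sq_le_of_integral_eq_zero hN hr hg hmean
  rw [hmp.integral_comp hemb fun x => (f x - m) ^ 2] at h
  refine h.trans (le_of_eq ?_)
  congr 1
  have hgrad : ∀ x, gradient (fun x => f (x + y) - m) x = gradient f (x + y) := by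
    intro x
    rw [gradient, gradient, fderiv_sub_const, fderiv_comp_add_right]
  simp_rw [hgrad]
  have hmp2 : MeasurePreserving (fun x : 𝔼 => x + y) (volume.restrict (Metric.ball 0 r))
      (volume.restrict (Metric.ball y r)) := by
    have := (measurePreserving_add_right (volume : Measure 𝔼) y).restrict_preimage
      (Metric.isOpen_ball (x := y) (ε := r)).measurableSet
    have h2 : (fun x : 𝔼 => x + y) ⁻¹' Metric.ball y r = Metric.ball 0 r := by
      ext x; simp [dist_eq_norm]
    rwa [h2] at this
  exact hmp2.integral_comp hemb fun x => ‖gradient f x‖ ^ 2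

lemma lintegral_enorm_sq_eq {α F : Type*} [MeasurableSpace α] [NormedAddCommGroup F]
    (μ : Measure α) (f : α → F) : ∫⁻ x, ‖f x‖ₑ ^ 2 ∂μ = eLpNorm f 2 μ ^ 2 := by
  have h := eLpNorm_nnreal_pow_eq_lintegral (f := f) (μ := μ) (p := 2) two_ne_zero
  have h2 : ((2 : NNReal) : ℝ) = ((2 : ℕ) : ℝ) := by norm_num
  rw [h2] at h
  simp only [ENNReal.rpow_natCast] at h
  exact h.symm

lemma ofReal_integral_norm_sq_eq {α F : Type*} [MeasurableSpace α] [NormedAddCommGroup F]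
    {μ : Measure α} {f : α → F} (hf : Integrable (fun x => ‖f x‖ ^ 2) μ) :
    ENNReal.ofReal (∫ x, ‖f x‖ ^ 2 ∂μ) = eLpNorm f 2 μ ^ 2 := by
  rw [← lintegral_enorm_sq_eq, ofReal_integral_eq_lintegral_ofReal hf
    (Eventually.of_forall fun x => sq_nonneg _)]
  refine lintegral_congr fun x => ?_
  rw [← ofReal_norm, ← ENNReal.ofReal_pow (norm_nonneg _)]

lemma eLpNorm_sub_mean_le (hN : 1 ≤ N) (y : 𝔼) {r : ℝ} (hr : 0 < r) {f : 𝔼 → ℝ}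
    (hf : ContDiff ℝ 1 f) {m : ℝ}
    (hm : ∫ x, f x ∂(boundaryMeasure (Metric.ball y r)) =
      m * (boundaryMeasure (Metric.ball y r)).real Set.univ) :
    eLpNorm (fun x => f x - m) 2 (boundaryMeasure (Metric.ball y r)) ≤
      ENNReal.ofReal (√r) * eLpNorm (gradient f) 2 (volume.restrict (Metric.ball y r)) := by
  have h := integral_sub_mean_sq_le hN y hr hf hm
  have h1 : ENNReal.ofReal (∫ x, (f x - m) ^ 2 ∂(boundaryMeasure (Metric.ball y r))) =
      eLpNorm (fun x => f x - m) 2 (boundaryMeasure (Metric.ball y r)) ^ 2 := by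
    rw [← ofReal_integral_norm_sq_eq (integrable_boundaryMeasure
      (f := fun x => ‖f x - m‖ ^ 2) (by have := hf.continuous; fun_prop) Metric.isBounded_ball
      (hausdorff_frontier_ball_ne_top hN y hr))]
    simp_rw [Real.norm_eq_abs, sq_abs]
  have h2 : ENNReal.ofReal (∫ x in Metric.ball y r, ‖gradient f x‖ ^ 2) =
      eLpNorm (gradient f) 2 (volume.restrict (Metric.ball y r)) ^ 2 :=
    ofReal_integral_norm_sq_eq (integrableOn_of_continuous_of_isBounded
      (f := fun x => ‖gradient f x‖ ^ 2) (by have := continuous_gradient hf; fun_prop)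
      Metric.isBounded_ball)
  have h3 := ENNReal.ofReal_le_ofReal h
  rw [ENNReal.ofReal_mul hr.le, h1, h2] at h3
  have h4 : ENNReal.ofReal r = ENNReal.ofReal (√r) ^ 2 := by
    rw [← ENNReal.ofReal_pow (Real.sqrt_nonneg r), Real.sq_sqrt hr.le]
  rw [h4, ← mul_pow] at h3
  exact (ENNReal.pow_le_pow_left_iff two_ne_zero).1 h3

/-- The sharp trace inequality on a ball: it passes from smooth functions to `W^{1,2}`. -/
lemma eLpNorm_trace_le (hN : 1 ≤ N) (y : 𝔼) {r : ℝ} (hr : 0 < r) (v : W12 (Metric.ball y r))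
    (hv : ∫ x, v.trace x ∂(boundaryMeasure (Metric.ball y r)) = 0) :
    eLpNorm v.trace 2 (boundaryMeasure (Metric.ball y r)) ≤
      ENNReal.ofReal (√r) * eLpNorm v.grad 2 (volume.restrict (Metric.ball y r)) := by
  have hfin := isFiniteMeasure_boundaryMeasure_ball hN y hr
  have hH := hausdorff_frontier_ball_ne_top hN y hr
  set μ := boundaryMeasure (Metric.ball y r) with hμ
  set τ := volume.restrict (Metric.ball y r) with hτ
  obtain ⟨φ, hφ, -, hφ2, hφ3⟩ := v.isTrace
  have hφ1 : ∀ n, ContDiff ℝ 1 (φ n) := fun n => (hφ n).of_le (by norm_cast)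
  have hφi : ∀ n, Integrable (φ n) μ := fun n =>
    integrable_boundaryMeasure (hφ1 n).continuous Metric.isBounded_ball hH
  have hM : μ.real Set.univ ≠ 0 := by
    have h2 := mul_boundaryMeasure_ball_eq hN hr y
    have hpos : 0 < volume.real (Metric.ball y r) :=
      ENNReal.toReal_pos (Metric.measure_ball_pos _ _ hr).ne' measure_ball_lt_top.ne
    have hN' : (0 : ℝ) < N := by exact_mod_cast hN
    intro h0
    rw [← hμ, h0, mul_zero] at h2
    exact (mul_pos hN' hpos).ne h2
  -- the means of the approximating functions, which tend to the mean of the trace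
  let m : ℕ → ℝ := fun n => (∫ x, φ n x ∂μ) / μ.real Set.univ
  have hm : Tendsto m atTop (𝓝 0) := by
    have h1 : Tendsto (fun n => eLpNorm (φ n - v.trace) 1 μ) atTop (𝓝 0) := by
      have h2 : ∀ n, eLpNorm (φ n - v.trace) 1 μ ≤
          eLpNorm (fun x => φ n x - v.trace x) 2 μ *
            μ Set.univ ^ (1 / (1 : ℝ≥0∞).toReal - 1 / (2 : ℝ≥0∞).toReal) :=
        fun n => eLpNorm_le_eLpNorm_mul_rpow_measure_univ one_le_two
          ((hφi n).1.sub v.memLp_trace.1)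
      refine tendsto_of_tendsto_of_tendsto_of_le_of_le tendsto_const_nhds ?_ (fun n => zero_le) h2
      have h3 := ENNReal.Tendsto.mul_const
        (b := μ Set.univ ^ (1 / (1 : ℝ≥0∞).toReal - 1 / (2 : ℝ≥0∞).toReal))
        hφ3 (Or.inr (ENNReal.rpow_ne_top_of_nonneg (by norm_num) (measure_ne_top _ _)))
      rwa [zero_mul] at h3
    have h4 := tendsto_integral_of_L1' v.trace v.memLp_trace.1
      (Eventually.of_forall hφi) h1
    rw [hv] at h4
    have h5 := h4.div_const (μ.real Set.univ)
    rwa [zero_div] at h5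
  have hmm : Tendsto (fun n => eLpNorm (fun _ : 𝔼 => m n) 2 μ) atTop (𝓝 0) := by
    have h1 : ∀ n, eLpNorm (fun _ : 𝔼 => m n) 2 μ = ‖m n‖ₑ * μ Set.univ ^ (1 / (2 : ℝ≥0∞).toReal) :=
      fun n => eLpNorm_const' _ two_ne_zero ENNReal.ofNat_ne_top
    simp_rw [h1]
    have h2 : Tendsto (fun n => ‖m n‖ₑ) atTop (𝓝 0) := by
      have := (continuous_enorm.tendsto (0 : ℝ)).comp hm
      rwa [enorm_zero] at this
    have h3 := ENNReal.Tendsto.mul_const (b := μ Set.univ ^ (1 / (2 : ℝ≥0∞).toReal))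
        h2 (Or.inr (ENNReal.rpow_ne_top_of_nonneg (by norm_num) (measure_ne_top _ _)))
    rwa [zero_mul] at h3
  have hbound : ∀ n, eLpNorm v.trace 2 μ ≤ eLpNorm (fun x => φ n x - v.trace x) 2 μ +
      (ENNReal.ofReal (√r) * (eLpNorm (fun x => gradient (φ n) x - v.grad x) 2 τ +
        eLpNorm v.grad 2 τ) + eLpNorm (fun _ : 𝔼 => m n) 2 μ) := by
    intro n
    have hms : AEStronglyMeasurable (fun x => φ n x - v.trace x) μ := (hφi n).1.sub v.memLp_trace.1
    have hms2 : AEStronglyMeasurable (fun x => φ n x - m n) μ :=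
      (hφi n).1.sub aestronglyMeasurable_const
    have h1 : v.trace = fun x => -(φ n x - v.trace x) + ((φ n x - m n) + m n) := by
      ext x; ring
    have h2 : eLpNorm (fun x => -(φ n x - v.trace x)) 2 μ =
        eLpNorm (fun x => φ n x - v.trace x) 2 μ := eLpNorm_neg (fun x => φ n x - v.trace x) 2 μ
    calc eLpNorm v.trace 2 μ =
          eLpNorm (fun x => -(φ n x - v.trace x) + ((φ n x - m n) + m n)) 2 μ := by rw [← h1]
      _ ≤ eLpNorm (fun x => -(φ n x - v.trace x)) 2 μ +
          eLpNorm (fun x => (φ n x - m n) + m n) 2 μ :=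
        eLpNorm_add_le hms.neg (hms2.add aestronglyMeasurable_const) one_le_two
      _ ≤ eLpNorm (fun x => -(φ n x - v.trace x)) 2 μ +
          (eLpNorm (fun x => φ n x - m n) 2 μ + eLpNorm (fun _ : 𝔼 => m n) 2 μ) := by
        gcongr
        exact eLpNorm_add_le hms2 aestronglyMeasurable_const one_le_two
      _ ≤ _ := by
        rw [h2]
        gcongr
        refine (eLpNorm_sub_mean_le hN y hr (hφ1 n) (m := m n) ?_).trans ?_
        · rw [← hμ]; simp only [m]; rw [div_mul_cancel₀ _ hM]
        · gcongr
          have h3 : gradient (φ n) = fun x => (gradient (φ n) x - v.grad x) + v.grad x := by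
            ext x; simp
          have h4 : AEStronglyMeasurable (fun x => gradient (φ n) x - v.grad x) τ :=
            (continuous_gradient (hφ1 n)).aestronglyMeasurable.sub v.memLp_grad.1
          calc eLpNorm (gradient (φ n)) 2 τ =
              eLpNorm (fun x => (gradient (φ n) x - v.grad x) + v.grad x) 2 τ := by rw [← h3]
            _ ≤ _ := eLpNorm_add_le h4 v.memLp_grad.1 one_le_two
  have hlim := hφ3.add ((ENNReal.Tendsto.const_mul (a := ENNReal.ofReal (√r))
    (hφ2.add_const (eLpNorm v.grad 2 τ)) (Or.inr ENNReal.ofReal_ne_top)).add hmm)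
  rw [zero_add, zero_add, add_zero] at hlim
  exact ge_of_tendsto hlim (Eventually.of_forall hbound)

lemma inv_le_rayleigh_ball (hN : 1 ≤ N) (y : 𝔼) {r : ℝ} (hr : 0 < r) (v : W12 (Metric.ball y r))
    (hv0 : v.TraceNeZero)
    (hv : ∫ x, v.trace x ∂(boundaryMeasure (Metric.ball y r)) = 0) :
    (ENNReal.ofReal r)⁻¹ ≤ v.rayleigh := by
  have h := eLpNorm_trace_le hN y hr v hv
  unfold W12.rayleigh
  unfold W12.TraceNeZero at hv0
  rw [lintegral_enorm_sq_eq] at *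
  rw [lintegral_enorm_sq_eq]
  have hT : eLpNorm v.trace 2 (boundaryMeasure (Metric.ball y r)) ^ 2 ≠ ⊤ :=
    ENNReal.pow_ne_top v.memLp_trace.2.ne
  have h2 := pow_le_pow_left' h 2
  have h4 : ENNReal.ofReal r = ENNReal.ofReal (√r) ^ 2 := by
    rw [← ENNReal.ofReal_pow (Real.sqrt_nonneg r), Real.sq_sqrt hr.le]
  rw [mul_pow, ← h4] at h2
  rw [ENNReal.le_div_iff_mul_le (Or.inl hv0) (Or.inl hT), mul_comm, ← div_eq_mul_inv]
  refine ENNReal.div_le_of_le_mul ?_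
  rw [mul_comm]
  exact h2

/-! ### Affine functions and the Steklov eigenvalues of a ball -/

lemma contDiff_affine (a : ℝ) (v c : 𝔼) {n : WithTop ℕ∞} :
    ContDiff ℝ n fun x : 𝔼 => a + inner ℝ v (x - c) :=
  contDiff_const.add (contDiff_const.inner ℝ (contDiff_id.sub contDiff_const))

lemma gradient_affine (a : ℝ) (v c x : 𝔼) :
    gradient (fun x : 𝔼 => a + inner ℝ v (x - c)) x = v := by
  refine HasGradientAt.gradient ?_
  rw [hasGradientAt_iff_hasFDerivAt]
  have h1 : HasFDerivAt (fun x : 𝔼 => x - c) (ContinuousLinearMap.id ℝ 𝔼) x :=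
    (hasFDerivAt_id x).sub_const c
  have h2 := ((innerSL ℝ v).hasFDerivAt.comp x h1).const_add a
  exact h2

/-- For an arbitrary bounded open set with boundary of finite surface measure: the boundary term in
the directional estimate vanishes. -/
lemma isWeakGradient_gradient {Ω : Set 𝔼} (hΩ : IsOpen Ω) (hΩb : Bornology.IsBounded Ω)
    (hH : μHE[N - 1] (frontier Ω) ≠ ⊤) {u : 𝔼 → ℝ} (hu : ContDiff ℝ 1 u) :
    IsWeakGradient Ω u (gradient u) := by
  intro φ hφ hφc hφΩ
  have hφ1 : ContDiff ℝ 1 φ := hφ.of_le (by norm_cast)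
  have hi1 : IntegrableOn (fun x => u x • gradient φ x) Ω :=
    integrableOn_of_continuous_of_isBounded (hu.continuous.smul (continuous_gradient hφ1)) hΩb
  have hi2 : IntegrableOn (fun x => φ x • gradient u x) Ω :=
    integrableOn_of_continuous_of_isBounded (hφ1.continuous.smul (continuous_gradient hu)) hΩb
  have hi3 : IntegrableOn (fun x => u x • gradient φ x + φ x • gradient u x) Ω := hi1.add hi2
  rw [eq_neg_iff_add_eq_zero, ← integral_add hi1 hi2]
  refine ext_inner_right ℝ fun w => ?_
  rw [inner_zero_left, real_inner_comm, ← integral_inner hi3]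
  have h1 : ∀ x, inner ℝ w (u x • gradient φ x + φ x • gradient u x) =
      fderiv ℝ (fun x => u x * φ x) x w := by
    intro x
    rw [fderiv_fun_mul (hu.differentiable one_ne_zero x) (hφ1.differentiable one_ne_zero x),
      inner_add_right, real_inner_smul_right, real_inner_smul_right, real_inner_comm,
      inner_gradient_left, real_inner_comm, inner_gradient_left]
    rfl
  simp_rw [h1]
  -- the product vanishes on the boundary
  have h2 := abs_integral_fderiv_le hΩ hΩb hH w (hu.mul hφ1)
  have h3 : ∫ x, |u x * φ x| ∂(boundaryMeasure Ω) = 0 := by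
    refine setIntegral_eq_zero_of_forall_eq_zero fun x hx => ?_
    have : φ x = 0 := by
      refine image_eq_zero_of_notMem_tsupport fun h => ?_
      rw [hΩ.frontier_eq] at hx
      exact hx.2 (hφΩ h)
    simp [this]
  rw [h3, mul_zero] at h2
  exact abs_nonpos_iff.1 h2

lemma memLp_of_continuous_of_isBounded {F : Type*} [NormedAddCommGroup F] {f : 𝔼 → F}
    (hf : Continuous f) {Ω : Set 𝔼} (hΩ : IsOpen Ω) (hΩb : Bornology.IsBounded Ω) :
    MemLp f 2 (volume.restrict Ω) := by
  have : IsFiniteMeasure (volume.restrict Ω) := ⟨by simpa using hΩb.measure_lt_top⟩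
  obtain ⟨C, hC⟩ := hΩb.isCompact_closure.exists_bound_of_continuousOn hf.continuousOn
  exact MemLp.of_bound hf.aestronglyMeasurable C
    ((ae_restrict_mem hΩ.measurableSet).mono fun x hx => hC x (subset_closure hx))

lemma memLp_boundaryMeasure {F : Type*} [NormedAddCommGroup F] {f : 𝔼 → F}
    (hf : Continuous f) {Ω : Set 𝔼} (hΩb : Bornology.IsBounded Ω)
    (hH : μHE[N - 1] (frontier Ω) ≠ ⊤) : MemLp f 2 (boundaryMeasure Ω) := by
  have : IsFiniteMeasure (boundaryMeasure Ω) := ⟨by simpa [boundaryMeasure] using hH.lt_top⟩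
  have hK : IsCompact (frontier Ω) :=
    Metric.isCompact_of_isClosed_isBounded isClosed_frontier
      (hΩb.closure.subset frontier_subset_closure)
  obtain ⟨C, hC⟩ := hK.exists_bound_of_continuousOn hf.continuousOn
  exact MemLp.of_bound hf.aestronglyMeasurable C
    ((ae_restrict_mem isClosed_frontier.measurableSet).mono hC)

/-- The affine function `a + ⟪v, x - c⟫` as an element of `W^{1,2}(Ω)`. -/
noncomputable def affineW12 {Ω : Set 𝔼} (hΩ : IsOpen Ω) (hΩb : Bornology.IsBounded Ω)
    (hH : μHE[N - 1] (frontier Ω) ≠ ⊤) (a : ℝ) (v c : 𝔼) : W12 Ω where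
  fn x := a + inner ℝ v (x - c)
  grad _ := v
  trace x := a + inner ℝ v (x - c)
  memLp_fn := memLp_of_continuous_of_isBounded (contDiff_affine a v c (n := 0)).continuous hΩ hΩb
  memLp_grad := memLp_of_continuous_of_isBounded continuous_const hΩ hΩb
  isWeakGradient := by
    have h := isWeakGradient_gradient hΩ hΩb hH (contDiff_affine a v c)
    rwa [show gradient (fun x : 𝔼 => a + inner ℝ v (x - c)) = fun _ => v from
      funext (gradient_affine a v c)] at h
  memLp_trace := memLp_boundaryMeasure (contDiff_affine a v c (n := 0)).continuous hΩb hH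
  isTrace := by
    refine ⟨fun _ x => a + inner ℝ v (x - c), fun _ => contDiff_affine a v c, ?_, ?_, ?_⟩
    · simp
    · simp [gradient_affine]
    · simp

lemma rayleigh_affineW12 {Ω : Set 𝔼} (hΩ : IsOpen Ω) (hΩb : Bornology.IsBounded Ω)
    (hH : μHE[N - 1] (frontier Ω) ≠ ⊤) (a : ℝ) (v c : 𝔼) :
    (affineW12 hΩ hΩb hH a v c).rayleigh = ENNReal.ofReal (‖v‖ ^ 2 * volume.real Ω) /
      ENNReal.ofReal (∫ x, (a + inner ℝ v (x - c)) ^ 2 ∂(boundaryMeasure Ω)) := by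
  have h1 : Integrable (fun x => ‖a + inner ℝ v (x - c)‖ ^ 2) (boundaryMeasure Ω) :=
    integrable_boundaryMeasure (by fun_prop) hΩb hH
  have h2 := ofReal_integral_norm_sq_eq h1
  simp_rw [Real.norm_eq_abs, sq_abs] at h2
  unfold W12.rayleigh
  rw [h2, ← lintegral_enorm_sq_eq]
  congr 1
  simp only [affineW12, lintegral_const, Measure.restrict_apply MeasurableSet.univ, Set.univ_inter]
  rw [ENNReal.ofReal_mul (by positivity), ENNReal.ofReal_pow (norm_nonneg _), ofReal_norm,
    Measure.real, ENNReal.ofReal_toReal hΩb.measure_lt_top.ne]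

lemma traceNeZero_affineW12 {Ω : Set 𝔼} (hΩ : IsOpen Ω) (hΩb : Bornology.IsBounded Ω)
    (hH : μHE[N - 1] (frontier Ω) ≠ ⊤) {a : ℝ} {v c : 𝔼}
    (h : 0 < ∫ x, (a + inner ℝ v (x - c)) ^ 2 ∂(boundaryMeasure Ω)) :
    (affineW12 hΩ hΩb hH a v c).TraceNeZero := by
  have h1 : Integrable (fun x => ‖a + inner ℝ v (x - c)‖ ^ 2) (boundaryMeasure Ω) :=
    integrable_boundaryMeasure (by fun_prop) hΩb hH
  have h2 := ofReal_integral_norm_sq_eq h1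
  simp_rw [Real.norm_eq_abs, sq_abs] at h2
  unfold W12.TraceNeZero
  change ∫⁻ x, ‖a + inner ℝ v (x - c)‖ₑ ^ 2 ∂(boundaryMeasure Ω) ≠ 0
  rw [lintegral_enorm_sq_eq, ← h2]
  simpa using h

lemma integral_inner_sub_mul_ball (hN : 1 ≤ N) (y : 𝔼) {r : ℝ} (hr : 0 < r) (a : ℝ) (v w : 𝔼) :
    ∫ x, (a + inner ℝ v (x - y)) * inner ℝ w (x - y) ∂(boundaryMeasure (Metric.ball y r)) =
      r * (volume.real (Metric.ball y r) * inner ℝ v w) := by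
  have h := mul_integral_fderiv_ball hN y hr (contDiff_affine a v y) w
  have h1 : ∀ x, fderiv ℝ (fun x : 𝔼 => a + inner ℝ v (x - y)) x w = inner ℝ v w := by
    intro x
    rw [← inner_gradient_left, gradient_affine]
  simp_rw [h1] at h
  rw [setIntegral_const, smul_eq_mul] at h
  rw [h]
  refine integral_congr_ae (Eventually.of_forall fun x => ?_)
  simp only [real_inner_comm]

/-- On a ball the constant function and the coordinates are the first eigenfunctions, with
eigenvalues `0` and `1 / r`. -/
lemma inv_le_eigenvalue_ball (hN : 1 ≤ N) (y : 𝔼) {r : ℝ} (hr : 0 < r) {k : ℕ} (hk : 2 ≤ k)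
    (hkN : k ≤ N + 1) : (ENNReal.ofReal r)⁻¹ ≤ eigenvalue (Metric.ball y r) k := by
  have hH := hausdorff_frontier_ball_ne_top hN y hr
  have hb : Bornology.IsBounded (Metric.ball y r) := Metric.isBounded_ball
  have hfin := isFiniteMeasure_boundaryMeasure_ball hN y hr
  have hpos : 0 < volume.real (Metric.ball y r) :=
    ENNReal.toReal_pos (Metric.measure_ball_pos _ _ hr).ne' measure_ball_lt_top.ne
  have hM : 0 < (boundaryMeasure (Metric.ball y r)).real Set.univ := by
    have h2 := mul_boundaryMeasure_ball_eq hN hr y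
    have hN' : (0 : ℝ) < N := by exact_mod_cast hN
    have := mul_pos hN' hpos
    rw [← h2] at this
    exact pos_of_mul_pos_right this hr.le
  let one : W12 (Metric.ball y r) := affineW12 Metric.isOpen_ball hb hH 1 0 y
  let coord : Fin N → W12 (Metric.ball y r) := fun i =>
    affineW12 Metric.isOpen_ball hb hH 0 (EuclideanSpace.single i 1) y
  let S : Fin (k - 1) → W12 (Metric.ball y r) := fun j =>
    if h : (j : ℕ) = 0 then one else coord ⟨j - 1, by have := j.2; omega⟩
  have hS0 : ∀ j : Fin (k - 1), (j : ℕ) = 0 → S j = one := fun j h => dif_pos h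
  have hS1 : ∀ j : Fin (k - 1), (h : (j : ℕ) ≠ 0) →
      S j = coord ⟨j - 1, by have := j.2; omega⟩ := fun j h => dif_neg h
  have hone : ∀ v : W12 (Metric.ball y r), v.BdryOrthogonal one →
      ∫ x, v.trace x ∂(boundaryMeasure (Metric.ball y r)) = 0 := by
    intro v hv
    have h1 : ∀ x, one.trace x = 1 := fun x => by simp [one, affineW12]
    simpa [W12.BdryOrthogonal, h1] using hv
  let z : Fin (k - 1) := ⟨0, by omega⟩
  have hS : IsFirstEigenfunctions (Metric.ball y r) S := by
    intro j
    by_cases hj : (j : ℕ) = 0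
    · rw [hS0 j hj]
      refine ⟨?_, ?_, ?_⟩
      · refine traceNeZero_affineW12 _ _ _ ?_
        simpa using hM
      · intro i hij
        have : (i : ℕ) < j := hij
        omega
      · intro v _ _
        simp [one, rayleigh_affineW12]
    · rw [hS1 j hj]
      have hcc : ∫ x, (0 + inner ℝ
          (EuclideanSpace.single (⟨j - 1, by have := j.2; omega⟩ : Fin N) (1 : ℝ)) (x - y)) ^ 2
            ∂(boundaryMeasure (Metric.ball y r)) = r * volume.real (Metric.ball y r) := by
        have := integral_inner_sub_mul_ball hN y hr 0
          (EuclideanSpace.single (⟨j - 1, by have := j.2; omega⟩ : Fin N) (1 : ℝ))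
          (EuclideanSpace.single (⟨j - 1, by have := j.2; omega⟩ : Fin N) (1 : ℝ))
        rw [real_inner_self_eq_norm_sq, PiLp.norm_single, norm_one, one_pow, mul_one] at this
        rw [← this]
        refine integral_congr_ae (Eventually.of_forall fun x => ?_)
        simp only [zero_add, sq]
      refine ⟨?_, ?_, ?_⟩
      · refine traceNeZero_affineW12 _ _ _ ?_
        rw [hcc]
        positivity
      · intro i hij
        have hij' : (i : ℕ) < j := hij
        by_cases hi : (i : ℕ) = 0
        · rw [hS0 i hi]
          have := integral_inner_sub_mul_ball hN y hr 1 0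
            (EuclideanSpace.single (⟨j - 1, by have := j.2; omega⟩ : Fin N) (1 : ℝ))
          rw [inner_zero_left, mul_zero, mul_zero] at this
          rw [W12.BdryOrthogonal, ← this]
          refine integral_congr_ae (Eventually.of_forall fun x => ?_)
          simp [one, coord, affineW12]
        · rw [hS1 i hi]
          have := integral_inner_sub_mul_ball hN y hr 0
            (EuclideanSpace.single (⟨j - 1, by have := j.2; omega⟩ : Fin N) (1 : ℝ))
            (EuclideanSpace.single (⟨i - 1, by have := i.2; omega⟩ : Fin N) (1 : ℝ))
          have h0 : inner ℝ (EuclideanSpace.single (⟨j - 1, by have := j.2; omega⟩ : Fin N) (1 : ℝ))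
            (EuclideanSpace.single (⟨i - 1, by have := i.2; omega⟩ : Fin N) (1 : ℝ)) = 0 := by
            rw [EuclideanSpace.inner_single_left]
            have : j.1 - 1 ≠ i.1 - 1 := by omega
            simp [this]
          rw [h0, mul_zero, mul_zero] at this
          rw [W12.BdryOrthogonal, ← this]
          refine integral_congr_ae (Eventually.of_forall fun x => ?_)
          simp [coord, affineW12]
      · intro v hv0 hv
        have h1 := inv_le_rayleigh_ball hN y hr v hv0 (hone v (by
          have := hv z (Fin.lt_def.2 (Nat.pos_of_ne_zero hj))
          rwa [hS0 z rfl] at this))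
        refine le_trans (le_of_eq ?_) h1
        simp only [coord]
        rw [rayleigh_affineW12, hcc, PiLp.norm_single, norm_one, one_pow, one_mul,
          ← ENNReal.ofReal_div_of_pos (by positivity), ← ENNReal.ofReal_inv_of_pos hr]
        congr 1
        field_simp
  refine le_iSup₂_of_le S hS ?_
  refine le_iInf fun u => le_iInf fun hu0 => le_iInf fun hu => ?_
  refine inv_le_rayleigh_ball hN y hr u hu0 (hone u ?_)
  have := hu z
  rwa [hS0 z rfl] at this

/-! ### Affine test functions on a domain -/

lemma integral_sq_affine {Ω : Set 𝔼} (hΩb : Bornology.IsBounded Ω)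
    (hH : μHE[N - 1] (frontier Ω) ≠ ⊤) {c : 𝔼} (hc : ∫ x, (x - c) ∂(boundaryMeasure Ω) = 0)
    (a : ℝ) (v : 𝔼) :
    ∫ x, (a + inner ℝ v (x - c)) ^ 2 ∂(boundaryMeasure Ω) =
      a ^ 2 * (boundaryMeasure Ω).real Set.univ +
        ∫ x, inner ℝ v (x - c) ^ 2 ∂(boundaryMeasure Ω) := by
  have hfin : IsFiniteMeasure (boundaryMeasure Ω) := ⟨by simpa [boundaryMeasure] using hH.lt_top⟩
  have h1 : Integrable (fun x : 𝔼 => 2 * a * inner ℝ v (x - c)) (boundaryMeasure Ω) :=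
    integrable_boundaryMeasure (by fun_prop) hΩb hH
  have h2 : Integrable (fun x : 𝔼 => inner ℝ v (x - c) ^ 2) (boundaryMeasure Ω) :=
    integrable_boundaryMeasure (by fun_prop) hΩb hH
  have h3 : Integrable (fun x : 𝔼 => a ^ 2 + 2 * a * inner ℝ v (x - c)) (boundaryMeasure Ω) :=
    (integrable_const _).add h1
  have h4 : Integrable (fun x : 𝔼 => x - c) (boundaryMeasure Ω) :=
    integrable_boundaryMeasure (by fun_prop) hΩb hH
  simp_rw [add_sq]
  rw [integral_add h3 h2, integral_add (integrable_const _) h1, integral_const_mul, integral_const,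
    integral_inner h4, hc, inner_zero_right, smul_eq_mul]
  ring

/-- An upper bound for the Steklov eigenvalues by the Rayleigh quotient on a space of affine
functions: by a dimension count it contains a nonzero function orthogonal to any `m` given ones, so
that the choice of the first eigenfunctions does not matter. -/
lemma eigenvalue_le_of_orthonormal {Ω : Set 𝔼} (hΩ : IsOpen Ω) (hΩb : Bornology.IsBounded Ω)
    (hH : μHE[N - 1] (frontier Ω) ≠ ⊤) {c : 𝔼} (hc : ∫ x, (x - c) ∂(boundaryMeasure Ω) = 0)
    (hM : 0 < (boundaryMeasure Ω).real Set.univ) {m : ℕ} {b : Fin m → 𝔼} (hb : Orthonormal ℝ b)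
    {κ : ℝ} (hκ : 0 < κ) (hB : ∀ a : Fin m → ℝ,
      κ * ∑ i, a i ^ 2 ≤ ∫ x, inner ℝ (∑ i, a i • b i) (x - c) ^ 2 ∂(boundaryMeasure Ω)) :
    eigenvalue Ω (m + 1) ≤ ENNReal.ofReal (volume.real Ω / κ) := by
  refine iSup₂_le fun S _ => ?_
  -- a vector in the kernel of `M` gives an affine function orthogonal to all the `S j`
  let M : Matrix (Fin m) (Fin (m + 1)) ℝ := Matrix.of fun j =>
    Fin.cons (∫ x, (S j).trace x ∂(boundaryMeasure Ω))
      fun i => ∫ x, inner ℝ (b i) (x - c) * (S j).trace x ∂(boundaryMeasure Ω)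
  obtain ⟨a, haM, ha0⟩ : ∃ a : Fin (m + 1) → ℝ, M.mulVec a = 0 ∧ a ≠ 0 := by
    have h1 : LinearMap.ker M.mulVecLin ≠ ⊥ := by
      refine LinearMap.ker_ne_bot_of_finrank_lt ?_
      simp
    obtain ⟨a, ha, ha0⟩ := Submodule.exists_mem_ne_zero_of_ne_bot h1
    exact ⟨a, ha, ha0⟩
  set v : 𝔼 := ∑ i : Fin m, a i.succ • b i with hv
  have hnv : ‖v‖ ^ 2 = ∑ i : Fin m, a i.succ ^ 2 := by
    rw [← real_inner_self_eq_norm_sq, hv, hb.inner_sum]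
    simp [sq]
  have hsq := integral_sq_affine hΩb hH hc (a 0) v
  have hlow := hB fun i => a i.succ
  rw [← hnv, ← hv] at hlow
  have hpos : 0 < ∫ x, (a 0 + inner ℝ v (x - c)) ^ 2 ∂(boundaryMeasure Ω) := by
    rw [hsq]
    by_cases h0 : a 0 = 0
    · have h1 : 0 < ‖v‖ ^ 2 := by
        rw [hnv]
        obtain ⟨i, hi⟩ := Function.ne_iff.1 ha0
        have hi0 : i ≠ 0 := by rintro rfl; exact hi h0
        obtain ⟨j, rfl⟩ := Fin.exists_succ_eq.2 hi0
        refine Finset.sum_pos' (fun i _ => sq_nonneg _) ⟨j, Finset.mem_univ _, ?_⟩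
        have : a j.succ ≠ 0 := hi
        positivity
      have := mul_pos hκ h1
      rw [h0]
      linarith
    · have h1 : 0 < a 0 ^ 2 * (boundaryMeasure Ω).real Set.univ := by positivity
      have h2 : 0 ≤ κ * ‖v‖ ^ 2 := by positivity
      linarith
  let w : W12 Ω := affineW12 hΩ hΩb hH (a 0) v c
  refine iInf₂_le_of_le w (traceNeZero_affineW12 hΩ hΩb hH hpos) (iInf_le_of_le (fun j => ?_) ?_)
  · have h1 := congrFun haM j
    have hT : MemLp (S j).trace 2 (boundaryMeasure Ω) := (S j).memLp_trace
    have hfin : IsFiniteMeasure (boundaryMeasure Ω) := ⟨by simpa [boundaryMeasure] using hH.lt_top⟩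
    have hT1 : Integrable (S j).trace (boundaryMeasure Ω) := hT.integrable one_le_two
    have hTi : ∀ i, Integrable (fun x => inner ℝ (b i) (x - c) * (S j).trace x)
        (boundaryMeasure Ω) := fun i =>
      MemLp.integrable_mul (memLp_boundaryMeasure (f := fun x : 𝔼 => inner ℝ (b i) (x - c))
        (by fun_prop) hΩb hH) hT
    have h2 : ∀ x, w.trace x * (S j).trace x = a 0 * (S j).trace x +
        ∑ i : Fin m, a i.succ * (inner ℝ (b i) (x - c) * (S j).trace x) := by
      intro x
      simp only [w, affineW12, hv, sum_inner, real_inner_smul_left, add_mul, Finset.sum_mul,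
        mul_assoc]
    unfold W12.BdryOrthogonal
    simp_rw [h2]
    rw [integral_add (hT1.const_mul _) (integrable_finsetSum _ fun i _ => (hTi i).const_mul _),
      integral_finsetSum _ fun i _ => (hTi i).const_mul _]
    simp_rw [integral_const_mul]
    rw [Matrix.mulVec, dotProduct, Fin.sum_univ_succ] at h1
    simp only [M, Matrix.of_apply, Fin.cons_zero, Fin.cons_succ, Pi.zero_apply] at h1
    rw [← h1, mul_comm (a 0)]
    congr 1
    exact Finset.sum_congr rfl fun i _ => mul_comm _ _
  · rw [rayleigh_affineW12, ← ENNReal.ofReal_div_of_pos hpos]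
    refine ENNReal.ofReal_le_ofReal ?_
    rw [div_le_div_iff₀ hpos hκ]
    have h1 : κ * ‖v‖ ^ 2 ≤ ∫ x, (a 0 + inner ℝ v (x - c)) ^ 2 ∂(boundaryMeasure Ω) := by
      have : 0 ≤ a 0 ^ 2 * (boundaryMeasure Ω).real Set.univ := by positivity
      rw [hsq]
      linarith
    have h2 := mul_le_mul_of_nonneg_left h1 (measureReal_nonneg (μ := volume) (s := Ω))
    linarith

/-- The second moments of the boundary about `c`, as a symmetric operator. -/
noncomputable def momentOperator {Ω : Set 𝔼} (hΩb : Bornology.IsBounded Ω)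
    (hH : μHE[N - 1] (frontier Ω) ≠ ⊤) (c : 𝔼) : 𝔼 →ₗ[ℝ] 𝔼 where
  toFun e := ∫ x, (inner ℝ e (x - c) : ℝ) • (x - c) ∂(boundaryMeasure Ω)
  map_add' e e' := by
    simp_rw [inner_add_left, add_smul]
    exact integral_add (integrable_boundaryMeasure (by fun_prop) hΩb hH)
      (integrable_boundaryMeasure (by fun_prop) hΩb hH)
  map_smul' t e := by
    simp_rw [real_inner_smul_left, mul_smul]
    exact integral_smul t _

lemma inner_momentOperator {Ω : Set 𝔼} (hΩb : Bornology.IsBounded Ω)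
    (hH : μHE[N - 1] (frontier Ω) ≠ ⊤) (c e w : 𝔼) :
    inner ℝ (momentOperator hΩb hH c e) w =
      ∫ x, inner ℝ e (x - c) * inner ℝ w (x - c) ∂(boundaryMeasure Ω) := by
  have h : Integrable (fun x : 𝔼 => (inner ℝ e (x - c) : ℝ) • (x - c)) (boundaryMeasure Ω) :=
    integrable_boundaryMeasure (by fun_prop) hΩb hH
  rw [real_inner_comm]
  change inner ℝ w (∫ x, (inner ℝ e (x - c) : ℝ) • (x - c) ∂(boundaryMeasure Ω)) = _
  rw [← integral_inner h]
  simp_rw [real_inner_smul_right]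

/-- The sum of the inverse eigenvalues is at least the trace of the form `∫_{∂Ω} u v` on the space
of affine functions of mean zero, with respect to the Dirichlet form. -/
theorem integral_sq_div_le_sum_inv_eigenvalue {Ω : Set 𝔼} (hΩ : IsOpen Ω)
    (hne : Ω.Nonempty) (hΩb : Bornology.IsBounded Ω)
    (hH : μHE[N - 1] (frontier Ω) ≠ ⊤) {c : 𝔼} (hc : ∫ x, (x - c) ∂(boundaryMeasure Ω) = 0)
    (hM : 0 < (boundaryMeasure Ω).real Set.univ) :
    ENNReal.ofReal ((∫ x, ‖x - c‖ ^ 2 ∂(boundaryMeasure Ω)) / volume.real Ω) ≤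
      ∑ k ∈ Finset.Icc 2 (N + 1), (eigenvalue Ω k)⁻¹ := by
  have hΩpos : 0 < volume.real Ω :=
    ENNReal.toReal_pos (hΩ.measure_pos volume hne).ne' hΩb.measure_lt_top.ne
  have hT : (momentOperator hΩb hH c).IsSymmetric := by
    intro e w
    rw [inner_momentOperator, real_inner_comm, inner_momentOperator]
    simp_rw [mul_comm]
  have hn : Module.finrank ℝ 𝔼 = N := by simp
  set b := hT.eigenvectorBasis hn with hb
  set κ := hT.eigenvalues hn with hκ
  have hanti : Antitone κ := hT.eigenvalues_antitone hn
  have hTb : ∀ i, momentOperator hΩb hH c (b i) = κ i • b i := fun i =>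
    hT.apply_eigenvectorBasis hn i
  have hquad : ∀ v : 𝔼, ∫ x, inner ℝ v (x - c) ^ 2 ∂(boundaryMeasure Ω) =
      inner ℝ (momentOperator hΩb hH c v) v := by
    intro v
    rw [inner_momentOperator]
    simp_rw [sq]
  have hterm : ∀ i : Fin N, ENNReal.ofReal (κ i / volume.real Ω) ≤ (eigenvalue Ω (i + 2))⁻¹ := by
    intro i
    -- `κ i` may vanish as long as the boundary is not known to span the space
    rcases le_or_gt (κ i) 0 with h0 | h0
    · rw [ENNReal.ofReal_of_nonpos (div_nonpos_of_nonpos_of_nonneg h0 hΩpos.le)]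
      exact zero_le
    · let ι : Fin (i + 1) → Fin N := Fin.castLE (Nat.succ_le_of_lt i.2)
      have hι : Function.Injective ι := Fin.castLE_injective _
      have h1 := eigenvalue_le_of_orthonormal hΩ hΩb hH hc hM
        (b := fun j => b (ι j)) (b.orthonormal.comp ι hι) h0 (fun a => ?_)
      · rw [ENNReal.le_inv_iff_le_inv]
        refine h1.trans (le_of_eq ?_)
        rw [← ENNReal.ofReal_inv_of_pos (by positivity), inv_div]
      · rw [hquad, map_sum]
        simp_rw [map_smul, hTb, smul_smul]
        have h3 : Orthonormal ℝ fun j => b (ι j) := b.orthonormal.comp ι hι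
        rw [h3.inner_sum, Finset.mul_sum]
        refine Finset.sum_le_sum fun j _ => ?_
        have h2 : κ i ≤ κ (ι j) := hanti (by
          rw [Fin.le_def]
          exact Nat.le_of_lt_succ j.2)
        simp only [conj_trivial]
        nlinarith [mul_le_mul_of_nonneg_right h2 (sq_nonneg (a j))]
  have hsum : ∑ k ∈ Finset.Icc 2 (N + 1), (eigenvalue Ω k)⁻¹ =
      ∑ i : Fin N, (eigenvalue Ω (i + 2))⁻¹ := by
    rw [Fin.sum_univ_eq_sum_range (fun i => (eigenvalue Ω (i + 2))⁻¹) N, Finset.range_eq_Ico,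
      Finset.sum_Ico_add' (fun k => (eigenvalue Ω k)⁻¹) 0 N 2]
    refine Finset.sum_congr ?_ fun _ _ => rfl
    ext k
    simp only [Finset.mem_Icc, Finset.mem_Ico]
    omega
  have hκ0 : ∀ i, κ i = ∫ x, inner ℝ (b i) (x - c) ^ 2 ∂(boundaryMeasure Ω) := by
    intro i
    rw [hquad, hTb, real_inner_smul_left, real_inner_self_eq_norm_sq, b.orthonormal.1 i]
    ring
  have htrace : ∫ x, ‖x - c‖ ^ 2 ∂(boundaryMeasure Ω) = ∑ i, κ i := by
    simp_rw [hκ0]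
    rw [← integral_finsetSum _ fun i _ => integrable_boundaryMeasure (by fun_prop) hΩb hH]
    refine integral_congr_ae (Eventually.of_forall fun x => ?_)
    simp only
    rw [← b.sum_sq_norm_inner_right (x - c)]
    simp
  rw [hsum, htrace, Finset.sum_div, ENNReal.ofReal_sum_of_nonneg]
  · exact Finset.sum_le_sum fun i _ => hterm i
  · intro i _
    rw [hκ0]
    exact div_nonneg (integral_nonneg fun x => sq_nonneg _) hΩpos.le

/-! ### The surface measure of a Lipschitz boundary -/

/-- Locally the boundary is the image of a bounded piece of a hyperplane under a Lipschitz map. -/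
lemma hausdorff_frontier_ne_top_of_hasLipschitzBoundary {Ω : Set 𝔼} (hΩ : IsOpen Ω)
    (hΩb : Bornology.IsBounded Ω) (hL : HasLipschitzBoundary Ω) :
    μHE[N - 1] (frontier Ω) ≠ ⊤ := by
  have hK : IsCompact (frontier Ω) :=
    Metric.isCompact_of_isClosed_isBounded isClosed_frontier
      (hΩb.closure.subset frontier_subset_closure)
  refine (hK.measure_lt_top_of_nhdsWithin fun p hp => ?_).ne
  obtain ⟨e, he, K, γ, hγ, U, hU, hpU, hUΩ⟩ := hL p hp
  have he0 : e ≠ 0 := by rintro rfl; simp at he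
  set s : Submodule ℝ 𝔼 := (ℝ ∙ e)ᗮ with hs
  have hrank : Module.finrank ℝ s = N - 1 := by
    have h1 : Module.finrank ℝ (ℝ ∙ e) + Module.finrank ℝ s = Module.finrank ℝ 𝔼 :=
      (ℝ ∙ e).finrank_add_finrank_orthogonal
    rw [finrank_span_singleton he0, finrank_euclideanSpace_fin] at h1
    exact Nat.eq_sub_of_add_eq' h1
  let Z : Set s := Metric.closedBall 0 (‖p‖ + 1)
  let g : s → 𝔼 := fun z => z + γ z • e
  have hg : LipschitzWith (1 + K) g := by
    refine LipschitzWith.of_dist_le_mul fun z w => ?_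
    have h1 : g z - g w = ((z : 𝔼) - w) + (γ z - γ w) • e := by
      simp only [g, sub_smul]; abel
    have h2 := hγ.dist_le_mul (z : 𝔼) w
    rw [Real.dist_eq, dist_eq_norm] at h2
    rw [dist_eq_norm, h1, Subtype.dist_eq, dist_eq_norm]
    calc ‖((z : 𝔼) - w) + (γ z - γ w) • e‖ ≤ ‖(z : 𝔼) - w‖ + ‖(γ z - γ w) • e‖ := norm_add_le _ _
      _ ≤ ‖(z : 𝔼) - w‖ + K * ‖(z : 𝔼) - w‖ := by
        gcongr
        rw [norm_smul, he, mul_one]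
        exact h2
      _ = _ := by push_cast; ring
  refine ⟨frontier Ω ∩ (U ∩ Metric.ball p 1), ?_, ?_⟩
  · exact inter_mem_nhdsWithin _ ((hU.inter Metric.isOpen_ball).mem_nhds
      ⟨hpU, Metric.mem_ball_self one_pos⟩)
  · -- near `p` the boundary is contained in the graph of `γ`
    have hsub : frontier Ω ∩ (U ∩ Metric.ball p 1) ⊆ g '' Z := by
      rintro x ⟨hxf, hxU, hxp⟩
      have hproj : x - inner ℝ e x • e ∈ s := by
        rw [hs, Submodule.mem_orthogonal_singleton_iff_inner_right, inner_sub_right,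
          real_inner_smul_right, real_inner_self_eq_norm_sq, he]
        norm_num
      have hγx : γ (x - inner ℝ e x • e) = inner ℝ e x := by
        have hxΩ : x ∉ Ω := by
          rw [hΩ.frontier_eq] at hxf
          exact hxf.2
        have h1 : inner ℝ e x ≤ γ (x - inner ℝ e x • e) := by
          by_contra h
          exact hxΩ ((hUΩ x hxU).2 (not_le.1 h))
        refine le_antisymm ?_ h1
        by_contra h
        have hopen : IsOpen {y : 𝔼 | inner ℝ e y < γ (y - inner ℝ e y • e)} := by
          have := hγ.continuous
          exact isOpen_lt (by fun_prop) (by fun_prop)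
        obtain ⟨y, ⟨hyU, hy⟩, hyΩ⟩ := mem_closure_iff.1 (frontier_subset_closure hxf) _
          (hU.inter hopen) ⟨hxU, not_le.1 h⟩
        exact lt_asymm hy ((hUΩ y hyU).1 hyΩ)
      refine ⟨⟨x - inner ℝ e x • e, hproj⟩, ?_, ?_⟩
      · have h1 : ‖x - inner ℝ e x • e‖ ≤ ‖x‖ := by
          refine le_of_sq_le_sq ?_ (norm_nonneg _)
          rw [norm_sub_sq_real, norm_smul, he, real_inner_smul_right, real_inner_comm,
            Real.norm_eq_abs, mul_one, sq_abs]
          nlinarith [sq_nonneg (inner ℝ e x : ℝ)]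
        have h2 : ‖x‖ ≤ ‖p‖ + 1 := by
          rw [mem_ball_iff_norm] at hxp
          have := norm_add_le p (x - p)
          rw [add_sub_cancel] at this
          linarith
        simp only [Z, mem_closedBall_zero_iff]
        exact h1.trans h2
      · simp only [g]
        rw [hγx, sub_add_cancel]
    refine (measure_mono hsub).trans_lt
      ((euclideanHausdorffMeasure_image_le hg.lipschitzOnWith (N - 1)).trans_lt ?_)
    refine ENNReal.mul_lt_top (by simp) ?_
    rw [← hrank, InnerProductSpace.euclideanHausdorffMeasure_eq_volume]
    exact measure_closedBall_lt_top

/-! ### The weighted isoperimetric inequality -/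

lemma divergence_sqrt_smul (c x : 𝔼) {ε : ℝ} (hε : 0 < ε) :
    divergence (fun x : 𝔼 => √(‖x - c‖ ^ 2 + ε ^ 2) • (x - c)) x =
      ‖x - c‖ ^ 2 / √(‖x - c‖ ^ 2 + ε ^ 2) + √(‖x - c‖ ^ 2 + ε ^ 2) * N := by
  have hpos : 0 < ‖x - c‖ ^ 2 + ε ^ 2 := by positivity
  have h1 : HasFDerivAt (fun x : 𝔼 => x - c) (ContinuousLinearMap.id ℝ 𝔼) x :=
    (hasFDerivAt_id x).sub_const c
  have h2 := (h1.norm_sq.add_const (ε ^ 2)).sqrt hpos.ne'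
  rw [divergence_smul h2.differentiableAt h1.differentiableAt, divergence_sub_const, h2.fderiv]
  congr 1
  change 1 / (2 * √(‖x - c‖ ^ 2 + ε ^ 2)) * (2 • inner ℝ (x - c) (x - c)) = _
  rw [real_inner_self_eq_norm_sq, nsmul_eq_mul, Nat.cast_ofNat]
  have := (Real.sqrt_pos.2 hpos).ne'
  field_simp

lemma contDiff_sqrt_smul (c : 𝔼) {ε : ℝ} (hε : 0 < ε) :
    ContDiff ℝ 1 fun x : 𝔼 => √(‖x - c‖ ^ 2 + ε ^ 2) • (x - c) := by
  have hX : ContDiff ℝ 1 fun x : 𝔼 => x - c := contDiff_id.sub contDiff_const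
  exact (((hX.norm_sq ℝ).add contDiff_const).sqrt fun x => by positivity).smul hX

lemma sqrt_sq_add_sq_le {a ε : ℝ} (ha : 0 ≤ a) (hε : 0 < ε) : √(a ^ 2 + ε ^ 2) ≤ a + ε := by
  rw [Real.sqrt_le_left (by positivity)]
  nlinarith [mul_nonneg ha hε.le]

lemma le_sqrt_sq_add_sq (a ε : ℝ) : a ≤ √(a ^ 2 + ε ^ 2) :=
  Real.le_sqrt_of_sq_le (by nlinarith [sq_nonneg ε])

/-- The divergence inequality for the field `‖x - c‖ (x - c)`, which is regularized at `c`. -/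
lemma mul_integral_norm_le {Ω : Set 𝔼} (hΩ : IsOpen Ω) (hΩb : Bornology.IsBounded Ω)
    (hH : μHE[N - 1] (frontier Ω) ≠ ⊤) (c : 𝔼) :
    (N + 1) * ∫ x in Ω, ‖x - c‖ ≤ ∫ x, ‖x - c‖ ^ 2 ∂(boundaryMeasure Ω) := by
  have hi1 : IntegrableOn (fun x : 𝔼 => ‖x - c‖) Ω :=
    integrableOn_of_continuous_of_isBounded (by fun_prop) hΩb
  have hi2 : Integrable (fun x : 𝔼 => ‖x - c‖ ^ 2) (boundaryMeasure Ω) :=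
    integrable_boundaryMeasure (by fun_prop) hΩb hH
  have hi3 : Integrable (fun x : 𝔼 => ‖x - c‖) (boundaryMeasure Ω) :=
    integrable_boundaryMeasure (by fun_prop) hΩb hH
  have hic : IntegrableOn (fun _ : 𝔼 => (1 : ℝ)) Ω :=
    integrableOn_of_continuous_of_isBounded continuous_const hΩb
  set m := volume.real Ω
  set A := ∫ x in Ω, ‖x - c‖ with hA
  set B := ∫ x, ‖x - c‖ ^ 2 ∂(boundaryMeasure Ω) with hB
  set D := ∫ x, ‖x - c‖ ∂(boundaryMeasure Ω) with hD
  have hbound : ∀ ε : ℝ, 0 < ε → (N + 1) * A - ε * m ≤ B + ε * D := by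
    intro ε hε
    have hV := contDiff_sqrt_smul c hε
    have h1 := integral_divergence_le hΩ hΩb hH hV
    have h2 : (N + 1) * A - ε * m ≤
        ∫ x in Ω, divergence (fun x : 𝔼 => √(‖x - c‖ ^ 2 + ε ^ 2) • (x - c)) x := by
      have h3 : (N + 1) * A - ε * m = ∫ x in Ω, ((N + 1) * ‖x - c‖ - ε * 1) := by
        rw [integral_sub (hi1.const_mul _) (hic.const_mul _), integral_const_mul,
          integral_const_mul, setIntegral_const, smul_eq_mul, mul_one]
      rw [h3]
      refine integral_mono ((hi1.const_mul _).sub (hic.const_mul _))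
        (integrableOn_of_continuous_of_isBounded (continuous_divergence hV) hΩb) fun x => ?_
      simp only
      rw [divergence_sqrt_smul c x hε]
      have h4 := sqrt_sq_add_sq_le (norm_nonneg (x - c)) hε
      have h5 := le_sqrt_sq_add_sq ‖x - c‖ ε
      have hs : 0 < √(‖x - c‖ ^ 2 + ε ^ 2) := by positivity
      have h6 : ‖x - c‖ - ε ≤ ‖x - c‖ ^ 2 / √(‖x - c‖ ^ 2 + ε ^ 2) := by
        rw [le_div_iff₀ hs]
        rcases le_total (‖x - c‖) ε with h | h
        · nlinarith [sq_nonneg ‖x - c‖, mul_nonneg (sub_nonneg.2 h) hs.le]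
        · nlinarith [mul_le_mul_of_nonneg_left h4 (sub_nonneg.2 h), sq_nonneg ε]
      nlinarith [mul_le_mul_of_nonneg_right h5 (Nat.cast_nonneg (α := ℝ) N)]
    have h7 : ∫ x, ‖√(‖x - c‖ ^ 2 + ε ^ 2) • (x - c)‖ ∂(boundaryMeasure Ω) ≤ B + ε * D := by
      rw [hB, hD, ← integral_const_mul, ← integral_add hi2 (hi3.const_mul _)]
      refine integral_mono (integrable_boundaryMeasure hV.continuous.norm hΩb hH)
        (hi2.add (hi3.const_mul _)) fun x => ?_
      simp only
      rw [norm_smul, Real.norm_of_nonneg (Real.sqrt_nonneg _)]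
      have h4 := sqrt_sq_add_sq_le (norm_nonneg (x - c)) hε
      nlinarith [mul_le_mul_of_nonneg_right h4 (norm_nonneg (x - c))]
    linarith
  have hl1 : Tendsto (fun ε : ℝ => (N + 1) * A - ε * m) (𝓝[>] 0) (𝓝 ((N + 1) * A)) := by
    have : Continuous fun ε : ℝ => (N + 1) * A - ε * m := by fun_prop
    simpa using (this.tendsto 0).mono_left (nhdsWithin_le_nhds (s := Set.Ioi 0))
  have hl2 : Tendsto (fun ε : ℝ => B + ε * D) (𝓝[>] 0) (𝓝 B) := by
    have : Continuous fun ε : ℝ => B + ε * D := by fun_prop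
    simpa using (this.tendsto 0).mono_left (nhdsWithin_le_nhds (s := Set.Ioi 0))
  exact le_of_tendsto_of_tendsto hl1 hl2
    (by filter_upwards [self_mem_nhdsWithin] with ε hε using hbound ε hε)

/-- On a ball around `c` the field `‖x - c‖ (x - c)` is radial, and equality holds in the previous
inequality; this is the half of it which is not covered there. -/
lemma le_mul_integral_norm_ball (hN : 1 ≤ N) (c : 𝔼) {r : ℝ} (hr : 0 < r) :
    N * (r * volume.real (Metric.ball c r)) ≤ (N + 1) * ∫ x in Metric.ball c r, ‖x - c‖ := by
  have hH := hausdorff_frontier_ball_ne_top hN c hr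
  have hb : Bornology.IsBounded (Metric.ball c r) := Metric.isBounded_ball
  have hfin := isFiniteMeasure_boundaryMeasure_ball hN c hr
  have hi1 : IntegrableOn (fun x : 𝔼 => ‖x - c‖) (Metric.ball c r) :=
    integrableOn_of_continuous_of_isBounded (by fun_prop) hb
  have hic : IntegrableOn (fun _ : 𝔼 => (1 : ℝ)) (Metric.ball c r) :=
    integrableOn_of_continuous_of_isBounded continuous_const hb
  set m := volume.real (Metric.ball c r)
  set A := ∫ x in Metric.ball c r, ‖x - c‖ with hA
  have hbound : ∀ ε : ℝ, 0 < ε → N * (r * m) ≤ (N + 1) * A + ε * (N * m) := by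
    intro ε hε
    have hV := contDiff_sqrt_smul c hε
    have h1 := integral_divergence_ball hN c hr hV
    have h2 : ∫ x in Metric.ball c r,
        divergence (fun x : 𝔼 => √(‖x - c‖ ^ 2 + ε ^ 2) • (x - c)) x ≤
        (N + 1) * A + ε * (N * m) := by
      have h3 : (N + 1) * A + ε * (N * m) =
          ∫ x in Metric.ball c r, ((N + 1) * ‖x - c‖ + ε * (N * 1)) := by
        rw [integral_add (hi1.const_mul _) ((hic.const_mul _).const_mul _), integral_const_mul,
          integral_const_mul, integral_const_mul, setIntegral_const, smul_eq_mul, mul_one]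
      rw [h3]
      refine integral_mono (integrableOn_of_continuous_of_isBounded (continuous_divergence hV) hb)
        ((hi1.const_mul _).add ((hic.const_mul _).const_mul _)) fun x => ?_
      simp only
      rw [divergence_sqrt_smul c x hε]
      have h4 := sqrt_sq_add_sq_le (norm_nonneg (x - c)) hε
      have h5 := le_sqrt_sq_add_sq ‖x - c‖ ε
      have hs : 0 < √(‖x - c‖ ^ 2 + ε ^ 2) := by positivity
      have h6 : ‖x - c‖ ^ 2 / √(‖x - c‖ ^ 2 + ε ^ 2) ≤ ‖x - c‖ := by
        rw [div_le_iff₀ hs]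
        nlinarith [mul_le_mul_of_nonneg_left h5 (norm_nonneg (x - c))]
      nlinarith [mul_le_mul_of_nonneg_right h4 (Nat.cast_nonneg (α := ℝ) N)]
    have h7 : ∫ x, inner ℝ (x - c) (√(‖x - c‖ ^ 2 + ε ^ 2) • (x - c))
        ∂(boundaryMeasure (Metric.ball c r)) =
        ∫ x, √(r ^ 2 + ε ^ 2) * r ^ 2 ∂(boundaryMeasure (Metric.ball c r)) := by
      refine setIntegral_congr_fun isClosed_frontier.measurableSet fun x hx => ?_
      rw [frontier_ball c hr.ne', mem_sphere_iff_norm] at hx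
      rw [real_inner_smul_right, real_inner_self_eq_norm_sq, hx]
    rw [h7, integral_const, smul_eq_mul] at h1
    have h8 := mul_boundaryMeasure_ball_eq hN hr c
    have h9 : r * ∫ x in Metric.ball c r,
        divergence (fun x : 𝔼 => √(‖x - c‖ ^ 2 + ε ^ 2) • (x - c)) x =
        r * (√(r ^ 2 + ε ^ 2) * (N * m)) := by
      rw [h1, ← h8]; ring
    have h10 := mul_left_cancel₀ hr.ne' h9
    rw [h10] at h2
    have h11 := le_sqrt_sq_add_sq r ε
    have h12 : 0 ≤ N * m := mul_nonneg (Nat.cast_nonneg N) measureReal_nonneg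
    nlinarith [mul_le_mul_of_nonneg_right h11 h12]
  have hl2 : Tendsto (fun ε : ℝ => (N + 1) * A + ε * (N * m)) (𝓝[>] 0) (𝓝 ((N + 1) * A)) := by
    have : Continuous fun ε : ℝ => (N + 1) * A + ε * (N * m) := by fun_prop
    simpa using (this.tendsto 0).mono_left (nhdsWithin_le_nhds (s := Set.Ioi 0))
  exact ge_of_tendsto hl2
    (by filter_upwards [self_mem_nhdsWithin] with ε hε using hbound ε hε)

/-! ### Stability of the weighted isoperimetric inequality -/

lemma volume_real_ball (c : 𝔼) {r : ℝ} (hr : 0 < r) :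
    volume.real (Metric.ball c r) = r ^ N * unitBallVolume N := by
  rw [Measure.real, Measure.addHaar_ball_of_pos _ _ hr, ENNReal.toReal_mul,
    ENNReal.toReal_ofReal (by positivity), finrank_euclideanSpace_fin]
  rfl

lemma unitBallVolume_pos (N : ℕ) : 0 < unitBallVolume N :=
  ENNReal.toReal_pos (Metric.measure_ball_pos _ _ one_pos).ne' measure_ball_lt_top.ne

lemma one_add_mul_le_one_add_rpow {p s : ℝ} (hp0 : 0 ≤ p) (hp1 : p ≤ 1) (hs0 : 0 ≤ s)
    (hs1 : s ≤ 1) : 1 + ((2 : ℝ) ^ p - 1) * s ≤ (1 + s) ^ p := by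
  have h := (Real.concaveOn_rpow hp0 hp1).2 (x := 1) (y := 2) (by simp) (by simp)
    (sub_nonneg.2 hs1) hs0 (by ring)
  simp only [smul_eq_mul, Real.one_rpow] at h
  calc 1 + ((2 : ℝ) ^ p - 1) * s = (1 - s) * 1 + s * 2 ^ p := by ring
    _ ≤ ((1 - s) * 1 + s * 2) ^ p := h
    _ = (1 + s) ^ p := by ring_nf

lemma two_rpow_sub_one_le {p : ℝ} (hp0 : 0 ≤ p) (hp1 : p ≤ 1) : (2 : ℝ) ^ p - 1 ≤ p := by
  have h := rpow_one_add_le_one_add_mul_self (s := 1) (by norm_num) hp0 hp1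
  norm_num at h
  linarith

lemma one_sub_rpow_le {p s : ℝ} (hp0 : 0 ≤ p) (hp1 : p ≤ 1) (hs0 : 0 ≤ s) (hs1 : s ≤ 1) :
    (1 - s) ^ p ≤ 1 - ((2 : ℝ) ^ p - 1) * s := by
  have h := rpow_one_add_le_one_add_mul_self (s := -s) (by linarith) hp0 hp1
  rw [← sub_eq_add_neg] at h
  nlinarith [mul_le_mul_of_nonneg_right (two_rpow_sub_one_le hp0 hp1) hs0]

lemma mul_sub_le_setIntegral {X : Type*} [MeasurableSpace X] {μ : Measure X} {A T : Set X}
    (hA : MeasurableSet A) (hT : MeasurableSet T) (hAfin : μ A ≠ ⊤) (hTfin : μ T ≠ ⊤)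
    {ψ : X → ℝ} (hψ : IntegrableOn ψ A μ) (h0 : ∀ x ∈ A, 0 ≤ ψ x) {a : ℝ} (ha : 0 ≤ a)
    (h : ∀ x ∈ A \ T, a ≤ ψ x) : a * (μ.real A - μ.real T) ≤ ∫ x in A, ψ x ∂μ := by
  have hfin : μ (A \ T) ≠ ⊤ := measure_ne_top_of_subset Set.sdiff_subset hAfin
  calc a * (μ.real A - μ.real T) ≤ a * μ.real (A \ T) := by
        gcongr
        exact le_measureReal_sdiff
    _ = ∫ _ in A \ T, a ∂μ := by rw [setIntegral_const, smul_eq_mul, mul_comm]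
    _ ≤ ∫ x in A \ T, ψ x ∂μ :=
        setIntegral_mono_on (integrableOn_const hfin) (hψ.mono_set Set.sdiff_subset)
          (hA.diff hT) h
    _ ≤ ∫ x in A, ψ x ∂μ := by
        refine setIntegral_mono_set hψ ?_ (Filter.Eventually.of_forall Set.sdiff_subset)
        filter_upwards [ae_restrict_mem hA] with x hx using h0 x hx

/-- Among the sets of given volume the ball minimizes `∫ ‖x - c‖`, and the defect controls the
square of the asymmetry. Half of the mass of `Ω \ B` lies outside the concentric ball whose volume
exceeds that of `B` by half of that mass, and likewise half of the mass of `B \ Ω` lies in a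
smaller ball. -/
lemma mul_symmDiff_sq_le_integral_norm_sub (hN : 1 ≤ N) {Ω : Set 𝔼} (hΩ : MeasurableSet Ω)
    (hΩb : Bornology.IsBounded Ω) (c : 𝔼) {R : ℝ} (hR : 0 < R)
    (hvol : volume.real Ω = volume.real (Metric.ball c R)) :
    R * ((2 : ℝ) ^ (1 / (N : ℝ)) - 1) *
        (volume.real (symmDiff Ω (Metric.ball c R)) / volume.real Ω) ^ 2 / 8 * volume.real Ω ≤
      (∫ x in Ω, ‖x - c‖) - ∫ x in Metric.ball c R, ‖x - c‖ := by
  set B : Set 𝔼 := Metric.ball c R with hB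
  set m := volume.real Ω with hm
  set κ := (2 : ℝ) ^ (1 / (N : ℝ)) - 1 with hκ
  have hN' : (1 : ℝ) ≤ N := by exact_mod_cast hN
  have hN0 : N ≠ 0 := by omega
  have hp0 : 0 ≤ 1 / (N : ℝ) := by positivity
  have hp1 : 1 / (N : ℝ) ≤ 1 := by rw [div_le_one (by positivity)]; exact hN'
  have hBmeas : MeasurableSet B := measurableSet_ball
  have hBb : Bornology.IsBounded B := Metric.isBounded_ball
  have hΩfin : volume Ω ≠ ⊤ := hΩb.measure_lt_top.ne
  have hBfin : volume B ≠ ⊤ := hBb.measure_lt_top.ne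
  have hm0 : 0 < m := by
    rw [hvol]
    exact ENNReal.toReal_pos (Metric.measure_ball_pos _ _ hR).ne' hBfin
  have hint : ∀ S : Set 𝔼, Bornology.IsBounded S → IntegrableOn (fun x : 𝔼 => ‖x - c‖) S :=
    fun S hS => integrableOn_of_continuous_of_isBounded (by fun_prop) hS
  have hAb : Bornology.IsBounded (Ω \ B) := hΩb.subset Set.sdiff_subset
  have hA'b : Bornology.IsBounded (B \ Ω) := hBb.subset Set.sdiff_subset
  have hAc : IntegrableOn (fun _ : 𝔼 => R) (Ω \ B) := integrableOn_const hAb.measure_lt_top.ne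
  have hA'c : IntegrableOn (fun _ : 𝔼 => R) (B \ Ω) := integrableOn_const hA'b.measure_lt_top.ne
  have hcap : volume.real (Ω ∩ B) + volume.real (Ω \ B) = m :=
    measureReal_inter_add_sdiff hBmeas hΩfin
  have hcap' : volume.real (Ω ∩ B) + volume.real (B \ Ω) = m := by
    rw [Set.inter_comm, hvol]
    exact measureReal_inter_add_sdiff hΩ hBfin
  set δ := volume.real (Ω \ B) with hδ
  have hδ' : volume.real (B \ Ω) = δ := by linarith
  have hδ0 : 0 ≤ δ := measureReal_nonneg
  have hδm : δ ≤ m := by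
    have : 0 ≤ volume.real (Ω ∩ B) := measureReal_nonneg
    linarith
  have hsymm : volume.real (symmDiff Ω B) = 2 * δ := by
    rw [measureReal_symmDiff_eq hΩ hBmeas hΩfin hBfin, hδ']
    ring
  set s := δ / m / 2 with hs
  have hs0 : 0 ≤ s := by positivity
  have hs1 : s ≤ 1 / 2 := by
    have : δ / m ≤ 1 := (div_le_one hm0).2 hδm
    linarith
  have hms : m * s = δ / 2 := by rw [hs]; field_simp
  have hκ0 : 0 ≤ κ := by
    have := Real.one_le_rpow (one_le_two (α := ℝ)) hp0
    rw [hκ]; linarith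
  -- a concentric ball of prescribed volume
  have hball : ∀ a : ℝ, 0 < a → volume.real (Metric.ball c (R * a ^ (1 / (N : ℝ)))) = m * a := by
    intro a ha
    rw [volume_real_ball c (by positivity), mul_pow, one_div,
      Real.rpow_inv_natCast_pow ha.le hN0, hvol, volume_real_ball c hR]
    ring
  have houter : R * κ * s * (δ / 2) ≤ ∫ x in Ω \ B, (‖x - c‖ - R) := by
    set R' := R * (1 + s) ^ (1 / (N : ℝ)) with hR'
    have hRR' : R * κ * s ≤ R' - R := by
      have := mul_le_mul_of_nonneg_left
        (one_add_mul_le_one_add_rpow hp0 hp1 hs0 (by linarith)) hR.le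
      rw [hR', hκ]; linarith
    have hle : R ≤ R' := by
      have : 0 ≤ R * κ * s := by positivity
      linarith
    have hT : volume.real (Metric.ball c R' \ B) = δ / 2 := by
      rw [measureReal_sdiff (Metric.ball_subset_ball hle) hBmeas
        Metric.isBounded_ball.measure_lt_top.ne, hball _ (by linarith), ← hvol]
      linarith
    have := mul_sub_le_setIntegral (μ := volume) (hΩ.diff hBmeas)
      (measurableSet_ball.diff hBmeas) (T := Metric.ball c R' \ B) hAb.measure_lt_top.ne
      (Metric.isBounded_ball.subset Set.sdiff_subset).measure_lt_top.ne
      (ψ := fun x => ‖x - c‖ - R) ((hint _ hAb).sub hAc)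
      (fun x hx => by
        have := hx.2
        rw [hB, mem_ball_iff_norm, not_lt] at this
        linarith) (sub_nonneg.2 hle)
      (fun x hx => by
        have : x ∉ Metric.ball c R' := fun h => hx.2 ⟨h, hx.1.2⟩
        rw [mem_ball_iff_norm, not_lt] at this
        linarith)
    rw [hT, ← hδ] at this
    refine le_trans ?_ this
    rw [show δ - δ / 2 = δ / 2 by ring]
    gcongr
  have hinner : R * κ * s * (δ / 2) ≤ ∫ x in B \ Ω, (R - ‖x - c‖) := by
    set R' := R * (1 - s) ^ (1 / (N : ℝ)) with hR'
    have hRR' : R * κ * s ≤ R - R' := by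
      have := mul_le_mul_of_nonneg_left (one_sub_rpow_le hp0 hp1 hs0 (by linarith)) hR.le
      rw [hR', hκ]; linarith
    have hle : R' ≤ R := by
      have : 0 ≤ R * κ * s := by positivity
      linarith
    have hT : volume.real (B \ Metric.ball c R') = δ / 2 := by
      rw [measureReal_sdiff (Metric.ball_subset_ball hle) measurableSet_ball hBfin,
        hball _ (by linarith), ← hvol]
      linarith
    have := mul_sub_le_setIntegral (μ := volume) (hBmeas.diff hΩ)
      (hBmeas.diff measurableSet_ball) (T := B \ Metric.ball c R') hA'b.measure_lt_top.ne
      (hBb.subset Set.sdiff_subset).measure_lt_top.ne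
      (ψ := fun x => R - ‖x - c‖)
      (hA'c.sub (hint _ hA'b))
      (fun x hx => by
        have := hx.1
        rw [hB, mem_ball_iff_norm] at this
        linarith) (sub_nonneg.2 hle)
      (fun x hx => by
        have : x ∈ Metric.ball c R' := by
          by_contra h
          exact hx.2 ⟨hx.1.1, h⟩
        rw [mem_ball_iff_norm] at this
        linarith)
    rw [hT, hδ'] at this
    refine le_trans ?_ this
    rw [show δ - δ / 2 = δ / 2 by ring]
    gcongr
  rw [integral_sub (hint _ hAb) hAc, setIntegral_const,
    ← hδ, smul_eq_mul] at houter
  rw [integral_sub hA'c (hint _ hA'b), setIntegral_const,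
    hδ', smul_eq_mul] at hinner
  have e1 := integral_inter_add_sdiff hBmeas (hint Ω hΩb)
  have e2 := integral_inter_add_sdiff hΩ (hint B hBb)
  rw [Set.inter_comm] at e2
  have hlhs : R * κ * (volume.real (symmDiff Ω B) / m) ^ 2 / 8 * m =
      2 * (R * κ * s * (δ / 2)) := by
    rw [hsymm, hs]
    field_simp
    ring
  rw [hlhs]
  linarith

lemma stabilityConst_pos (hN : 1 ≤ N) : 0 < stabilityConst N := by
  have hN' : (0 : ℝ) < N := by exact_mod_cast hN
  have h1 : 0 < (2 : ℝ) ^ (1 / (N : ℝ)) - 1 :=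
    sub_pos.2 (Real.one_lt_rpow one_lt_two (by positivity))
  have h2 := unitBallVolume_pos N
  rw [stabilityConst]
  positivity

/-- The moment of inertia of the boundary about any point `c`, compared with that of the sphere
bounding a ball about `c` with the same volume. -/
lemma mul_add_stabilityConst_le (hN : 1 ≤ N) {Ω : Set 𝔼} (hΩ : IsOpen Ω)
    (hΩb : Bornology.IsBounded Ω) (hH : μHE[N - 1] (frontier Ω) ≠ ⊤)
    (hm0 : 0 < volume.real Ω) (c : 𝔼) :
    N / unitBallVolume N ^ (1 / (N : ℝ)) + stabilityConst N *
        (volume.real (symmDiff Ω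
          (Metric.ball c ((volume.real Ω / unitBallVolume N) ^ (1 / (N : ℝ))))) /
            volume.real Ω) ^ 2 ≤
      (volume.real Ω ^ (1 / (N : ℝ)))⁻¹ *
        ((∫ x, ‖x - c‖ ^ 2 ∂(boundaryMeasure Ω)) / volume.real Ω) := by
  have hω := unitBallVolume_pos N
  have hN0 : N ≠ 0 := by omega
  have hN' : (1 : ℝ) ≤ N := by exact_mod_cast hN
  have hp0 : 0 ≤ 1 / (N : ℝ) := by positivity
  have hp1 : 1 / (N : ℝ) ≤ 1 := by rw [div_le_one (by positivity)]; exact hN'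
  set R := (volume.real Ω / unitBallVolume N) ^ (1 / (N : ℝ)) with hRdef
  have hR : 0 < R := by positivity
  have hvol : volume.real Ω = volume.real (Metric.ball c R) := by
    rw [volume_real_ball c hR, hRdef, one_div, Real.rpow_inv_natCast_pow (by positivity) hN0,
      div_mul_cancel₀ _ hω.ne']
  have h1 := mul_integral_norm_le hΩ hΩb hH c
  have h2 := le_mul_integral_norm_ball hN c hR
  have h3 := mul_symmDiff_sq_le_integral_norm_sub hN hΩ.measurableSet hΩb c hR hvol
  rw [← hvol] at h2
  set m := volume.real Ω with hm
  set α := volume.real (symmDiff Ω (Metric.ball c R)) / m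
  set κ := (2 : ℝ) ^ (1 / (N : ℝ)) - 1 with hκ
  set w := unitBallVolume N ^ (1 / (N : ℝ)) with hw
  set q := m ^ (1 / (N : ℝ)) with hq
  have hw0 : 0 < w := by positivity
  have hq0 : 0 < q := by positivity
  have hRq : R = q / w := by rw [hRdef, Real.div_rpow hm0.le hω.le]
  have hκ0 : 0 ≤ κ := by
    have := Real.one_le_rpow (one_le_two (α := ℝ)) hp0
    rw [hκ]; linarith
  have hNκ : N * κ ≤ 1 := by
    have := mul_le_mul_of_nonneg_left (two_rpow_sub_one_le hp0 hp1) (Nat.cast_nonneg (α := ℝ) N)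
    rwa [mul_one_div_cancel (by positivity)] at this
  have h4 : N * R + (N + 1) * (R * κ * α ^ 2 / 8) ≤
      (∫ x, ‖x - c‖ ^ 2 ∂(boundaryMeasure Ω)) / m := by
    rw [le_div_iff₀ hm0]
    have := mul_le_mul_of_nonneg_left h3 (by positivity : (0 : ℝ) ≤ N + 1)
    linarith
  have h5 := mul_le_mul_of_nonneg_left h4 (inv_pos.2 hq0).le
  refine le_trans ?_ h5
  have h6 : q⁻¹ * (N * R + (N + 1) * (R * κ * α ^ 2 / 8)) =
      N / w + (N + 1) / w * κ / 8 * α ^ 2 := by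
    rw [hRq]; field_simp
  rw [h6]
  have h7 : stabilityConst N * α ^ 2 = (N + 1) / w * κ / 8 * α ^ 2 * (N * κ) := by
    rw [stabilityConst, ← hκ, ← hw]; ring
  rw [h7]
  have h8 : 0 ≤ (N + 1) / w * κ / 8 * α ^ 2 := by positivity
  linarith [mul_le_of_le_one_right h8 hNκ]

/-! ### The two sides of the inequality -/

lemma scaledInverseSum_ball_le (hN : 1 ≤ N) (y : 𝔼) {r : ℝ} (hr : 0 < r) :
    scaledInverseSum (Metric.ball y r) ≤
      ENNReal.ofReal (N / unitBallVolume N ^ (1 / (N : ℝ))) := by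
  have hω := unitBallVolume_pos N
  have hN0 : N ≠ 0 := by omega
  have hv : volume (Metric.ball y r) = ENNReal.ofReal (r ^ N * unitBallVolume N) := by
    rw [← volume_real_ball y hr, ofReal_measureReal measure_ball_lt_top.ne]
  have hsum : ∑ k ∈ Finset.Icc 2 (N + 1), (eigenvalue (Metric.ball y r) k)⁻¹ ≤
      ENNReal.ofReal (N * r) := by
    calc ∑ k ∈ Finset.Icc 2 (N + 1), (eigenvalue (Metric.ball y r) k)⁻¹
        ≤ ∑ _k ∈ Finset.Icc 2 (N + 1), ENNReal.ofReal r := by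
          refine Finset.sum_le_sum fun k hk => ?_
          rw [Finset.mem_Icc] at hk
          exact ENNReal.inv_le_iff_inv_le.1 (inv_le_eigenvalue_ball hN y hr hk.1 hk.2)
      _ = ENNReal.ofReal (N * r) := by
          rw [Finset.sum_const, Nat.card_Icc, nsmul_eq_mul,
            ENNReal.ofReal_mul (Nat.cast_nonneg N), ENNReal.ofReal_natCast]
          congr 2
  rw [scaledInverseSum, hv, ENNReal.ofReal_rpow_of_pos (by positivity),
    ← ENNReal.ofReal_inv_of_pos (by positivity)]
  refine (mul_le_mul_right hsum _).trans ?_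
  rw [← ENNReal.ofReal_mul (by positivity)]
  refine ENNReal.ofReal_le_ofReal (le_of_eq ?_)
  rw [Real.mul_rpow (by positivity) hω.le, one_div, Real.pow_rpow_inv_natCast hr.le hN0]
  field_simp

lemma integral_sub_boundaryBarycenter {Ω : Set 𝔼} (hΩb : Bornology.IsBounded Ω)
    (hH : μHE[N - 1] (frontier Ω) ≠ ⊤) (hM : 0 < (boundaryMeasure Ω).real Set.univ) :
    ∫ x, (x - boundaryBarycenter Ω) ∂(boundaryMeasure Ω) = 0 := by
  rw [integral_sub (integrable_boundaryMeasure (f := fun x : 𝔼 => x) continuous_id hΩb hH)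
    (integrable_boundaryMeasure continuous_const hΩb hH), integral_const, boundaryBarycenter,
    average_eq, smul_smul, mul_inv_cancel₀ hM.ne', one_smul]
  exact sub_self _

lemma boundaryMeasure_real_univ_pos (hN : 1 ≤ N) {Ω : Set 𝔼} (hΩ : IsOpen Ω)
    (hΩb : Bornology.IsBounded Ω) (hH : μHE[N - 1] (frontier Ω) ≠ ⊤)
    (hm0 : 0 < volume.real Ω) : 0 < (boundaryMeasure Ω).real Set.univ := by
  refine measureReal_nonneg.lt_of_ne fun h => ?_
  have h1 := integral_divergence_le hΩ hΩb hH (V := fun x => x - 0)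
    (contDiff_id.sub contDiff_const)
  have h0 : boundaryMeasure Ω Set.univ = 0 := by
    rw [Measure.real, eq_comm, ENNReal.toReal_eq_zero_iff] at h
    refine h.resolve_right ?_
    rwa [boundaryMeasure, Measure.restrict_apply_univ]
  rw [Measure.measure_univ_eq_zero.1 h0, integral_zero_measure] at h1
  simp only [divergence_sub_const, setIntegral_const, smul_eq_mul] at h1
  have hN' : (0 : ℝ) < N := by exact_mod_cast hN
  exact absurd h1 (not_le.2 (mul_pos hm0 hN'))

lemma ofReal_le_scaledInverseSum (hN : 1 ≤ N) {Ω : Set 𝔼} (hΩ : IsOpen Ω) (hne : Ω.Nonempty)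
    (hΩb : Bornology.IsBounded Ω) (hH : μHE[N - 1] (frontier Ω) ≠ ⊤) :
    ENNReal.ofReal (N / unitBallVolume N ^ (1 / (N : ℝ)) + stabilityConst N *
        (volume.real (symmDiff Ω ((fun x => x + boundaryBarycenter Ω) '' symmBall Ω)) /
          volume.real Ω) ^ 2) ≤ scaledInverseSum Ω := by
  have hfin : volume Ω ≠ ⊤ := hΩb.measure_lt_top.ne
  have hm0 : 0 < volume.real Ω := ENNReal.toReal_pos (hΩ.measure_pos _ hne).ne' hfin
  have hM := boundaryMeasure_real_univ_pos hN hΩ hΩb hH hm0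
  set c := boundaryBarycenter Ω with hc
  have himg : (fun x => x + c) '' symmBall Ω =
      Metric.ball c ((volume.real Ω / unitBallVolume N) ^ (1 / (N : ℝ))) := by
    rw [symmBall, Set.image_add_right]
    ext x
    simp [dist_eq_norm, sub_eq_add_neg]
  rw [himg]
  refine (ENNReal.ofReal_le_ofReal (mul_add_stabilityConst_le hN hΩ hΩb hH hm0 c)).trans ?_
  rw [ENNReal.ofReal_mul (by positivity), ENNReal.ofReal_inv_of_pos (by positivity),
    ← ENNReal.ofReal_rpow_of_pos hm0, ofReal_measureReal hfin, scaledInverseSum]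
  exact mul_le_mul_right (integral_sq_div_le_sum_inv_eigenvalue hΩ hne hΩb hH
    (integral_sub_boundaryBarycenter hΩb hH hM) hM) _

end Steklov

theorem mainTheorem7 (N : ℕ) (hN : 1 ≤ N) (Ω : Set (EuclideanSpace ℝ (Fin N)))
    (hΩ_open : IsOpen Ω) (hΩ_nonempty : Ω.Nonempty) (hΩ_bdd : Bornology.IsBounded Ω)
    (hΩ_lip : Steklov.HasLipschitzBoundary Ω)
    (y : EuclideanSpace ℝ (Fin N)) (r : ℝ) (hr : 0 < r) :
    0 < Steklov.stabilityConst N ∧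
    ((Steklov.stabilityConst N *
        (volume.real (symmDiff Ω
            ((fun x => x + Steklov.boundaryBarycenter Ω) '' Steklov.symmBall Ω)) /
          volume.real Ω) ^ 2 : ℝ) : EReal) ≤
      (Steklov.scaledInverseSum Ω : EReal) -
        (Steklov.scaledInverseSum (Metric.ball y r) : EReal) := by
  have hpos := Steklov.stabilityConst_pos hN
  refine ⟨hpos, ?_⟩
  have hH := Steklov.hausdorff_frontier_ne_top_of_hasLipschitzBoundary hΩ_open hΩ_bdd hΩ_lip
  have hX := Steklov.ofReal_le_scaledInverseSum hN hΩ_open hΩ_nonempty hΩ_bdd hH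
  have hY := Steklov.scaledInverseSum_ball_le hN y hr
  have hω := Steklov.unitBallVolume_pos N
  refine le_trans (le_of_eq ?_) (EReal.sub_le_sub (EReal.coe_ennreal_le_coe_ennreal_iff.2 hX)
    (EReal.coe_ennreal_le_coe_ennreal_iff.2 hY))
  rw [EReal.coe_ennreal_ofReal, EReal.coe_ennreal_ofReal, max_eq_left (by positivity),
    max_eq_left (by positivity), ← EReal.coe_sub, add_sub_cancel_left]
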